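/- **Setting.** Let $\mathbf k$ be a field of characteristic zero or, more generally, a $\mathbb Z_2$-graded commutative ring whose even part $\mathbf k_0$ is a field of characteristic zero. Let $V=V_0\oplus V_1$ be a $\mathbb Z_2$-graded $\mathbf k$-module (with $vt=(-1)^{|t||v|}tv$), equipped with an inner product: an even right $\mathbf k$-module homomorphism $\langle\cdot,\cdot\rangle:V\otimes V\to\mathbf k$ which is graded symmetric, $\langle v,w\rangle=(-1)^{|v||w|}\langle w,v\rangle$, and non-degenerate in the sense that $v\mapsto\langle v,\cdot\rangle$ is an isomorphism $V\to\mathrm{Hom}(V,\mathbf k)$. For $v_1,\dots,v_n$ homogeneous and a permutation $\sigma$, let $\epsilon(\sigma)$ be the Koszul sign of $v_1\cdots v_n\mapsto v_{\sigma(1)}\cdots v_{\sigma(n)}$ and $(-1)^\sigma$ the sign of $\sigma$; let $\mathrm{Sh}(p,q)$ be the set of unshuffles (permutations of $p+q$ letters increasing on the first $p$ and on the last $q$ positions). Let $C(V)=\mathrm{Hom}(\bigwedge V,V)=\prod_{k\ge1}\mathrm{Hom}(\bigwedge^kV,V)$, where $\bigwedge^k V$ is the graded exterior power (so elements are graded antisymmetric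 $\mathbf k$-multilinear maps); $\varphi=(\varphi_k)_{k\ge 1}$, and a homogeneous $\varphi_k$ has bidegree $(|\varphi_k|,k-1)$. All indices $k,l$ below are $\geq 1$. For homogeneous $\varphi_k,\psi_l$ and $n=k+l-1$ put $$(\varphi_k\circ\psi_l)(v_1,\dots,v_n)=\sum_{\sigma\in \mathrm{Sh}(l,k-1)}(-1)^\sigma\epsilon(\sigma)\,\varphi_k(\psi_l(v_{\sigma(1)},\dots,v_{\sigma(l)}),v_{\sigma(l+1)},\dots,v_{\sigma(n)}),$$ $$[\varphi_k,\psi_l]=\varphi_k\circ\psi_l-(-1)^{|\varphi_k||\psi_l|+(k-1)(l-1)}\psi_l\circ\varphi_k,\qquad \{\varphi_k,\psi_l\}=(-1)^{(k-1)|\psi_l|}[\varphi_k,\psi_l],$$ and extend the modified bracket biadditively to $C(V)$ by $\{\varphi,\psi\}_n=\sum_{k+l=n+1}\{\varphi_k,\psi_l\}$. A homogeneous $\varphi_k$ is *cyclic* if $\langle\varphi_k(v_1,\dots,v_k),v_{k+1}\rangle=(-1)^{k+|v_1||\varphi_k|}\langle v_1,\varphi_k(v_2,\dots,v_{k+1})\rangle$;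 $\varphi\in C(V)$ is cyclic if all homogeneous components of all $\varphi_k$ are. Let $CC(V)\subseteq C(V)$ be the module of cyclic elements, and $\tilde\varphi_k(v_1,\dots,v_{k+1})=\langle\varphi_k(v_1,\dots,v_k),v_{k+1}\rangle$; $\varphi\mapsto\tilde\varphi=(\tilde\varphi_k)_{k\ge1}$ is a bijection of $CC(V)$ onto $\prod_{k\ge1}\mathrm{Hom}(\bigwedge^{k+1}V,\mathbf k)$, and the two modules, with their bidegrees $(|\varphi_k|,k-1)$, are identified by it. Each element of this product decomposes uniquely into its bihomogeneous components. **Theorem.** i) If $\varphi,\psi\in C(V)$ are cyclic, then $\{\varphi,\psi\}$ is cyclic, and if every $\psi_l$ is homogeneous then, for homogeneous $v_i$ and all $n\ge1$, $$\widetilde{\{\varphi,\psi\}}(v_1,\dots,v_{n+1})=\sum_{\substack{k+l=n+1\\ \sigma\in \mathrm{Sh}(l,k)}}(-1)^\sigma\epsilon(\sigma)(-1)^{(k-1)|\psi_l|}\,\tilde\varphi_k(\psi_l(v_{\sigma(1)},\dots,v_{\sigma(l)}),v_{\sigma(l+1)},\dots,v_{\sigma(n+1)}).$$ Thus $\{\tilde\varphi,\tilde\psi\}=\widetilde{\{\varphi,\psi\}}$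 defines on $CC(V)$ the structure of a $\mathbb Z_2\times\mathbb Z$-graded Lie algebra over $\mathbf k$ with respect to the form $\langle(m,n),(m',n')\rangle=(m+n)(m'+n')$ on $\mathbb Z_2\times\mathbb Z$; equally, it is a $\mathbb Z_2$-graded Lie algebra with respect to the total parity, which is $q+d$ in bidegree $(q,d)$. ii) Let $l\in C(V)$ be an $L_\infty$ structure on $V$, i.e. $l_k$ has parity $k \bmod 2$ and for all $n\geq 1$ and homogeneous $v_i$ $$\sum_{\substack{k+j=n+1\\ \sigma\in \mathrm{Sh}(j,n-j)}}(-1)^\sigma\epsilon(\sigma)(-1)^{(k-1)j}\,l_k(l_j(v_{\sigma(1)},\dots,v_{\sigma(j)}),v_{\sigma(j+1)},\dots,v_{\sigma(n)})=0 .$$ Then (whether or not $l$ is cyclic) there is a $\mathbf k$-linear differential $D$ on $CC(V)$, i.e. $D^2=0$ and $D$ is odd for the total parity, given by $$D(\tilde\varphi)(v_1,\dots,v_{n+1})=\sum_{\substack{k+j=n+1\\ \sigma\in \mathrm{Sh}(j,k)}}(-1)^\sigma\epsilon(\sigma)(-1)^{(k-1)j}\,\tilde\varphi_k(l_j(v_{\sigma(1)},\dots,v_{\sigma(j)}),v_{\sigma(j+1)},\dots,v_{\sigma(n+1)}).$$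 iii) If moreover the inner product is invariant, i.e. $l$ is cyclic, then $D(\tilde\varphi)=\{\tilde\varphi,\tilde l\}$, and $CC(V)$ with $\{\cdot,\cdot\}$ and $D$ is a differential graded Lie algebra, graded by the total parity $|\cdot|$, with derivation rule $D\{x,y\}=\{x,Dy\}+(-1)^{|y|}\{Dx,y\}$. -/

import Mathlib

open scoped BigOperators

namespace LInfty

/-! ### Signs -/

/-- The sign `(-1)^z` for `z` in `ℤ/2`. -/
def ksign (z : ZMod 2) : ℤ := if z = 0 then 1 else -1

/-- The Koszul sign `ε(σ; v₁, …, v_N)` of the rearrangement `v_{σ(1)}, …, v_{σ(N)}` of homogeneous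
elements `v_i` of parity `p i`: the product over all inversions of `σ` of `(-1)^{|v_{σ i}||v_{σ j}|}`. -/
def koszul {N : ℕ} (σ : Equiv.Perm (Fin N)) (p : Fin N → ZMod 2) : ℤ :=
  ∏ i, ∏ j, if i < j ∧ σ j < σ i then ksign (p (σ i) * p (σ j)) else 1

/-- The unshuffles of type `(l, N - l)`: permutations of `N` letters that are increasing on the first
`l` positions and increasing on the remaining positions. -/
def unshuffles (l N : ℕ) : Finset (Equiv.Perm (Fin N)) :=
  Finset.univ.filter fun σ => ∀ i j : Fin N, i < j → (j.val < l ∨ l ≤ i.val) → σ i < σ j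

/-- The `i`-th entry of `v` (used only with `i < N`). -/
def argAt {X : Type*} [Zero X] {N : ℕ} (v : Fin N → X) (i : ℕ) : X :=
  if h : i < N then v ⟨i, h⟩ else 0

/-! ### Ground ring, supermodules, inner products -/

section Super

variable {K V : Type*} [Ring K] [AddCommGroup V] [Module K V] [Module Kᵐᵒᵖ V]

/-- Graded commutativity of a `ℤ/2`-graded ring. -/
def IsSupercommutative (𝒦 : ZMod 2 → AddSubgroup K) : Prop :=
  ∀ (i j : ZMod 2) (a b : K), a ∈ 𝒦 i → b ∈ 𝒦 j → a * b = ksign (i * j) • (b * a)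

/-- `V = V₀ ⊕ V₁` is a `ℤ/2`-graded module; the left and the right action of the ground ring are
related by `v t = (-1)^{|t||v|} t v`. -/
structure IsSupermodule (𝒦 : ZMod 2 → AddSubgroup K) (𝒱 : ZMod 2 → AddSubgroup V) : Prop where
  smul_mem : ∀ (s p : ZMod 2) (t : K) (v : V), t ∈ 𝒦 s → v ∈ 𝒱 p → t • v ∈ 𝒱 (s + p)
  op_smul : ∀ (s p : ZMod 2) (t : K) (v : V), t ∈ 𝒦 s → v ∈ 𝒱 p →
    MulOpposite.op t • v = ksign (s * p) • (t • v)

/-- An even inner product: a right module homomorphism `V ⊗ V → K` (tensor product over `K`) that is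
even, graded symmetric and non-degenerate, i.e. `v ↦ ⟨v, ·⟩` is a bijection from `V` onto the
module of right module homomorphisms `V → K`. -/
structure IsInnerProduct (𝒦 : ZMod 2 → AddSubgroup K) (𝒱 : ZMod 2 → AddSubgroup V)
    (ip : V →+ V →+ K) : Prop where
  balanced : ∀ (v w : V) (t : K), ip (MulOpposite.op t • v) w = ip v (t • w)
  map_op_smul : ∀ (v w : V) (t : K), ip v (MulOpposite.op t • w) = ip v w * t
  even : ∀ (p q : ZMod 2) (v w : V), v ∈ 𝒱 p → w ∈ 𝒱 q → ip v w ∈ 𝒦 (p + q)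
  symm : ∀ (p q : ZMod 2) (v w : V), v ∈ 𝒱 p → w ∈ 𝒱 q → ip v w = ksign (p * q) • ip w v
  nondegenerate : ∀ g : V →ₗ[Kᵐᵒᵖ] K, ∃! v : V, ∀ w, ip v w = g w

/-! ### Cochains -/

/-- `f` is an element of `Hom(⋀^{m+1} V, X)`: it is additive in every variable, balanced over `K`
(so that it is a map on the tensor power over `K`), a right `K`-module homomorphism, and
graded antisymmetric. -/
structure IsCochain (K : Type*) {V X : Type*} [Ring K] [AddCommGroup V] [Module K V]
    [Module Kᵐᵒᵖ V] [AddCommGroup X] [Module Kᵐᵒᵖ X] (𝒱 : ZMod 2 → AddSubgroup V) {m : ℕ}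
    (f : (Fin (m + 1) → V) → X) : Prop where
  add : ∀ (v : Fin (m + 1) → V) (i : Fin (m + 1)) (x y : V),
    f (Function.update v i (x + y)) = f (Function.update v i x) + f (Function.update v i y)
  balanced : ∀ (v : Fin (m + 1) → V) (i : Fin m) (t : K),
    f (Function.update v i.castSucc (MulOpposite.op t • v i.castSucc)) =
      f (Function.update v i.succ (t • v i.succ))
  map_op_smul : ∀ (v : Fin (m + 1) → V) (t : K),
    f (Function.update v (Fin.last m) (MulOpposite.op t • v (Fin.last m))) =
      MulOpposite.op t • f v
  antisymm : ∀ (v : Fin (m + 1) → V) (p : Fin (m + 1) → ZMod 2), (∀ i, v i ∈ 𝒱 (p i)) →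
    ∀ σ : Equiv.Perm (Fin (m + 1)),
      f v = ((Equiv.Perm.sign σ : ℤ) * koszul σ p) • f fun i => v (σ i)

/-- A sequence `φ` of maps; `φ d` has `d + 1` arguments, so that it has exterior degree `d`. In the
notation `φ = (φ_k)_{k ≥ 1}` with `φ_k : ⋀^k V → V` one has `φ d = φ_{d+1}`. -/
abbrev CochainFamily (V : Type*) := ∀ d : ℕ, (Fin (d + 1) → V) → V

/-- A sequence of scalar valued maps; the one of exterior degree `d` has `d + 2` arguments. -/
abbrev FormFamily (V K : Type*) := ∀ d : ℕ, (Fin (d + 2) → V) → K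

/-- `φ` lies in `C(V) = Hom(⋀ V, V) = ∏_{k ≥ 1} Hom(⋀^k V, V)`. -/
def InC (K : Type*) {V : Type*} [Ring K] [AddCommGroup V] [Module K V] [Module Kᵐᵒᵖ V]
    (𝒱 : ZMod 2 → AddSubgroup V) (φ : CochainFamily V) : Prop :=
  ∀ d, IsCochain K 𝒱 (φ d)

/-- `f` is homogeneous of parity `q`. -/
def HasParity {X : Type*} [AddCommGroup X] (𝒱 : ZMod 2 → AddSubgroup V)
    (𝒳 : ZMod 2 → AddSubgroup X) (q : ZMod 2) {N : ℕ} (f : (Fin N → V) → X) : Prop :=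
  ∀ (v : Fin N → V) (p : Fin N → ZMod 2), (∀ i, v i ∈ 𝒱 (p i)) → f v ∈ 𝒳 (q + ∑ i, p i)

/-- The component of parity `p` of `x`. -/
def proj (𝒱 : ZMod 2 → AddSubgroup V) [DirectSum.Decomposition 𝒱] (p : ZMod 2) (x : V) : V :=
  (DirectSum.decompose 𝒱 x p : V)

/-- The component of parity `q` of a multi-additive map `f`. -/
def parityPart (𝒱 : ZMod 2 → AddSubgroup V) [DirectSum.Decomposition 𝒱] (q : ZMod 2) {N : ℕ}
    (f : (Fin N → V) → V) : (Fin N → V) → V :=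
  fun v => ∑ p : Fin N → ZMod 2, proj 𝒱 (q + ∑ i, p i) (f fun i => proj 𝒱 (p i) (v i))

/-- The map associated with `φ` by the inner product,
`φ̃(v_1, …, v_{n+1}) = ⟨φ(v_1, …, v_n), v_{n+1}⟩`. -/
def tilde (ip : V →+ V →+ K) (φ : CochainFamily V) : FormFamily V K :=
  fun d v => ip (φ d fun i => v i.castSucc) (v (Fin.last (d + 1)))

/-- `f : V^n → V`, `n = d + 1`, is cyclic: each homogeneous component `f^q` satisfies
`⟨f^q(v_1, …, v_n), v_{n+1}⟩ = (-1)^{n + |v_1| q} ⟨v_1, f^q(v_2, …, v_{n+1})⟩`. -/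
def IsCyclic (𝒱 : ZMod 2 → AddSubgroup V) [DirectSum.Decomposition 𝒱] (ip : V →+ V →+ K) {d : ℕ}
    (f : (Fin (d + 1) → V) → V) : Prop :=
  ∀ (q : ZMod 2) (v : Fin (d + 2) → V) (p : Fin (d + 2) → ZMod 2), (∀ i, v i ∈ 𝒱 (p i)) →
    ip (parityPart 𝒱 q f fun i => v i.castSucc) (v (Fin.last (d + 1))) =
      ksign ((d : ZMod 2) + 1 + p 0 * q) • ip (v 0) (parityPart 𝒱 q f fun i => v i.succ)

/-- `CC(V)`: the set of all cyclic elements of `C(V)`. -/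
def CC (𝒱 : ZMod 2 → AddSubgroup V) [DirectSum.Decomposition 𝒱] (ip : V →+ V →+ K) :
    Set (CochainFamily V) :=
  {φ | InC K 𝒱 φ ∧ ∀ d, IsCyclic 𝒱 ip (φ d)}

/-! ### Insertion along unshuffles and the brackets -/

/-- `∑_{σ ∈ Sh(b+1, m)} (-1)^σ ε(σ) f(g(v_{σ(1)}, …, v_{σ(b+1)}), v_{σ(b+2)}, …, v_{σ(N)})` for
homogeneous `v_i` of parity `p i` and `N = b + 1 + m`. -/
def insertAt {X : Type*} [AddCommGroup X] {m b N : ℕ} (f : (Fin (m + 1) → V) → X)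
    (g : (Fin (b + 1) → V) → V) (p : Fin N → ZMod 2) (v : Fin N → V) : X :=
  ∑ σ ∈ unshuffles (b + 1) N, ((Equiv.Perm.sign σ : ℤ) * koszul σ p) •
    f (Fin.cons (g fun i => argAt (fun s => v (σ s)) i)
      fun j : Fin m => argAt (fun s => v (σ s)) (b + 1 + j))

/-- The multi-additive extension of `insertAt` to arbitrary arguments. -/
def insertion (𝒱 : ZMod 2 → AddSubgroup V) [DirectSum.Decomposition 𝒱] {m b N : ℕ}
    (f : (Fin (m + 1) → V) → V) (g : (Fin (b + 1) → V) → V) (v : Fin N → V) : V :=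
  ∑ p : Fin N → ZMod 2, insertAt f g p fun i => proj 𝒱 (p i) (v i)

/-- The bracket of coderivations `[f, g]` for `f` of bidegree `(q, a)` and `g` of bidegree `(r, b)`;
here `N = a + b + 1`. -/
def coderBracket (𝒱 : ZMod 2 → AddSubgroup V) [DirectSum.Decomposition 𝒱] {a b N : ℕ}
    (q r : ZMod 2) (f : (Fin (a + 1) → V) → V) (g : (Fin (b + 1) → V) → V) (v : Fin N → V) : V :=
  insertion 𝒱 f g v - ksign (q * r + (a : ZMod 2) * b) • insertion 𝒱 g f v

/-- The modified bracket `{φ, ψ}` on `C(V)`: the biadditive extension of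
`{φ_k, ψ_l} = (-1)^{deg(φ_k) |ψ_l|} [φ_k, ψ_l]` (with `deg φ_k = k - 1`) to sequences of not
necessarily homogeneous cochains, `{φ, ψ}_n = ∑_{k + l = n + 1} {φ_k, ψ_l}`. -/
def modBracket (𝒱 : ZMod 2 → AddSubgroup V) [DirectSum.Decomposition 𝒱]
    (φ ψ : CochainFamily V) : CochainFamily V :=
  fun d v => ∑ ab ∈ Finset.HasAntidiagonal.antidiagonal d, ∑ q : ZMod 2, ∑ r : ZMod 2,
    ksign ((ab.1 : ZMod 2) * r) •
      coderBracket 𝒱 q r (parityPart 𝒱 q (φ ab.1)) (parityPart 𝒱 r (ψ ab.2)) v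

/-- `l` is an `L_∞` structure: `l_k ∈ Hom(⋀^k V, V)` has parity `k`, and
`∑_{k+l=n+1} ∑_{σ ∈ Sh(l, n-l)} (-1)^σ ε(σ) (-1)^{(k-1) l} l_k(l_l(v_{σ(1)}, …), …, v_{σ(n)}) = 0`. -/
structure IsLInfty (K : Type*) {V : Type*} [Ring K] [AddCommGroup V] [Module K V] [Module Kᵐᵒᵖ V]
    (𝒱 : ZMod 2 → AddSubgroup V) (l : CochainFamily V) : Prop where
  cochain : InC K 𝒱 l
  parity : ∀ d : ℕ, HasParity 𝒱 𝒱 ((d : ZMod 2) + 1) (l d)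
  relation : ∀ (d : ℕ) (v : Fin (d + 1) → V) (p : Fin (d + 1) → ZMod 2), (∀ i, v i ∈ 𝒱 (p i)) →
    ∑ ab ∈ Finset.HasAntidiagonal.antidiagonal d,
      ksign ((ab.1 : ZMod 2) * ((ab.2 : ZMod 2) + 1)) • insertAt (l ab.1) (l ab.2) p v = 0

/-! ### The module of scalar valued cochains and its gradings -/

/-- The module `∏_{n ≥ 1} Hom(⋀^{n+1} V, K)`. -/
def Forms (K : Type*) {V : Type*} [Ring K] [AddCommGroup V] [Module K V] [Module Kᵐᵒᵖ V]
    (𝒱 : ZMod 2 → AddSubgroup V) : Submodule K (FormFamily V K) where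
  carrier := {f | ∀ d, IsCochain K 𝒱 (f d)}
  zero_mem' d := ⟨by simp, by simp, by simp, by simp⟩
  add_mem' {f g} hf hg d := by
    refine ⟨fun v i x y => ?_, fun v i t => ?_, fun v t => ?_, fun v p hp σ => ?_⟩
    · simp only [Pi.add_apply, (hf d).add, (hg d).add]; abel
    · simp only [Pi.add_apply, (hf d).balanced, (hg d).balanced]
    · simp only [Pi.add_apply, (hf d).map_op_smul, (hg d).map_op_smul, smul_add]
    · simp only [Pi.add_apply, smul_add]
      rw [(hf d).antisymm v p hp σ, (hg d).antisymm v p hp σ]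
  smul_mem' c f hf d := by
    refine ⟨fun v i x y => ?_, fun v i t => ?_, fun v t => ?_, fun v p hp σ => ?_⟩
    · simp only [Pi.smul_apply, (hf d).add, smul_add]
    · simp only [Pi.smul_apply, (hf d).balanced]
    · simp only [Pi.smul_apply, (hf d).map_op_smul, smul_eq_mul, MulOpposite.smul_eq_mul_unop,
        mul_assoc]
    · simp only [Pi.smul_apply, smul_eq_mul]
      rw [(hf d).antisymm v p hp σ, mul_smul_comm]

/-- The elements of bidegree `g = (parity, exterior degree)`. -/
def bidegreePart (𝒦 : ZMod 2 → AddSubgroup K) (𝒱 : ZMod 2 → AddSubgroup V) (g : ZMod 2 × ℤ) :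
    AddSubgroup (Forms K 𝒱) where
  carrier := {f | (∀ d : ℕ, (d : ℤ) ≠ g.2 → f.1 d = 0) ∧ ∀ d, HasParity 𝒱 𝒦 g.1 (f.1 d)}
  zero_mem' := ⟨fun _ _ => rfl, fun _ _ _ _ => zero_mem _⟩
  add_mem' {f f'} hf hf' :=
    ⟨fun d hd => by
      have h1 := hf.1 d hd
      have h2 := hf'.1 d hd
      change f.1 d + f'.1 d = 0
      rw [h1, h2, add_zero],
     fun d v p hp => add_mem (hf.2 d v p hp) (hf'.2 d v p hp)⟩
  neg_mem' {f} hf :=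
    ⟨fun d hd => by
      have h1 := hf.1 d hd
      change -(f.1 d) = 0
      rw [h1, neg_zero],
     fun d v p hp => neg_mem (hf.2 d v p hp)⟩

/-- The elements of total parity `s`, where an element of bidegree `(q, d)` has total parity
`q + d`. -/
def totalParityPart (𝒦 : ZMod 2 → AddSubgroup K) (𝒱 : ZMod 2 → AddSubgroup V) (s : ZMod 2) :
    AddSubgroup (Forms K 𝒱) where
  carrier := {f | ∀ d : ℕ, HasParity 𝒱 𝒦 (s + d) (f.1 d)}
  zero_mem' := fun _ _ _ _ => zero_mem _
  add_mem' hf hf' := fun d v p hp => add_mem (hf d v p hp) (hf' d v p hp)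
  neg_mem' hf := fun d v p hp => neg_mem (hf d v p hp)

/-- The form `⟨(m, n), (m', n')⟩ = (m + n)(m' + n')` on the grading group `ℤ/2 × ℤ`. -/
def totalForm (g h : ZMod 2 × ℤ) : ZMod 2 := (g.1 + (g.2 : ZMod 2)) * (h.1 + (h.2 : ZMod 2))

/-! ### Graded Lie algebras -/

/-- `B` is a graded Lie bracket on the `K`-module `L` with homogeneous parts `𝓛 g`, with respect to
the form `χ` on the grading group. Together with antisymmetry, linearity over `K` on the left
gives (graded) `K`-bilinearity. -/
structure IsGradedLieBracket (K : Type*) {L G : Type*} [Ring K] [AddCommGroup L] [Module K L]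
    [AddCommGroup G] (𝓛 : G → AddSubgroup L) (χ : G → G → ZMod 2) (B : L →+ L →+ L) : Prop where
  mem : ∀ (g h : G) (x y : L), x ∈ 𝓛 g → y ∈ 𝓛 h → B x y ∈ 𝓛 (g + h)
  smul_left : ∀ (t : K) (x y : L), B (t • x) y = t • B x y
  antisymm : ∀ (g h : G) (x y : L), x ∈ 𝓛 g → y ∈ 𝓛 h → B x y = -(ksign (χ g h) • B y x)
  jacobi : ∀ (g h : G) (x y z : L), x ∈ 𝓛 g → y ∈ 𝓛 h →
    B x (B y z) = B (B x y) z + ksign (χ g h) • B y (B x z)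

/-- `D` is an odd map of square zero. -/
structure IsDifferential {K L : Type*} [Ring K] [AddCommGroup L] [Module K L]
    (𝓛 : ZMod 2 → AddSubgroup L) (D : L →ₗ[K] L) : Prop where
  odd : ∀ (s : ZMod 2) (x : L), x ∈ 𝓛 s → D x ∈ 𝓛 (s + 1)
  sq_zero : ∀ x : L, D (D x) = 0

/-- `(L, B, D)` is a (`ℤ/2`-graded) differential graded Lie algebra; the derivation rule is
`D{x, y} = {x, D y} + (-1)^{|y|} {D x, y}`. -/
structure IsDGLie {K L : Type*} [Ring K] [AddCommGroup L] [Module K L]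
    (𝓛 : ZMod 2 → AddSubgroup L) (B : L →+ L →+ L) (D : L →ₗ[K] L) : Prop where
  lie : IsGradedLieBracket K 𝓛 (fun s t => s * t) B
  differential : IsDifferential 𝓛 D
  derivation : ∀ (s : ZMod 2) (x y : L), y ∈ 𝓛 s →
    D (B x y) = B x (D y) + ksign s • B (D x) y

end Super

end LInfty

/-!
Shifting the parity of `V` by one (décalage) turns the graded antisymmetric cochains into graded
symmetric functions of words in homogeneous letters and absorbs every sign that depends only on
arities. In this picture inserting one cochain into another along unshuffles is a right pre-Lie
product: in `(f ∘ g) ∘ h - f ∘ (g ∘ h)` the cochains `g` and `h` enter two different slots of `f`,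
so the associator is graded symmetric in `g` and `h`. Consequently `C(V)` acts from the right on
scalar valued cochains, `(f · g) · h ∓ (f · h) · g = f · [g, h]`.

Moving cyclic cochains `φ` and `ψ` through the inner product, as endomorphisms of the last
argument, shows that `φ̃ · ψ` is the scalar cochain of `{φ, ψ}`. So the bracket of the scalar
cochains `φ̃` and `ψ̃` is `φ̃ · ψ`, and the Jacobi identity is the identity of the action. The
operator `D` is the action of `l`; since `l` is odd and `l ∘ l = 0`, the element `D² f` is the
associator of `f`, `l`, `l`, which equals its own negative.
-/

namespace LInfty

/-! ### Homogeneous words and unshuffles of words -/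

section Signs

variable {X : Type*} [AddCommGroup X]

theorem ksign_zero : ksign 0 = 1 := rfl

theorem ksign_one : ksign 1 = -1 := rfl

theorem ksign_add (a b : ZMod 2) : ksign (a + b) = ksign a * ksign b := by
  revert a b; decide

theorem ksign_mul_self (a : ZMod 2) : ksign a * ksign a = 1 := by
  revert a; decide

theorem ksign_smul_ksign_smul (a b : ZMod 2) (x : X) :
    ksign a • ksign b • x = ksign (a + b) • x := by
  rw [smul_smul, ksign_add]

theorem ksign_smul_self (a : ZMod 2) (x : X) : ksign a • ksign a • x = x := by
  rw [smul_smul, ksign_mul_self, one_smul]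

theorem ksign_smul_congr {a b : ZMod 2} (h : a = b) (x : X) : ksign a • x = ksign b • x := by
  rw [h]

theorem ksign_smul_eq_iff (a : ZMod 2) (x y : X) : ksign a • x = y ↔ x = ksign a • y :=
  ⟨fun h => by rw [← h, ksign_smul_self], fun h => by rw [h, ksign_smul_self]⟩

theorem add_one_add_one (a : ZMod 2) : a + 1 + 1 = a := CharTwo.add_cancel_right a 1

end Signs

section UnshuffleSum

variable {α β X Y : Type*} [AddCommGroup X] [AddCommGroup Y] (w : α → α → ℤ)

/-- The sum of `F T R` over all decompositions of a list into complementary sublists `T` and `R`,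
where each pair `t ∈ T`, `r ∈ R` with `r` before `t` contributes the factor `w t r`: the sum over
all unshuffles, defined by recursion on the list. -/
def unshuffleSum : List α → (List α → List α → X) → X
  | [], F => F [] []
  | a :: l, F => unshuffleSum l (fun T R => F (a :: T) R) +
      unshuffleSum l (fun T R => (T.map (w · a)).prod • F T (a :: R))

theorem unshuffleSum_congr (l : List α) {F G : List α → List α → X}
    (h : ∀ T R, (T ++ R).Perm l → F T R = G T R) : unshuffleSum w l F = unshuffleSum w l G := by
  induction l generalizing F G with
  | nil => exact h [] [] (List.Perm.refl _)
  | cons a l ih =>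
    simp only [unshuffleSum]
    congr 1
    · exact ih fun T R hp => h _ _ (hp.cons a)
    · exact ih fun T R hp => by rw [h _ _ (List.perm_middle.trans (hp.cons a))]

theorem map_unshuffleSum (φ : X →+ Y) (l : List α) (F : List α → List α → X) :
    φ (unshuffleSum w l F) = unshuffleSum w l fun T R => φ (F T R) := by
  induction l generalizing F with
  | nil => rfl
  | cons a l ih => simp only [unshuffleSum, map_add, ih, map_zsmul]

theorem unshuffleSum_mem (H : AddSubgroup X) (l : List α) {F : List α → List α → X}
    (h : ∀ T R, (T ++ R).Perm l → F T R ∈ H) : unshuffleSum w l F ∈ H := by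
  induction l generalizing F with
  | nil => exact h [] [] (List.Perm.refl _)
  | cons a l ih =>
    exact H.add_mem (ih fun T R hp => h _ _ (hp.cons a))
      (ih fun T R hp => H.zsmul_mem (h _ _ (List.perm_middle.trans (hp.cons a))) _)

theorem unshuffleSum_add (l : List α) (F G : List α → List α → X) :
    (unshuffleSum w l fun T R => F T R + G T R) = unshuffleSum w l F + unshuffleSum w l G := by
  induction l generalizing F G with
  | nil => rfl
  | cons a l ih => simp only [unshuffleSum, smul_add, ih]; abel

theorem unshuffleSum_smul {M : Type*} [DistribSMul M X] (c : M) (l : List α)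
    (F : List α → List α → X) :
    (unshuffleSum w l fun T R => c • F T R) = c • unshuffleSum w l F :=
  (map_unshuffleSum w (DistribSMul.toAddMonoidHom X c) l F).symm

theorem unshuffleSum_sum {ι : Type*} (s : Finset ι) (l : List α) (F : ι → List α → List α → X) :
    (unshuffleSum w l fun T R => ∑ i ∈ s, F i T R) = ∑ i ∈ s, unshuffleSum w l (F i) := by
  induction l generalizing F with
  | nil => rfl
  | cons a l ih => simp only [unshuffleSum, Finset.smul_sum, ih, Finset.sum_add_distrib]

theorem unshuffleSum_map (w : β → β → ℤ) (h : α → β) (l : List α) (F : List β → List β → X) :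
    unshuffleSum w (l.map h) F =
      unshuffleSum (fun a b => w (h a) (h b)) l fun T R => F (T.map h) (R.map h) := by
  induction l generalizing F with
  | nil => rfl
  | cons a l ih => simp only [List.map_cons, unshuffleSum, ih, List.map_map, Function.comp_def]

theorem unshuffleSum_assoc (l : List α) (F : List α → List α → List α → X) :
    (unshuffleSum w l fun T R => unshuffleSum w T fun A B => F A B R) =
      unshuffleSum w l fun A S => unshuffleSum w S fun B R => F A B R := by
  induction l generalizing F with
  | nil => rfl
  | cons a l ih =>
    have weight_split : ∀ T R, (T.map (w · a)).prod • (unshuffleSum w T fun A B => F A B (a :: R)) =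
        unshuffleSum w T fun A B =>
          (A.map (w · a)).prod • (B.map (w · a)).prod • F A B (a :: R) := by
      intro T R
      rw [← unshuffleSum_smul]
      refine unshuffleSum_congr w T fun A B hp => ?_
      rw [smul_smul, ← List.prod_append, ← List.map_append, (hp.map _).prod_eq]
    simp only [unshuffleSum, unshuffleSum_add, weight_split, ih, smul_add, unshuffleSum_smul]
    rw [add_assoc]

theorem unshuffleSum_append_singleton (l : List α) (c : α) (F : List α → List α → X) :
    unshuffleSum w (l ++ [c]) F =
      (unshuffleSum w l fun T R => (R.map (w c ·)).prod • F (T ++ [c]) R) +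
        unshuffleSum w l fun T R => F T (R ++ [c]) := by
  induction l generalizing F with
  | nil => simp [unshuffleSum]
  | cons a l ih =>
    simp only [List.cons_append, unshuffleSum, ih, List.map_append, List.prod_append, List.map_cons,
      List.prod_cons, List.map_nil, List.prod_nil, mul_one, smul_smul]
    rw [add_add_add_comm]
    congr 2
    refine congrArg _ (funext₂ fun T R => ?_)
    congr 1
    ring

end UnshuffleSum

section Supermodule

variable {K V : Type*} [Ring K] [AddCommGroup V] [Module K V] [Module Kᵐᵒᵖ V]
  {𝒦 : ZMod 2 → AddSubgroup K} {𝒱 : ZMod 2 → AddSubgroup V}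

theorem IsSupermodule.op_smul_mem (hV : IsSupermodule 𝒦 𝒱) {s p : ZMod 2} {t : K} {v : V}
    (ht : t ∈ 𝒦 s) (hv : v ∈ 𝒱 p) : MulOpposite.op t • v ∈ 𝒱 (p + s) := by
  rw [hV.op_smul s p t v ht hv, add_comm]
  exact (𝒱 _).zsmul_mem (hV.smul_mem s p t v ht hv) _

end Supermodule

section Proj

variable {V : Type*} [AddCommGroup V] (𝒱 : ZMod 2 → AddSubgroup V) [DirectSum.Decomposition 𝒱]

theorem sum_proj (x : V) : ∑ p, proj 𝒱 p x = x := by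
  classical
  conv_rhs => rw [← DirectSum.sum_support_decompose 𝒱 x]
  refine (Finset.sum_subset (Finset.subset_univ _) fun p _ hp => ?_).symm
  rw [DFinsupp.notMem_support_iff] at hp
  rw [proj, hp]
  rfl

theorem proj_mem (p : ZMod 2) (x : V) : proj 𝒱 p x ∈ 𝒱 p := SetLike.coe_mem _

variable {𝒱} in
theorem proj_of_mem {p : ZMod 2} {x : V} (hx : x ∈ 𝒱 p) : proj 𝒱 p x = x :=
  DirectSum.decompose_of_mem_same 𝒱 hx

variable {𝒱} in
theorem proj_of_mem_ne {p q : ZMod 2} {x : V} (hx : x ∈ 𝒱 p) (hpq : p ≠ q) : proj 𝒱 q x = 0 :=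
  DirectSum.decompose_of_mem_ne 𝒱 hx hpq

theorem proj_add (p : ZMod 2) (x y : V) : proj 𝒱 p (x + y) = proj 𝒱 p x + proj 𝒱 p y := by
  simp [proj, DirectSum.decompose_add]

/-- The projection to a homogeneous component as a homomorphism. -/
def projHom (p : ZMod 2) : V →+ V := AddMonoidHom.mk' (proj 𝒱 p) (proj_add 𝒱 p)

@[simp] theorem projHom_apply (p : ZMod 2) (x : V) : projHom 𝒱 p x = proj 𝒱 p x := rfl

theorem eq_of_proj_eq {x y : V} (h : ∀ p, proj 𝒱 p x = proj 𝒱 p y) : x = y := by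
  rw [← sum_proj 𝒱 x, ← sum_proj 𝒱 y, Finset.sum_congr rfl fun p _ => h p]

variable {𝒱}

theorem proj_map {W : Type*} [AddCommGroup W] {𝒲 : ZMod 2 → AddSubgroup W}
    [DirectSum.Decomposition 𝒲] {s : ZMod 2} (φ : V →+ W)
    (hφ : ∀ (q : ZMod 2) (x : V), x ∈ 𝒱 q → φ x ∈ 𝒲 (q + s)) (p : ZMod 2) (x : V) :
    proj 𝒲 (p + s) (φ x) = φ (proj 𝒱 p x) := by
  conv_lhs => rw [← sum_proj 𝒱 x, map_sum, ← projHom_apply, map_sum]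
  rw [Finset.sum_eq_single_of_mem p (Finset.mem_univ p), projHom_apply,
    proj_of_mem (hφ p _ (proj_mem 𝒱 p x))]
  exact fun q _ hq =>
    proj_of_mem_ne (hφ q _ (proj_mem 𝒱 q x)) fun h => hq (add_right_cancel h)

variable {K : Type*} [Ring K] [Module K V] [Module Kᵐᵒᵖ V] {𝒦 : ZMod 2 → AddSubgroup K}

theorem IsSupermodule.proj_op_smul (hV : IsSupermodule 𝒦 𝒱) {s : ZMod 2} {t : K} (ht : t ∈ 𝒦 s)
    (p : ZMod 2) (x : V) :
    proj 𝒱 (p + s) (MulOpposite.op t • x) = MulOpposite.op t • proj 𝒱 p x :=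
  proj_map (DistribSMul.toAddMonoidHom V (MulOpposite.op t)) (fun _ _ => hV.op_smul_mem ht) p x

end Proj

section Letters

variable {V X : Type*} [AddCommGroup V] [AddCommGroup X] {𝒱 : ZMod 2 → AddSubgroup V}

/-- A homogeneous element of `V`, recorded with its degree in the shifted module `V[1]`, in which
the graded antisymmetric maps on `V` become graded symmetric functions of words of letters. -/
@[ext]
structure Letter (𝒱 : ZMod 2 → AddSubgroup V) where
  /-- The parity in `V[1]`. -/
  deg : ZMod 2
  /-- The underlying element of `V`. -/
  val : V
  mem : val ∈ 𝒱 (deg + 1)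

/-- The degree of a word in the shifted module. -/
def label (l : List (Letter 𝒱)) : ZMod 2 := (l.map Letter.deg).sum

@[simp] theorem label_nil : label ([] : List (Letter 𝒱)) = 0 := rfl

@[simp] theorem label_cons (a : Letter 𝒱) (l : List (Letter 𝒱)) :
    label (a :: l) = a.deg + label l := by simp [label]

@[simp] theorem label_append (l l' : List (Letter 𝒱)) : label (l ++ l') = label l + label l' := by
  simp [label]

theorem label_perm {l l' : List (Letter 𝒱)} (h : l.Perm l') : label l = label l' :=
  (h.map _).sum_eq

theorem label_append_perm {l T R : List (Letter 𝒱)} (h : (T ++ R).Perm l) :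
    label l = label T + label R := by rw [← label_perm h, label_append]

/-- The sum over all unshuffles of a word with the Koszul signs of the shifted degrees. -/
abbrev koszulSum (l : List (Letter 𝒱)) (F : List (Letter 𝒱) → List (Letter 𝒱) → X) : X :=
  unshuffleSum (fun a b => ksign (a.deg * b.deg)) l F

theorem prod_ksign_mul_right (l : List (Letter 𝒱)) (z : ZMod 2) :
    (l.map fun t => ksign (t.deg * z)).prod = ksign (label l * z) := by
  induction l with
  | nil => simp [ksign_zero]
  | cons b l ih => simp [ih, add_mul, ksign_add]

theorem koszulSum_cons (a : Letter 𝒱) (l : List (Letter 𝒱))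
    (F : List (Letter 𝒱) → List (Letter 𝒱) → X) :
    koszulSum (a :: l) F = (koszulSum l fun T R => F (a :: T) R) +
      koszulSum l fun T R => ksign (label T * a.deg) • F T (a :: R) := by
  simp only [koszulSum, unshuffleSum, prod_ksign_mul_right]

theorem koszulSum_append_singleton (l : List (Letter 𝒱)) (c : Letter 𝒱)
    (F : List (Letter 𝒱) → List (Letter 𝒱) → X) :
    koszulSum (l ++ [c]) F =
      (koszulSum l fun T R => ksign (c.deg * label R) • F (T ++ [c]) R) +
        koszulSum l fun T R => F T (R ++ [c]) := by
  simp only [koszulSum, unshuffleSum_append_singleton, mul_comm c.deg, prod_ksign_mul_right]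

theorem koszulSum_comm (l : List (Letter 𝒱)) (F : List (Letter 𝒱) → List (Letter 𝒱) → X) :
    koszulSum l F = koszulSum l fun T R => ksign (label T * label R) • F R T := by
  induction l generalizing F with
  | nil => simp [koszulSum, unshuffleSum, ksign_zero]
  | cons a l ih =>
    rw [koszulSum_cons, koszulSum_cons, ih, add_comm, ih]
    simp only [ksign_smul_ksign_smul, label_cons]
    congr 2 <;> funext T R <;> exact ksign_smul_congr (by grind) _

/-- Graded symmetry of a function of words. -/
def IsGradedSymmetric (F : List (Letter 𝒱) → X) : Prop :=
  ∀ (l₁ l₂ : List (Letter 𝒱)) (a b : Letter 𝒱),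
    F (l₁ ++ a :: b :: l₂) = ksign (a.deg * b.deg) • F (l₁ ++ b :: a :: l₂)

theorem IsGradedSymmetric.move {F : List (Letter 𝒱) → X} (hF : IsGradedSymmetric F)
    (l₁ l₂ l₃ : List (Letter 𝒱)) (a : Letter 𝒱) :
    F (l₁ ++ l₂ ++ a :: l₃) = ksign (a.deg * label l₂) • F (l₁ ++ a :: l₂ ++ l₃) := by
  induction l₂ generalizing l₁ with
  | nil => simp [ksign_zero]
  | cons b l₂ ih =>
    have tail := ih (l₁ ++ [b])
    simp only [List.append_assoc, List.cons_append, List.nil_append] at tail ⊢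
    rw [tail, hF, ksign_smul_ksign_smul, label_cons]
    exact ksign_smul_congr (by ring) _

theorem IsGradedSymmetric.append_cons {F : List (Letter 𝒱) → X} (hF : IsGradedSymmetric F)
    (l₁ l₂ : List (Letter 𝒱)) (a : Letter 𝒱) :
    F (l₁ ++ a :: l₂) = ksign (a.deg * label l₁) • F (a :: (l₁ ++ l₂)) :=
  hF.move [] l₁ l₂ a

theorem IsGradedSymmetric.cons_eq {F : List (Letter 𝒱) → X} (hF : IsGradedSymmetric F)
    (a : Letter 𝒱) (l : List (Letter 𝒱)) : F (a :: l) = ksign (a.deg * label l) • F (l ++ [a]) := by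
  rw [hF.append_cons l [], List.append_nil, ksign_smul_self]

theorem IsGradedSymmetric.cons_cons {F : List (Letter 𝒱) → X} (hF : IsGradedSymmetric F)
    (a b : Letter 𝒱) (l : List (Letter 𝒱)) :
    F (a :: b :: l) = ksign (a.deg * b.deg) • F (b :: a :: l) :=
  hF [] l a b

theorem isGradedSymmetric_koszulSum {F : List (Letter 𝒱) → List (Letter 𝒱) → X}
    (hT : ∀ R, IsGradedSymmetric fun T => F T R) (hR : ∀ T, IsGradedSymmetric (F T)) :
    IsGradedSymmetric fun l => koszulSum l F := by
  intro l₁ l₂ a b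
  change koszulSum (l₁ ++ a :: b :: l₂) F =
    ksign (a.deg * b.deg) • koszulSum (l₁ ++ b :: a :: l₂) F
  induction l₁ generalizing F with
  | nil =>
    have inner : ∀ T R, F (a :: b :: T) R = ksign (a.deg * b.deg) • F (b :: a :: T) R :=
      fun T R => (hT R).cons_cons a b T
    have outer : ∀ T R, F T (a :: b :: R) = ksign (a.deg * b.deg) • F T (b :: a :: R) :=
      fun T R => (hR T).cons_cons a b R
    simp only [List.nil_append, koszulSum_cons, label_cons, inner, outer, smul_add,
      ← unshuffleSum_smul, ksign_smul_ksign_smul, koszulSum]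
    rw [add_assoc, add_assoc]
    congr 1
    rw [add_left_comm]
    refine congrArg₂ _ ?_ (congrArg₂ _ ?_ ?_) <;> congr 1 <;> funext T R <;>
      exact ksign_smul_congr (by grind) _
  | cons c l₁ ih =>
    simp only [List.cons_append, koszulSum_cons, smul_add]
    rw [ih (fun R T₁ => hT R (c :: T₁)) fun T => hR (c :: T), ih (fun R T₁ T₂ x y => ?_)
      fun T R₁ R₂ x y => ?_]
    · simp only [label_append, label_cons]
      rw [show F (T₁ ++ x :: y :: T₂) (c :: R) = _ from hT (c :: R) T₁ T₂ x y,
        add_left_comm x.deg, smul_comm]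
    · rw [smul_comm]
      exact congrArg _ (hR T (c :: R₁) R₂ x y)

end Letters

/-! ### Insertion into functions of words -/

section Words

variable {V X : Type*} [AddCommGroup V] [AddCommGroup X] {𝒱 : ZMod 2 → AddSubgroup V}
  [DirectSum.Decomposition 𝒱]

/-- The letter of degree `d` given by the homogeneous component of `x` of that degree in `V[1]`.
As it is defined for all `x`, no homogeneity of `x` has to be carried along. -/
def letter (d : ZMod 2) (x : V) : Letter 𝒱 := ⟨d, proj 𝒱 (d + 1) x, proj_mem 𝒱 (d + 1) x⟩

@[simp] theorem letter_deg (d : ZMod 2) (x : V) : (letter d x : Letter 𝒱).deg = d := rfl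

theorem letter_val (d : ZMod 2) (x : V) : (letter d x : Letter 𝒱).val = proj 𝒱 (d + 1) x := rfl

theorem letter_deg_val (a : Letter 𝒱) : letter a.deg a.val = a :=
  Letter.ext rfl (proj_of_mem a.mem)

theorem letter_proj (d : ZMod 2) (x : V) :
    (letter d (proj 𝒱 (d + 1) x) : Letter 𝒱) = letter d x :=
  Letter.ext rfl (proj_of_mem (proj_mem 𝒱 _ x))

/-- Additivity in the first letter of a word. -/
def HeadAdditive (F : List (Letter 𝒱) → X) : Prop :=
  ∀ (d : ZMod 2) (x y : V) (l : List (Letter 𝒱)),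
    F (letter d (x + y) :: l) = F (letter d x :: l) + F (letter d y :: l)

/-- A head additive function as a homomorphism in its first letter. -/
def HeadAdditive.hom {F : List (Letter 𝒱) → X} (hF : HeadAdditive F) (d : ZMod 2)
    (l : List (Letter 𝒱)) : V →+ X :=
  AddMonoidHom.mk' (fun x => F (letter d x :: l)) fun x y => hF d x y l

theorem HeadAdditive.zsmul {F : List (Letter 𝒱) → X} (hF : HeadAdditive F) (d : ZMod 2) (n : ℤ)
    (x : V) (l : List (Letter 𝒱)) : F (letter d (n • x) :: l) = n • F (letter d x :: l) :=
  map_zsmul (hF.hom d l) n x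

theorem HeadAdditive.zero {F : List (Letter 𝒱) → X} (hF : HeadAdditive F) (d : ZMod 2)
    (l : List (Letter 𝒱)) : F (letter d 0 :: l) = 0 :=
  map_zero (hF.hom d l)

theorem HeadAdditive.koszulSum {F : List (Letter 𝒱) → X} (hF : HeadAdditive F) (d : ZMod 2)
    (l l' : List (Letter 𝒱)) (G : List (Letter 𝒱) → List (Letter 𝒱) → V) :
    F (letter d (koszulSum l' G) :: l) =
      LInfty.koszulSum l' fun T R => F (letter d (G T R) :: l) :=
  map_unshuffleSum _ (hF.hom d l) l' G

/-- Functions of words of degree `γ`, where the grading of the values is shifted by `u`. -/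
def HasDegree (𝒳 : ZMod 2 → AddSubgroup X) (u γ : ZMod 2) (F : List (Letter 𝒱) → X) : Prop :=
  ∀ l : List (Letter 𝒱), F l ∈ 𝒳 (γ + label l + u)

/-- The insertion of `g`, of degree `γ`, into the first place of `f`. -/
def wordInsert (γ : ZMod 2) (f : List (Letter 𝒱) → X) (g : List (Letter 𝒱) → V)
    (l : List (Letter 𝒱)) : X :=
  koszulSum l fun T R => f (letter (γ + label T) (g T) :: R)

/-- The insertion of `g`, of degree `γ₁`, and `h`, of degree `γ₂`, into two places of `f`. -/
def wordInsertPair (γ₁ γ₂ : ZMod 2) (f : List (Letter 𝒱) → X) (g h : List (Letter 𝒱) → V)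
    (l : List (Letter 𝒱)) : X :=
  koszulSum l fun S R => koszulSum S fun T U => ksign (label U * (γ₂ + label T)) •
    f (letter (γ₁ + label U) (g U) :: letter (γ₂ + label T) (h T) :: R)

theorem wordInsert_add_left (γ : ZMod 2) (f f' : List (Letter 𝒱) → X) (g : List (Letter 𝒱) → V)
    (l : List (Letter 𝒱)) :
    wordInsert γ (fun l => f l + f' l) g l = wordInsert γ f g l + wordInsert γ f' g l :=
  unshuffleSum_add _ _ _ _

theorem wordInsert_add_right (γ : ZMod 2) {f : List (Letter 𝒱) → X} (hf : HeadAdditive f)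
    (g g' : List (Letter 𝒱) → V) (l : List (Letter 𝒱)) :
    wordInsert γ f (fun l => g l + g' l) l = wordInsert γ f g l + wordInsert γ f g' l := by
  simp only [wordInsert, hf _ _ _ _, koszulSum, unshuffleSum_add]

theorem wordInsert_zsmul_right (γ : ZMod 2) {f : List (Letter 𝒱) → X} (hf : HeadAdditive f)
    (n : ℤ) (g : List (Letter 𝒱) → V) (l : List (Letter 𝒱)) :
    wordInsert γ f (fun l => n • g l) l = n • wordInsert γ f g l := by
  simp only [wordInsert, hf.zsmul, koszulSum, unshuffleSum_smul]

theorem HasDegree.wordInsert {𝒳 : ZMod 2 → AddSubgroup X} {u γ₁ : ZMod 2}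
    {f : List (Letter 𝒱) → X} (hf : HasDegree 𝒳 u γ₁ f) (γ₂ : ZMod 2) (g : List (Letter 𝒱) → V) :
    HasDegree 𝒳 u (γ₁ + γ₂) (wordInsert γ₂ f g) := fun l =>
  unshuffleSum_mem _ _ l fun T R hp => by
    simpa only [label_cons, letter_deg, label_append_perm hp, add_assoc] using
      hf (letter (γ₂ + label T) (g T) :: R)

theorem IsGradedSymmetric.wordInsert (γ : ZMod 2) {f : List (Letter 𝒱) → X}
    (hf : IsGradedSymmetric f) (hfa : HeadAdditive f) {g : List (Letter 𝒱) → V}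
    (hg : IsGradedSymmetric g) : IsGradedSymmetric (wordInsert γ f g) := by
  refine isGradedSymmetric_koszulSum (fun R T₁ T₂ a b => ?_) fun T R₁ R₂ a b =>
    hf (letter (γ + label T) (g T) :: R₁) R₂ a b
  have same_label : label (T₁ ++ a :: b :: T₂) = label (T₁ ++ b :: a :: T₂) :=
    label_perm ((List.Perm.swap b a T₂).append_left T₁)
  beta_reduce
  rw [hg, hfa.zsmul, same_label]

theorem HeadAdditive.wordInsert (γ : ZMod 2) {f : List (Letter 𝒱) → X}
    (hf : IsGradedSymmetric f) (hfa : HeadAdditive f) {g : List (Letter 𝒱) → V}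
    (hga : HeadAdditive g) : HeadAdditive (wordInsert γ f g) := by
  intro d x y l
  have second_additive : ∀ a R, f (a :: letter d (x + y) :: R) =
      f (a :: letter d x :: R) + f (a :: letter d y :: R) := fun a R => by
    simp only [hf.cons_cons a, letter_deg, hfa _ x y, smul_add]
  simp only [LInfty.wordInsert, koszulSum_cons, label_cons, letter_deg, second_additive, smul_add,
    hga d x y, hfa _ _ (g _), unshuffleSum_add]
  abel

/-- In the iterated insertion, `h` is inserted either into `g` or beside it. -/
theorem wordInsert_wordInsert (γ₁ γ₂ : ZMod 2) {f : List (Letter 𝒱) → X} (hf : HeadAdditive f)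
    (g h : List (Letter 𝒱) → V) (l : List (Letter 𝒱)) :
    wordInsert γ₂ (wordInsert γ₁ f g) h l =
      wordInsert (γ₁ + γ₂) f (wordInsert γ₂ g h) l + wordInsertPair γ₁ γ₂ f g h l := by
  simp only [wordInsert, wordInsertPair, koszulSum_cons, koszulSum, unshuffleSum_add]
  congr 1
  · rw [← unshuffleSum_assoc _ l fun A B R => f (letter (γ₁ + label (letter (γ₂ + label A) (h A) ::
      B)) (g (letter (γ₂ + label A) (h A) :: B)) :: R)]
    refine unshuffleSum_congr _ _ fun T R _ => ?_
    refine Eq.trans ?_ (hf.koszulSum _ _ _ _).symm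
    refine unshuffleSum_congr _ _ fun A B hp => ?_
    rw [label_cons, label_append_perm hp, letter_deg, add_assoc, add_assoc]
  · exact (unshuffleSum_assoc _ l fun A B R => ksign (label B * (γ₂ + label A)) •
      f (letter (γ₁ + label B) (g B) :: letter (γ₂ + label A) (h A) :: R)).symm

theorem wordInsertPair_swap (γ₁ γ₂ : ZMod 2) {f : List (Letter 𝒱) → X} (hf : IsGradedSymmetric f)
    (g h : List (Letter 𝒱) → V) (l : List (Letter 𝒱)) :
    wordInsertPair γ₁ γ₂ f g h l = ksign (γ₁ * γ₂) • wordInsertPair γ₂ γ₁ f h g l := by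
  simp only [wordInsertPair, koszulSum, ← unshuffleSum_smul]
  refine unshuffleSum_congr _ _ fun S R _ => ?_
  refine (koszulSum_comm _ _).trans (unshuffleSum_congr _ _ fun T U _ => ?_)
  rw [hf.cons_cons]
  simp only [letter_deg, ksign_smul_ksign_smul]
  exact ksign_smul_congr (by grind) _

theorem wordInsert_bracket (γ₁ γ₂ : ZMod 2) {f : List (Letter 𝒱) → X} (hfa : HeadAdditive f)
    (hf : IsGradedSymmetric f) (g h : List (Letter 𝒱) → V) (l : List (Letter 𝒱)) :
    wordInsert (γ₁ + γ₂) f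
        (fun l => wordInsert γ₂ g h l - ksign (γ₁ * γ₂) • wordInsert γ₁ h g l) l =
      wordInsert γ₂ (wordInsert γ₁ f g) h l -
        ksign (γ₁ * γ₂) • wordInsert γ₁ (wordInsert γ₂ f h) g l := by
  simp only [sub_eq_add_neg, ← neg_smul]
  rw [wordInsert_add_right _ hfa, wordInsert_zsmul_right _ hfa, wordInsert_wordInsert γ₁ γ₂ hfa,
    wordInsert_wordInsert γ₂ γ₁ hfa, wordInsertPair_swap γ₁ γ₂ hf, add_comm γ₂ γ₁]
  simp only [neg_smul, smul_add]
  abel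

end Words

section WordCochains

variable {K V X : Type*} [Ring K] [AddCommGroup V] [Module Kᵐᵒᵖ V]
  [AddCommGroup X] [Module Kᵐᵒᵖ X] {𝒦 : ZMod 2 → AddSubgroup K} {𝒱 : ZMod 2 → AddSubgroup V}
  [DirectSum.Decomposition 𝒱]

/-- Right linearity in the first letter of a word; `e` is the parity by which the values of `F` are
shifted relative to those of a `V`-valued cochain. -/
def HeadLinear (𝒦 : ZMod 2 → AddSubgroup K) (e : ZMod 2) (F : List (Letter 𝒱) → X) : Prop :=
  ∀ (s : ZMod 2) (t : K), t ∈ 𝒦 s → ∀ (d : ZMod 2) (x : V) (l : List (Letter 𝒱)),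
    F (letter (d + s) (MulOpposite.op t • x) :: l) =
      ksign (s * (label l + e)) • MulOpposite.op t • F (letter d x :: l)

theorem HeadLinear.wordInsert (γ : ZMod 2) {e : ZMod 2} {f : List (Letter 𝒱) → X}
    (hf : IsGradedSymmetric f) (hfa : HeadAdditive f) (hfl : HeadLinear 𝒦 e f)
    {g : List (Letter 𝒱) → V} (hgl : HeadLinear 𝒦 0 g) : HeadLinear 𝒦 e (wordInsert γ f g) := by
  intro s t ht d x l
  have second_linear : ∀ a R, f (a :: letter (d + s) (MulOpposite.op t • x) :: R) =
      ksign (s * (label R + e)) • MulOpposite.op t • f (a :: letter d x :: R) := fun a R => by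
    rw [hf.cons_cons, hfl s t ht, hf.cons_cons a, smul_comm (MulOpposite.op t)]
    simp only [ksign_smul_ksign_smul, letter_deg, label_cons]
    exact ksign_smul_congr (by grind) _
  simp only [LInfty.wordInsert, koszulSum_cons, smul_add, koszulSum, ← unshuffleSum_smul]
  congr 1 <;> refine unshuffleSum_congr _ _ fun T R hp => ?_
  · have shift : γ + label ((letter (d + s) (MulOpposite.op t • x) : Letter 𝒱) :: T) =
        γ + label ((letter d x : Letter 𝒱) :: T) + s := by
      simp only [label_cons, letter_deg]; ring
    rw [hgl s t ht, hfa.zsmul, shift, hfl s t ht, ksign_smul_ksign_smul, label_append_perm hp]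
    exact ksign_smul_congr (by ring) _
  · rw [second_linear, smul_comm (MulOpposite.op t) (ksign _)]
    simp only [ksign_smul_ksign_smul, letter_deg, label_append_perm hp]
    exact ksign_smul_congr (by ring) _

/-- The functions of words that correspond to cochains under the décalage `V ≅ V[1]`. -/
structure IsWordCochain (𝒦 : ZMod 2 → AddSubgroup K) (e : ZMod 2) (F : List (Letter 𝒱) → X) :
    Prop where
  symm : IsGradedSymmetric F
  add : HeadAdditive F
  linear : HeadLinear 𝒦 e F

theorem IsWordCochain.wordInsert (γ : ZMod 2) {e : ZMod 2} {f : List (Letter 𝒱) → X}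
    (hf : IsWordCochain 𝒦 e f) {g : List (Letter 𝒱) → V} (hg : IsWordCochain 𝒦 0 g) :
    IsWordCochain 𝒦 e (wordInsert γ f g) :=
  ⟨hf.symm.wordInsert γ hf.add hg.symm, hf.add.wordInsert γ hf.symm hg.add,
    hf.linear.wordInsert γ hf.symm hf.add hg.linear⟩

theorem IsWordCochain.append_cons_op_smul {F : List (Letter 𝒱) → X} (hF : IsWordCochain 𝒦 e F)
    {s : ZMod 2} {t : K} (ht : t ∈ 𝒦 s) (l₁ l₂ : List (Letter 𝒱)) (d : ZMod 2) (x : V) :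
    F (l₁ ++ letter (d + s) (MulOpposite.op t • x) :: l₂) =
      ksign (s * (label l₂ + e)) • MulOpposite.op t • F (l₁ ++ letter d x :: l₂) := by
  rw [hF.symm.append_cons, hF.symm.append_cons, hF.linear s t ht, smul_comm (MulOpposite.op t)]
  simp only [ksign_smul_ksign_smul, letter_deg, label_append]
  exact ksign_smul_congr (by grind) _

end WordCochains

/-! ### Koszul signs of permutations -/

section Koszul

variable {N : ℕ}

/-- Making `h` antisymmetric reduces the claim to
`Equiv.Perm.prod_Iio_comp_eq_sign_mul_prod`, since the signs of `σ` cancel. -/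
theorem prod_Iio_comp_perm (σ : Equiv.Perm (Fin N)) {h : Fin N → Fin N → ℤ}
    (hs : ∀ i j, h i j = h j i) :
    ∏ j, ∏ i ∈ Finset.Iio j, h (σ i) (σ j) = ∏ j, ∏ i ∈ Finset.Iio j, h i j := by
  let alt : Fin N → Fin N → ℤ := fun i j => if i < j then h i j else if j < i then -h i j else 0
  have alt_antisymm : ∀ i j, alt i j = -alt j i := fun i j => by
    rcases lt_trichotomy i j with hij | rfl | hij
    · simp [alt, hij, hij.not_gt, hs i j]
    · simp [alt]
    · simp [alt, hij, hij.not_gt, hs i j]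
  have alt_comp : ∏ j, ∏ i ∈ Finset.Iio j, alt (σ i) (σ j) =
      (σ.sign : ℤ) * ∏ j, ∏ i ∈ Finset.Iio j, h (σ i) (σ j) := by
    rw [Equiv.Perm.sign_eq_prod_prod_Iio]
    simp only [Units.coe_prod, ← Finset.prod_mul_distrib]
    refine Finset.prod_congr rfl fun j _ => Finset.prod_congr rfl fun i hi => ?_
    rcases (σ.injective.ne (Finset.mem_Iio.1 hi).ne).lt_or_gt with hij | hij <;>
      simp [alt, hij, hij.not_gt]
  have alt_eq : ∏ j, ∏ i ∈ Finset.Iio j, alt i j = ∏ j, ∏ i ∈ Finset.Iio j, h i j :=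
    Finset.prod_congr rfl fun j _ => Finset.prod_congr rfl fun i hi => by
      simp [alt, Finset.mem_Iio.1 hi]
  have sign_mul_eq := σ.prod_Iio_comp_eq_sign_mul_prod (R := ℤ) alt_antisymm
  rw [alt_comp, alt_eq] at sign_mul_eq
  exact mul_left_cancel₀ (Units.ne_zero σ.sign) sign_mul_eq

theorem koszul_eq_prod (σ : Equiv.Perm (Fin N)) (p : Fin N → ZMod 2) :
    koszul σ p = ∏ j, ∏ i ∈ Finset.Iio j,
      if (i < j ↔ σ i < σ j) then 1 else ksign (p (σ i) * p (σ j)) := by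
  rw [koszul, Finset.prod_comm]
  refine Finset.prod_congr rfl fun j _ => ?_
  have Iio_eq_filter : Finset.Iio j = Finset.univ.filter (· < j) := by ext; simp
  rw [Iio_eq_filter, Finset.prod_filter]
  refine Finset.prod_congr rfl fun i _ => ?_
  by_cases hij : i < j
  · rcases (σ.injective.ne hij.ne).lt_or_gt with h | h <;> simp [hij, h, h.not_gt]
  · simp [hij]

theorem koszul_mul (σ τ : Equiv.Perm (Fin N)) (p : Fin N → ZMod 2) :
    koszul (σ * τ) p = koszul σ p * koszul τ fun i => p (σ i) := by
  let sign_of_pair : Fin N → Fin N → ℤ := fun i j =>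
    if (i < j ↔ σ i < σ j) then 1 else ksign (p (σ i) * p (σ j))
  have pair_symm : ∀ i j, sign_of_pair i j = sign_of_pair j i := fun i j => by
    simp only [sign_of_pair, mul_comm (p (σ j))]
    rcases eq_or_ne i j with rfl | h
    · rfl
    · rcases h.lt_or_gt with h | h <;> rcases (σ.injective.ne h.ne).lt_or_gt with h' | h' <;>
        simp [h, h.not_gt, h', h'.not_gt]
  rw [koszul_eq_prod, koszul_eq_prod, koszul_eq_prod]
  change _ = (∏ j, ∏ i ∈ Finset.Iio j, sign_of_pair i j) * _
  rw [← prod_Iio_comp_perm τ pair_symm]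
  simp only [← Finset.prod_mul_distrib, sign_of_pair]
  refine Finset.prod_congr rfl fun j _ => Finset.prod_congr rfl fun i _ => ?_
  simp only [Equiv.Perm.mul_apply]
  by_cases h1 : i < j <;> by_cases h2 : τ i < τ j <;> by_cases h3 : σ (τ i) < σ (τ j) <;>
    simp [h1, h2, h3, ksign_mul_self]

theorem koszul_swap_castSucc_succ {m : ℕ} (i : Fin m) (p : Fin (m + 1) → ZMod 2) :
    koszul (Equiv.swap i.castSucc i.succ) p = ksign (p i.castSucc * p i.succ) := by
  rw [koszul, Finset.prod_eq_single i.castSucc, Finset.prod_eq_single i.succ]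
  · simp [mul_comm]
  · intro j _ hj
    refine if_neg fun ⟨h1, h2⟩ => ?_
    rw [Equiv.swap_apply_left, Equiv.swap_apply_of_ne_of_ne h1.ne' hj] at h2
    simp only [Fin.lt_def, Fin.val_castSucc, Fin.val_succ] at h1 h2
    omega
  · simp
  · intro k _ hk
    refine Finset.prod_eq_one fun j _ => if_neg fun ⟨h1, h2⟩ => ?_
    simp only [Equiv.swap_apply_def] at h2
    simp only [ne_eq, Fin.ext_iff, Fin.lt_def, Fin.val_castSucc, Fin.val_succ] at h1 h2 hk
    split_ifs at h2 <;> simp_all <;> omega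
  · simp

theorem sign_mul_koszul_swap {m : ℕ} (i : Fin m) (p : Fin (m + 1) → ZMod 2) :
    (Equiv.Perm.sign (Equiv.swap i.castSucc i.succ) : ℤ) *
      koszul (Equiv.swap i.castSucc i.succ) p = ksign (1 + p i.castSucc * p i.succ) := by
  rw [koszul_swap_castSucc_succ, Equiv.Perm.sign_swap (Fin.castSucc_lt_succ (i := i)).ne, ksign_add]
  rfl

theorem antisymm_of_swap {V X : Type*} [AddCommGroup V] [AddCommGroup X]
    {𝒱 : ZMod 2 → AddSubgroup V} {m : ℕ} {f : (Fin (m + 1) → V) → X}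
    (hf : ∀ (v : Fin (m + 1) → V) (p : Fin (m + 1) → ZMod 2), (∀ i, v i ∈ 𝒱 (p i)) →
      ∀ i : Fin m, f v = ksign (1 + p i.castSucc * p i.succ) •
        f fun j => v (Equiv.swap i.castSucc i.succ j))
    (v : Fin (m + 1) → V) (p : Fin (m + 1) → ZMod 2) (hv : ∀ i, v i ∈ 𝒱 (p i))
    (σ : Equiv.Perm (Fin (m + 1))) :
    f v = ((Equiv.Perm.sign σ : ℤ) * koszul σ p) • f fun i => v (σ i) := by
  have hσ : σ ∈ Submonoid.closure
      (Set.range fun i : Fin m => Equiv.swap i.castSucc i.succ) := by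
    rw [Equiv.Perm.mclosure_swap_castSucc_succ]; trivial
  induction hσ using Submonoid.closure_induction generalizing v p with
  | mem σ hσ =>
    obtain ⟨i, rfl⟩ := hσ
    rw [sign_mul_koszul_swap, hf v p hv i]
  | one =>
    have no_inversion : ∀ i j : Fin (m + 1), ¬(i < j ∧ j < i) := fun i j h => lt_asymm h.1 h.2
    simp [koszul, no_inversion]
  | mul σ τ _ _ hσ hτ =>
    rw [hσ v p hv, hτ (fun i => v (σ i)) (fun i => p (σ i)) fun i => hv (σ i), koszul_mul,
      Equiv.Perm.sign_mul, Units.val_mul, smul_smul]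
    simp only [Equiv.Perm.mul_apply]
    congr 1
    ring

end Koszul

section Lists

variable {α : Type*}

theorem ofFn_update {N : ℕ} (w : Fin N → α) (i : Fin N) (x : α) :
    List.ofFn (Function.update w i x) =
      (List.ofFn w).take i ++ x :: (List.ofFn w).drop (i + 1) := by
  have ofFn_set : List.ofFn (Function.update w i x) = (List.ofFn w).set i x := by
    refine List.ext_getElem (by simp) fun n _ _ => ?_
    simp only [List.getElem_ofFn, List.getElem_set, Function.update_apply, Fin.ext_iff]
    simp only [eq_comm]
  rw [ofFn_set, List.set_eq_take_append_cons_drop, if_pos (by simp)]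

theorem comp_swap_eq_update {m : ℕ} (w : Fin (m + 1) → α) (i : Fin m) :
    (fun j => w (Equiv.swap i.castSucc i.succ j)) =
      Function.update (Function.update w i.castSucc (w i.succ)) i.succ (w i.castSucc) := by
  funext j
  rcases eq_or_ne j i.succ with rfl | h1
  · simp
  · rcases eq_or_ne j i.castSucc with rfl | h2
    · simp [h1]
    · simp [h1, h2, Equiv.swap_apply_of_ne_of_ne h2 h1]

theorem ofFn_eq_take_append_drop {m : ℕ} (w : Fin (m + 1) → α) (i : Fin m) :
    List.ofFn w =
      (List.ofFn w).take i ++ w i.castSucc :: w i.succ :: (List.ofFn w).drop (i + 2) := by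
  conv_lhs => rw [← List.take_append_drop i (List.ofFn w),
    List.drop_eq_getElem_cons (by simp), List.drop_eq_getElem_cons (by simp)]
  simp only [List.getElem_ofFn]
  rfl

theorem ofFn_comp_swap {m : ℕ} (w : Fin (m + 1) → α) (i : Fin m) :
    List.ofFn (fun j => w (Equiv.swap i.castSucc i.succ j)) =
      (List.ofFn w).take i ++ w i.succ :: w i.castSucc :: (List.ofFn w).drop (i + 2) := by
  rw [comp_swap_eq_update, ofFn_update, ofFn_update]
  generalize hl : List.ofFn w = l
  have length_take : (l.take i).length = i := by
    rw [List.length_take, ← hl, List.length_ofFn]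
    omega
  simp only [List.drop_append, List.take_append, length_take, Fin.val_castSucc, Fin.val_succ,
    List.take_take, List.drop_take]
  have index_sub : (i : ℕ) + 1 + 1 - i = 2 := by omega
  have index_sub' : (i : ℕ) - (i + 1 + 1) = 0 := by omega
  simp [index_sub, index_sub']

theorem exists_ofFn_eq_append {α : Type*} (l₁ l₂ : List α) (a b : α) :
    ∃ (m : ℕ) (w : Fin (m + 1) → α) (i : Fin m), l₁ ++ a :: b :: l₂ = List.ofFn w ∧
      l₁ ++ b :: a :: l₂ = List.ofFn (fun j => w (Equiv.swap i.castSucc i.succ j)) ∧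
      w i.castSucc = a ∧ w i.succ = b := by
  let m := l₁.length + l₂.length + 1
  have length_eq : (l₁ ++ a :: b :: l₂).length = m + 1 := by simp [m]; omega
  let w : Fin (m + 1) → α := fun i => (l₁ ++ a :: b :: l₂)[i]
  let i : Fin m := ⟨l₁.length, by omega⟩
  have ofFn_w : List.ofFn w = l₁ ++ a :: b :: l₂ :=
    List.ext_getElem (by rw [List.length_ofFn, length_eq]) fun n _ _ => List.getElem_ofFn _
  have left : w i.castSucc = a := by simp [w, i]
  have right : w i.succ = b := by simp [w, i]
  refine ⟨m, w, i, ofFn_w.symm, ?_, left, right⟩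
  rw [ofFn_comp_swap, left, right, ofFn_w]
  simp [i, List.drop_append]

end Lists

/-! ### Décalage -/

section MultiAdditive

variable {V X : Type*} [AddCommGroup V] [AddCommGroup X]

/-- Additivity in every argument. -/
def MultiAdditive {N : ℕ} (f : (Fin N → V) → X) : Prop :=
  ∀ (v : Fin N → V) (i : Fin N) (x y : V), f (Function.update v i (x + y)) =
    f (Function.update v i x) + f (Function.update v i y)

namespace MultiAdditive

variable {N : ℕ} {f g : (Fin N → V) → X}

/-- A multi-additive function as a homomorphism in its argument with index `i`. -/
def updateHom (hf : MultiAdditive f) (v : Fin N → V) (i : Fin N) : V →+ X :=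
  AddMonoidHom.mk' (fun x => f (Function.update v i x)) (hf v i)

theorem update_zsmul (hf : MultiAdditive f) (v : Fin N → V) (i : Fin N) (n : ℤ) (x : V) :
    f (Function.update v i (n • x)) = n • f (Function.update v i x) :=
  map_zsmul (hf.updateHom v i) n x

theorem update_sum (hf : MultiAdditive f) (v : Fin N → V) (i : Fin N) {ι : Type*} (s : Finset ι)
    (x : ι → V) : f (Function.update v i (∑ j ∈ s, x j)) = ∑ j ∈ s, f (Function.update v i (x j)) :=
  map_sum (hf.updateHom v i) x s

theorem eq_zero (hf : MultiAdditive f) {v : Fin N → V} {i : Fin N} (hv : v i = 0) : f v = 0 := by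
  rw [← Function.update_eq_self i v, hv]
  exact map_zero (hf.updateHom v i)

/-- A multi-additive function as a multilinear map over the integers. -/
def toMultilinearMap (hf : MultiAdditive f) : MultilinearMap ℤ (fun _ : Fin N => V) X where
  toFun := f
  map_update_add' {inst} v i x y := by
    cases Subsingleton.elim inst (instDecidableEqFin N)
    exact hf v i x y
  map_update_smul' {inst} v i c x := by
    cases Subsingleton.elim inst (instDecidableEqFin N)
    exact hf.update_zsmul v i c x

theorem comp_hom (hf : MultiAdditive f) (A : Fin N → V →+ V) :
    MultiAdditive fun v => f fun i => A i (v i) := by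
  intro v i x y
  have comp_update : ∀ z, (fun j => A j (Function.update v i z j)) =
      Function.update (fun j => A j (v j)) i (A i z) := fun z => by
    funext j
    rcases eq_or_ne j i with rfl | hj <;> simp [*]
  simp only [comp_update, map_add, hf _ _ _ _]

theorem comp_update (hf : MultiAdditive f) (i : Fin N) (A : V →+ V) :
    MultiAdditive fun v => f (Function.update v i (A (v i))) := by
  convert hf.comp_hom (Function.update (fun _ => AddMonoidHom.id V) i A) using 3 with v
  funext j
  rcases eq_or_ne j i with rfl | hj <;> simp [*]

theorem map {Y : Type*} [AddCommGroup Y] (hf : MultiAdditive f) (A : X →+ Y) :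
    MultiAdditive fun v => A (f v) := fun v i x y => by simp only [hf v i x y, map_add]

theorem sum {ι : Type*} (s : Finset ι) {F : ι → (Fin N → V) → X}
    (hF : ∀ i ∈ s, MultiAdditive (F i)) : MultiAdditive fun v => ∑ i ∈ s, F i v := fun v i x y => by
  rw [← Finset.sum_add_distrib]
  exact Finset.sum_congr rfl fun j hj => hF j hj v i x y

variable (𝒱 : ZMod 2 → AddSubgroup V) [DirectSum.Decomposition 𝒱]

theorem eq_sum_proj (hf : MultiAdditive f) (v : Fin N → V) :
    f v = ∑ p : Fin N → ZMod 2, f fun i => proj 𝒱 (p i) (v i) := by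
  conv_lhs => rw [show v = fun i => ∑ p, proj 𝒱 p (v i) from funext fun i => (sum_proj 𝒱 _).symm]
  exact hf.toMultilinearMap.map_sum fun i p => proj 𝒱 p (v i)

theorem ext (hf : MultiAdditive f) (hg : MultiAdditive g)
    (h : ∀ (v : Fin N → V) (p : Fin N → ZMod 2), (∀ i, v i ∈ 𝒱 (p i)) → f v = g v) : f = g := by
  funext v
  rw [hf.eq_sum_proj 𝒱, hg.eq_sum_proj 𝒱]
  exact Finset.sum_congr rfl fun p _ => h _ p fun i => proj_mem 𝒱 _ _

end MultiAdditive

end MultiAdditive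

section Word

variable {V : Type*} [AddCommGroup V] {𝒱 : ZMod 2 → AddSubgroup V} [DirectSum.Decomposition 𝒱]
  {N : ℕ}

/-- The word of the components of parity `p i` in `V` of the entries `v i`. -/
def word (p : Fin N → ZMod 2) (v : Fin N → V) : List (Letter 𝒱) :=
  List.ofFn fun i => letter (p i + 1) (v i)

variable {p : Fin N → ZMod 2} {v : Fin N → V}

theorem map_deg_word : (word p v : List (Letter 𝒱)).map Letter.deg = (List.ofFn p).map (· + 1) := by
  simp [word, List.map_ofFn, Function.comp_def]

theorem length_word : (word p v : List (Letter 𝒱)).length = N := List.length_ofFn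

theorem word_update (i : Fin N) (q : ZMod 2) (x : V) :
    (word (Function.update p i q) (Function.update v i x) : List (Letter 𝒱)) =
      (word p v).take i ++ letter (q + 1) x :: (word p v).drop (i + 1) := by
  rw [word, word, ← ofFn_update]
  congr 1
  funext j
  rcases eq_or_ne j i with rfl | hj <;> simp [*]

theorem word_update_right (i : Fin N) (x : V) :
    (word p (Function.update v i x) : List (Letter 𝒱)) =
      (word p v).take i ++ letter (p i + 1) x :: (word p v).drop (i + 1) := by
  rw [← word_update, Function.update_eq_self]

theorem word_eq_append (i : Fin N) : (word p v : List (Letter 𝒱)) =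
    (word p v).take i ++ letter (p i + 1) (v i) :: (word p v).drop (i + 1) := by
  rw [← word_update_right, Function.update_eq_self]

theorem label_drop_word (k : ℕ) : label ((word p v : List (Letter 𝒱)).drop k) =
    ((List.ofFn p).drop k).sum + (((word p v : List (Letter 𝒱)).drop k).length : ZMod 2) := by
  have sum_map_add_one : ∀ l : List (ZMod 2), (l.map (· + 1)).sum = l.sum + l.length := fun l => by
    induction l with
    | nil => simp
    | cons a l ih => simp only [List.map_cons, List.sum_cons, ih, List.length_cons]; push_cast; ring
  rw [label, List.map_drop, map_deg_word, ← List.map_drop, sum_map_add_one]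
  simp [length_word]

theorem label_word : label (word p v : List (Letter 𝒱)) = ∑ i, p i + N := by
  simpa [List.sum_ofFn, length_word] using label_drop_word (p := p) (v := v) (𝒱 := 𝒱) 0

theorem exists_eq_word (l : List (Letter 𝒱)) :
    ∃ (v : Fin l.length → V) (p : Fin l.length → ZMod 2), (∀ i, v i ∈ 𝒱 (p i)) ∧ l = word p v := by
  refine ⟨fun i => (l.get i).val, fun i => (l.get i).deg + 1, fun i => (l.get i).mem, ?_⟩
  simp only [word, add_one_add_one, letter_deg_val]
  exact (List.ofFn_get l).symm

theorem word_proj (p : Fin N → ZMod 2) (v : Fin N → V) :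
    (word p fun i => proj 𝒱 (p i) (v i) : List (Letter 𝒱)) = word p v := by
  refine congrArg List.ofFn (funext fun i => ?_)
  simpa only [add_one_add_one] using letter_proj (𝒱 := 𝒱) (p i + 1) (v i)

variable {X : Type*} [AddCommGroup X] {F : List (Letter 𝒱) → X}

theorem multiAdditive_word (hF : IsGradedSymmetric F) (hFa : HeadAdditive F) (p : Fin N → ZMod 2) :
    MultiAdditive fun v => F (word p v) := fun v i x y => by
  simp only [word_update_right, hF.append_cons, letter_deg, hFa _ x y, smul_add]

theorem apply_word_eq_zero (hF : IsGradedSymmetric F) (hFa : HeadAdditive F)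
    {q : Fin N → ZMod 2} (hv : ∀ i, v i ∈ 𝒱 (p i)) (hpq : p ≠ q) : F (word q v) = 0 := by
  obtain ⟨i, hi⟩ := Function.ne_iff.1 hpq
  rw [← word_proj]
  exact (multiAdditive_word hF hFa q).eq_zero (i := i) (proj_of_mem_ne (hv i) hi)

end Word

section Decalage

/-- The exponent of the sign by which the décalage `V ≅ V[1]` acts on words with the given degrees
in `V[1]`; `e` is the parity by which the values of the functions of words are shifted relative to
`V`-valued cochains. -/
def decalage (e : ZMod 2) : List (ZMod 2) → ZMod 2
  | [] => 0
  | a :: l => (a + 1) * (l.length + e) + decalage e l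

theorem decalage_append (e : ZMod 2) (l₁ l₂ : List (ZMod 2)) :
    decalage e (l₁ ++ l₂) = decalage (l₂.length + e) l₁ + decalage e l₂ := by
  induction l₁ with
  | nil => simp [decalage]
  | cons a l₁ ih => simp only [List.cons_append, decalage, ih, List.length_append]; push_cast; ring

theorem decalage_swap (e : ZMod 2) (l₁ l₂ : List (ZMod 2)) (a b : ZMod 2) :
    decalage e (l₁ ++ a :: b :: l₂) = decalage e (l₁ ++ b :: a :: l₂) + a + b := by
  simp only [decalage_append, decalage, List.length_cons]
  grind

end Decalage

section WordForm

variable {V X : Type*} [AddCommGroup V] [AddCommGroup X] {𝒱 : ZMod 2 → AddSubgroup V}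

/-- The function of words that corresponds to a sequence of maps, including the décalage sign. -/
def wordForm (e : ZMod 2) (F : ∀ N : ℕ, (Fin N → V) → X) (l : List (Letter 𝒱)) : X :=
  ksign (decalage e (l.map Letter.deg)) • F l.length fun i => (l.get i).val

theorem wordForm_ofFn (e : ZMod 2) (F : ∀ N : ℕ, (Fin N → V) → X) {N : ℕ}
    (w : Fin N → Letter 𝒱) : wordForm e F (List.ofFn w) =
      ksign (decalage e ((List.ofFn w).map Letter.deg)) • F N fun i => (w i).val := by
  have values_eq : ∀ (M : ℕ) (h : M = N) (u : Fin M → Letter 𝒱), (∀ i, u i = w (i.cast h)) →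
      (F M fun i => (u i).val) = F N fun i => (w i).val := by
    rintro M rfl u hu
    simp [hu]
  rw [wordForm, values_eq _ List.length_ofFn _ fun i => by simp [Fin.cast]]

theorem wordForm_append_singleton (e : ZMod 2) (F : ∀ N : ℕ, (Fin N → V) → X)
    (l : List (Letter 𝒱)) (a : Letter 𝒱) :
    wordForm e F (l ++ [a]) = ksign (decalage e ((l ++ [a]).map Letter.deg)) •
      F (l.length + 1) (Fin.snoc (α := fun _ => V) (fun i => (l.get i).val) a.val) := by
  have eq_ofFn : l ++ [a] = List.ofFn (Fin.snoc (α := fun _ => Letter 𝒱) l.get a) := by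
    rw [List.ofFn_succ']
    simp
  rw [eq_ofFn, wordForm_ofFn]
  congr 2
  funext i
  refine Fin.lastCases ?_ (fun i => ?_) i <;> simp

theorem isGradedSymmetric_wordForm (e : ZMod 2) {F : ∀ N : ℕ, (Fin N → V) → X}
    (hF : ∀ (m : ℕ) (v : Fin (m + 1) → V) (p : Fin (m + 1) → ZMod 2), (∀ i, v i ∈ 𝒱 (p i)) →
      ∀ σ : Equiv.Perm (Fin (m + 1)),
        F (m + 1) v = ((Equiv.Perm.sign σ : ℤ) * koszul σ p) • F (m + 1) fun i => v (σ i)) :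
    IsGradedSymmetric (wordForm e F : List (Letter 𝒱) → X) := by
  intro l₁ l₂ a b
  have sign_swap := decalage_swap e (l₁.map Letter.deg) (l₂.map Letter.deg) a.deg b.deg
  simp only [← List.map_cons, ← List.map_append] at sign_swap
  obtain ⟨m, w, i, h1, h2, rfl, rfl⟩ := exists_ofFn_eq_append l₁ l₂ a b
  rw [h1, h2] at sign_swap
  rw [h1, h2, wordForm_ofFn, wordForm_ofFn, sign_swap,
    hF m (fun i => (w i).val) (fun i => (w i).deg + 1) (fun i => (w i).mem)
      (Equiv.swap i.castSucc i.succ), sign_mul_koszul_swap]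
  simp only [ksign_smul_ksign_smul]
  exact ksign_smul_congr (by grind) _

variable [DirectSum.Decomposition 𝒱]

theorem headAdditive_wordForm (e : ZMod 2) {F : ∀ N : ℕ, (Fin N → V) → X}
    (hF : ∀ m, MultiAdditive (F (m + 1))) :
    HeadAdditive (wordForm e F : List (Letter 𝒱) → X) := by
  intro d x y l
  have eq_update : ∀ z, wordForm e F (letter d z :: l) =
      ksign (decalage e (d :: l.map Letter.deg)) • F (l.length + 1)
        (Function.update (Fin.cons 0 fun i => (l.get i).val : Fin (l.length + 1) → V) 0
          (proj 𝒱 (d + 1) z)) := by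
    intro z
    rw [wordForm, Fin.update_cons_zero]
    congr 2
    funext i
    refine Fin.cases ?_ (fun i => ?_) i <;> rfl
  rw [eq_update, eq_update, eq_update, proj_add, hF, smul_add]

theorem wordForm_word (e : ZMod 2) (F : ∀ N : ℕ, (Fin N → V) → X) {N : ℕ} {v : Fin N → V}
    {p : Fin N → ZMod 2} (hv : ∀ i, v i ∈ 𝒱 (p i)) : wordForm e F (word p v : List (Letter 𝒱)) =
      ksign (decalage e ((List.ofFn p).map (· + 1))) • F N v := by
  rw [word, wordForm_ofFn, ← word, map_deg_word]
  simp only [letter_val, add_one_add_one, proj_of_mem (hv _)]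

theorem eq_wordForm_word (e : ZMod 2) (F : ∀ N : ℕ, (Fin N → V) → X) {N : ℕ} {v : Fin N → V}
    {p : Fin N → ZMod 2} (hv : ∀ i, v i ∈ 𝒱 (p i)) :
    F N v = ksign (decalage e ((List.ofFn p).map (· + 1))) •
      wordForm e F (word p v : List (Letter 𝒱)) := by
  rw [wordForm_word e F hv, ksign_smul_self]

theorem IsGradedSymmetric.apply_eq_swap {e : ZMod 2} {F : ∀ N : ℕ, (Fin N → V) → X}
    (hF : IsGradedSymmetric (wordForm e F : List (Letter 𝒱) → X)) {m : ℕ} {v : Fin (m + 1) → V}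
    {p : Fin (m + 1) → ZMod 2} (hv : ∀ i, v i ∈ 𝒱 (p i)) (i : Fin m) :
    F (m + 1) v = ksign (1 + p i.castSucc * p i.succ) •
      F (m + 1) fun j => v (Equiv.swap i.castSucc i.succ j) := by
  rw [eq_wordForm_word e F hv, eq_wordForm_word e F (p := fun j => p (Equiv.swap _ _ j))
    fun j => hv _, word, ofFn_eq_take_append_drop (fun i => letter (p i + 1) (v i)) i, hF,
    word, ofFn_comp_swap (fun i => letter (p i + 1) (v i)) i, ofFn_eq_take_append_drop p i,
    ofFn_comp_swap p i]
  simp only [List.map_append, List.map_cons, ksign_smul_ksign_smul, letter_deg]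
  rw [decalage_swap]
  exact ksign_smul_congr (by grind) _

/-- The sequence of multi-additive maps that corresponds to a function of words: the inverse of
`wordForm e`. -/
def ofWord (e : ZMod 2) (F : List (Letter 𝒱) → X) (N : ℕ) (v : Fin N → V) : X :=
  ∑ p : Fin N → ZMod 2, ksign (decalage e ((List.ofFn p).map (· + 1))) • F (word p v)

variable {F : List (Letter 𝒱) → X} (hF : IsGradedSymmetric F) (hFa : HeadAdditive F)

include hF hFa

theorem ofWord_of_mem (e : ZMod 2) {N : ℕ} {v : Fin N → V} {p : Fin N → ZMod 2}
    (hv : ∀ i, v i ∈ 𝒱 (p i)) :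
    ofWord e F N v = ksign (decalage e ((List.ofFn p).map (· + 1))) • F (word p v) := by
  refine Finset.sum_eq_single_of_mem p (Finset.mem_univ p) fun q _ hq => ?_
  rw [apply_word_eq_zero hF hFa hv hq.symm, smul_zero]

theorem multiAdditive_ofWord (e : ZMod 2) (N : ℕ) : MultiAdditive (ofWord e F N) :=
  MultiAdditive.sum _ fun p _ => (multiAdditive_word hF hFa p).map (zsmulAddGroupHom _)

theorem wordForm_ofWord (e : ZMod 2) : wordForm e (ofWord e F) = F := by
  funext l
  obtain ⟨v, p, hv, h⟩ := exists_eq_word l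
  rw [h, wordForm_word e _ hv, ofWord_of_mem hF hFa e hv, ksign_smul_self]

end WordForm

section Cochains

variable {K V X : Type*} [Ring K] [AddCommGroup V] [Module K V] [Module Kᵐᵒᵖ V]
  [AddCommGroup X] [Module Kᵐᵒᵖ X] {𝒦 : ZMod 2 → AddSubgroup K} {𝒱 : ZMod 2 → AddSubgroup V}
  [DirectSum.Decomposition 𝒱] {e : ZMod 2}

theorem headLinear_wordForm (hV : IsSupermodule 𝒦 𝒱) (e : ZMod 2) {F : ∀ N : ℕ, (Fin N → V) → X}
    (hF : ∀ m, IsCochain K 𝒱 (F (m + 1))) :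
    HeadLinear 𝒦 e (wordForm e F : List (Letter 𝒱) → X) := by
  intro s t ht d x l
  have cons_eq : ∀ a : Letter 𝒱, wordForm e F (a :: l) =
      ksign (a.deg * label l) • wordForm e F (l ++ [a]) :=
    fun a => (isGradedSymmetric_wordForm e fun m => (hF m).antisymm).cons_eq a l
  have last_linear := (hF l.length).map_op_smul
    (Fin.snoc (α := fun _ => V) (fun i => (l.get i).val) (proj 𝒱 (d + 1) x)) t
  simp only [Fin.snoc_last, Fin.update_snoc_last] at last_linear
  rw [cons_eq, cons_eq, wordForm_append_singleton, wordForm_append_singleton, letter_val,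
    add_right_comm, hV.proj_op_smul ht, last_linear, letter_val, smul_comm (MulOpposite.op t),
    smul_comm (MulOpposite.op t)]
  simp only [ksign_smul_ksign_smul, List.map_append, decalage_append, decalage, letter_deg,
    List.map_cons, List.map_nil, List.length_cons, List.length_nil]
  exact ksign_smul_congr (by grind) _

theorem isWordCochain_wordForm (hV : IsSupermodule 𝒦 𝒱) (e : ZMod 2)
    {F : ∀ N : ℕ, (Fin N → V) → X} (hF : ∀ m, IsCochain K 𝒱 (F (m + 1))) :
    IsWordCochain 𝒦 e (wordForm e F : List (Letter 𝒱) → X) :=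
  ⟨isGradedSymmetric_wordForm e fun m => (hF m).antisymm,
    headAdditive_wordForm e fun m => (hF m).add, headLinear_wordForm hV e hF⟩

section OfWordForm

variable {F : ∀ N : ℕ, (Fin N → V) → X}
  (hF : IsWordCochain 𝒦 e (wordForm e F : List (Letter 𝒱) → X))

include hF

theorem IsWordCochain.update_op_smul (hV : IsSupermodule 𝒦 𝒱) {N : ℕ} {v : Fin N → V}
    {p : Fin N → ZMod 2} (hv : ∀ i, v i ∈ 𝒱 (p i)) {s : ZMod 2} {t : K} (ht : t ∈ 𝒦 s)
    (i : Fin N) : F N (Function.update v i (MulOpposite.op t • v i)) =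
      ksign (s * ((List.ofFn p).drop (i + 1)).sum) • MulOpposite.op t • F N v := by
  have hv' : ∀ j, Function.update v i (MulOpposite.op t • v i) j ∈
      𝒱 (Function.update p i (p i + s) j) := fun j => by
    rcases eq_or_ne j i with rfl | hj
    · simpa using hV.op_smul_mem ht (hv j)
    · simpa [hj] using hv j
  have decalage_eq : decalage e ((List.ofFn p).map (· + 1)) = decalage e
      (((List.ofFn p).take i ++ p i :: (List.ofFn p).drop (i + 1)).map (· + 1)) := by
    rw [← ofFn_update, Function.update_eq_self]
  rw [eq_wordForm_word e F hv', eq_wordForm_word e F hv, word_update, add_right_comm,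
    hF.append_cons_op_smul ht, label_drop_word, ← word_eq_append, ofFn_update, decalage_eq]
  simp only [smul_comm (MulOpposite.op t), ksign_smul_ksign_smul, List.map_append, List.map_cons,
    decalage_append, decalage, List.length_cons, List.length_map, List.length_drop, length_word,
    List.length_ofFn]
  exact ksign_smul_congr (by grind) _

variable [DirectSum.Decomposition 𝒦] (hV : IsSupermodule 𝒦 𝒱) {m : ℕ}
  (hFm : MultiAdditive (F (m + 1)))

include hV hFm

theorem IsWordCochain.balanced (v : Fin (m + 1) → V) (i : Fin m) (t : K) :
    F (m + 1) (Function.update v i.castSucc (MulOpposite.op t • v i.castSucc)) =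
      F (m + 1) (Function.update v i.succ (t • v i.succ)) := by
  suffices H : ∀ (s : ZMod 2) (t : K), t ∈ 𝒦 s →
      F (m + 1) (Function.update v i.castSucc (MulOpposite.op t • v i.castSucc)) =
        F (m + 1) (Function.update v i.succ (t • v i.succ)) by
    rw [← sum_proj 𝒦 t, Finset.op_sum, Finset.sum_smul, Finset.sum_smul, hFm.update_sum,
      hFm.update_sum]
    exact Finset.sum_congr rfl fun s _ => H s _ (proj_mem 𝒦 _ _)
  intro s t ht
  refine congrFun (MultiAdditive.ext 𝒱
    (hFm.comp_update i.castSucc (DistribSMul.toAddMonoidHom V (MulOpposite.op t)))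
    (hFm.comp_update i.succ (DistribSMul.toAddMonoidHom V t)) fun v p hv => ?_) v
  have left_smul : t • v i.succ = ksign (s * p i.succ) • MulOpposite.op t • v i.succ := by
    rw [hV.op_smul s _ t _ ht (hv _), ksign_smul_self]
  have drop_eq : (List.ofFn p).drop (i + 1) = p i.succ :: (List.ofFn p).drop (i + 1 + 1) := by
    rw [List.drop_eq_getElem_cons (by simp), List.getElem_ofFn]
    rfl
  simp only [DistribSMul.toAddMonoidHom_apply]
  rw [left_smul, hFm.update_zsmul, hF.update_op_smul hV hv ht, hF.update_op_smul hV hv ht,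
    ksign_smul_ksign_smul, Fin.val_castSucc, Fin.val_succ, drop_eq, List.sum_cons, mul_add]

theorem IsWordCochain.update_last_op_smul (v : Fin (m + 1) → V) (t : K) :
    F (m + 1) (Function.update v (Fin.last m) (MulOpposite.op t • v (Fin.last m))) =
      MulOpposite.op t • F (m + 1) v := by
  suffices H : ∀ (s : ZMod 2) (t : K), t ∈ 𝒦 s →
      F (m + 1) (Function.update v (Fin.last m) (MulOpposite.op t • v (Fin.last m))) =
        MulOpposite.op t • F (m + 1) v by
    rw [← sum_proj 𝒦 t, Finset.op_sum, Finset.sum_smul, Finset.sum_smul, hFm.update_sum]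
    exact Finset.sum_congr rfl fun s _ => H s _ (proj_mem 𝒦 _ _)
  intro s t ht
  refine congrFun (MultiAdditive.ext 𝒱
    (hFm.comp_update (Fin.last m) (DistribSMul.toAddMonoidHom V (MulOpposite.op t)))
    (hFm.map (DistribSMul.toAddMonoidHom X (MulOpposite.op t))) fun v p hv => ?_) v
  simp only [DistribSMul.toAddMonoidHom_apply]
  rw [hF.update_op_smul hV hv ht, List.drop_eq_nil_of_le (by simp), List.sum_nil, mul_zero,
    ksign_zero, one_smul]

theorem IsWordCochain.isCochain : IsCochain K 𝒱 (F (m + 1)) where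
  add := hFm
  balanced := hF.balanced hV hFm
  map_op_smul := hF.update_last_op_smul hV hFm
  antisymm := antisymm_of_swap fun _ _ hv i => hF.symm.apply_eq_swap hv i

end OfWordForm

end Cochains

/-! ### Unshuffles as permutations -/

section Powerset

variable {α X : Type*} [LinearOrder α] [AddCommGroup X]

theorem filter_mem_insert_cons {a : α} {l : List α} (ha : a ∉ l) (s : Finset α) :
    (a :: l).filter (· ∈ insert a s) = a :: l.filter (· ∈ s) := by
  rw [List.filter_cons_of_pos (by simp)]
  exact congrArg _ (List.filter_congr fun x hx => by simp [ne_of_mem_of_not_mem hx ha])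

theorem filter_notMem_insert_cons {a : α} {l : List α} (ha : a ∉ l) (s : Finset α) :
    (a :: l).filter (· ∉ insert a s) = l.filter (· ∉ s) := by
  rw [List.filter_cons_of_neg (by simp)]
  exact List.filter_congr fun x hx => by simp [ne_of_mem_of_not_mem hx ha]

theorem toFinset_filter_mem {l : List α} {s : Finset α} (hs : s ⊆ l.toFinset) :
    (l.filter (· ∈ s)).toFinset = s := by
  ext x
  simpa using fun hx => List.mem_toFinset.1 (hs hx)

theorem unshuffleSum_eq_sum_powerset (w : α → α → ℤ) {l : List α} (hl : l.Pairwise (· < ·))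
    (F : List α → List α → X) :
    unshuffleSum w l F = ∑ s ∈ l.toFinset.powerset,
      (∏ t ∈ s, ∏ u ∈ (l.toFinset \ s).filter (· < t), w t u) •
        F (l.filter (· ∈ s)) (l.filter (· ∉ s)) := by
  induction l generalizing F with
  | nil => simp [unshuffleSum]
  | cons a l ih =>
    obtain ⟨a_lt, hl'⟩ := List.pairwise_cons.1 hl
    have a_notMem : a ∉ l := fun h => lt_irrefl _ (a_lt a h)
    have a_notMem' : a ∉ l.toFinset := mt List.mem_toFinset.1 a_notMem
    rw [unshuffleSum, ih hl', ih hl', List.toFinset_cons, Finset.sum_powerset_insert a_notMem',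
      add_comm]
    congr 1 <;> refine Finset.sum_congr rfl fun s hs => ?_ <;> rw [Finset.mem_powerset] at hs <;>
      have has : a ∉ s := fun h => a_notMem' (hs h)
    · have weight_insert : ∀ t ∈ s, ∏ u ∈ (insert a l.toFinset \ s).filter (· < t), w t u =
          (∏ u ∈ (l.toFinset \ s).filter (· < t), w t u) * w t a := fun t ht => by
        rw [Finset.insert_sdiff_of_notMem _ has, Finset.filter_insert,
          if_pos (a_lt t (List.mem_toFinset.1 (hs ht))), Finset.prod_insert (by simp [a_notMem]),
          mul_comm]
      rw [Finset.prod_congr rfl weight_insert, Finset.prod_mul_distrib, smul_smul,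
        ← List.prod_toFinset _ ((hl'.imp LT.lt.ne).filter _), toFinset_filter_mem hs,
        List.filter_cons_of_neg (by simpa), List.filter_cons_of_pos (by simpa)]
    · have no_smaller : (l.toFinset \ s).filter (· < a) = ∅ := Finset.filter_eq_empty_iff.2
        fun x hx => (a_lt x (List.mem_toFinset.1 (Finset.mem_sdiff.1 hx).1)).not_gt
      rw [filter_mem_insert_cons a_notMem, filter_notMem_insert_cons a_notMem,
        Finset.insert_sdiff_insert, Finset.sdiff_insert_of_notMem a_notMem',
        Finset.prod_insert has, no_smaller, Finset.prod_empty, one_mul]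

end Powerset

section Unshuffles

variable {N k : ℕ} {σ : Equiv.Perm (Fin N)}

theorem mem_unshuffles : σ ∈ unshuffles k N ↔
    ∀ i j : Fin N, i < j → (j.val < k ∨ k ≤ i.val) → σ i < σ j := by
  simp [unshuffles]

/-- The set of letters that an unshuffle moves to the first `k` positions. -/
def frontSet (k : ℕ) (σ : Equiv.Perm (Fin N)) : Finset (Fin N) :=
  Finset.univ.filter fun x => (σ.symm x).val < k

theorem mem_frontSet {x : Fin N} : x ∈ frontSet k σ ↔ (σ.symm x).val < k := by simp [frontSet]

theorem apply_mem_frontSet {i : Fin N} : σ i ∈ frontSet k σ ↔ i.val < k := by simp [mem_frontSet]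

theorem sign_mul_koszul (σ : Equiv.Perm (Fin N)) (p : Fin N → ZMod 2) :
    (Equiv.Perm.sign σ : ℤ) * koszul σ p =
      ∏ i, ∏ j, if i < j ∧ σ j < σ i then ksign (1 + p (σ i) * p (σ j)) else 1 := by
  rw [Equiv.Perm.sign_eq_prod_prod_Iio, koszul_eq_prod, Finset.prod_comm]
  simp only [Units.coe_prod, ← Finset.prod_mul_distrib]
  refine Finset.prod_congr rfl fun j _ => ?_
  rw [show Finset.Iio j = Finset.univ.filter (· < j) by ext; simp, Finset.prod_filter]
  refine Finset.prod_congr rfl fun i _ => ?_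
  by_cases hij : i < j
  · rcases (σ.injective.ne hij.ne).lt_or_gt with h | h <;>
      simp [hij, h, h.not_gt, ksign_add, ksign_one]
  · simp [hij]

theorem lt_and_apply_lt_iff (hσ : σ ∈ unshuffles k N) (i j : Fin N) : i < j ∧ σ j < σ i ↔
    σ i ∈ frontSet k σ ∧ σ j ∉ frontSet k σ ∧ σ j < σ i := by
  rw [apply_mem_frontSet, apply_mem_frontSet]
  constructor
  · rintro ⟨hij, h⟩
    have not_increasing := fun hk => (mem_unshuffles.1 hσ i j hij hk).not_gt h
    exact ⟨by_contra fun hk => not_increasing (.inr (not_lt.1 hk)),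
      fun hk => not_increasing (.inl hk), h⟩
  · rintro ⟨hi, hj, h⟩
    exact ⟨Fin.lt_def.2 (by omega), h⟩

theorem sign_mul_koszul_of_mem_unshuffles (hσ : σ ∈ unshuffles k N) (p : Fin N → ZMod 2) :
    (Equiv.Perm.sign σ : ℤ) * koszul σ p = ∏ t ∈ frontSet k σ,
      ∏ u ∈ (Finset.univ \ frontSet k σ).filter (· < t), ksign (1 + p t * p u) := by
  simp only [sign_mul_koszul, lt_and_apply_lt_iff hσ]
  rw [Equiv.prod_comp σ fun t => ∏ j, if t ∈ frontSet k σ ∧ σ j ∉ frontSet k σ ∧ σ j < t then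
    ksign (1 + p t * p (σ j)) else 1, ← Fintype.prod_ite_mem (frontSet k σ)]
  refine Finset.prod_congr rfl fun t _ => ?_
  rw [Equiv.prod_comp σ fun u => if t ∈ frontSet k σ ∧ u ∉ frontSet k σ ∧ u < t then
    ksign (1 + p t * p u) else 1]
  split_ifs with ht
  · simp only [ht, true_and, ← Finset.prod_filter]
    exact Finset.prod_congr (by ext; simp) fun _ _ => rfl
  · simp [ht]

theorem eq_filter_finRange {l : List (Fin N)} (hl : l.Pairwise (· < ·)) {s : Fin N → Prop}
    [DecidablePred s] (hs : ∀ x, x ∈ l ↔ s x) : l = (List.finRange N).filter (s ·) := by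
  refine List.Perm.eq_of_pairwise (le := (· < ·)) (fun a b _ _ hab hba => absurd hab hba.not_gt) hl
    ((List.pairwise_lt_finRange N).filter _) ?_
  rw [List.perm_ext_iff_of_nodup (hl.imp LT.lt.ne) ((List.nodup_finRange N).filter _)]
  simpa using hs

theorem take_ofFn_of_mem_unshuffles (hσ : σ ∈ unshuffles k N) :
    (List.ofFn σ).take k = (List.finRange N).filter (· ∈ frontSet k σ) := by
  refine eq_filter_finRange (List.pairwise_iff_getElem.2 fun i j hi hj hij => ?_) fun x => ?_
  · simp only [List.length_take, List.length_ofFn, List.getElem_take, List.getElem_ofFn] at hj ⊢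
    exact mem_unshuffles.1 hσ _ _ (Fin.lt_def.2 hij) (.inl (by simp; omega))
  · simp only [List.mem_take_iff_getElem, List.length_ofFn, List.getElem_ofFn, mem_frontSet]
    constructor
    · rintro ⟨j, hj, rfl⟩
      simp; omega
    · exact fun hx => ⟨σ.symm x, by omega, by simp⟩

theorem drop_ofFn_of_mem_unshuffles (hσ : σ ∈ unshuffles k N) :
    (List.ofFn σ).drop k = (List.finRange N).filter (· ∉ frontSet k σ) := by
  refine eq_filter_finRange (List.pairwise_iff_getElem.2 fun i j hi hj hij => ?_) fun x => ?_
  · simp only [List.getElem_drop, List.getElem_ofFn]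
    exact mem_unshuffles.1 hσ _ _ (Fin.lt_def.2 (by simpa)) (.inr (by simp))
  · simp only [List.mem_drop_iff_getElem, List.length_ofFn, List.getElem_ofFn, mem_frontSet, not_lt]
    constructor
    · rintro ⟨j, hj, rfl⟩
      simp
    · exact fun hx => ⟨σ.symm x - k, by omega, by simp [Nat.add_sub_cancel' hx]⟩

end Unshuffles

section UnshuffleBridge

variable {k m : ℕ}

theorem card_frontSet (σ : Equiv.Perm (Fin (k + m))) : (frontSet k σ).card = k := by
  have eq_map : frontSet k σ =
      (Finset.univ.filter fun i : Fin (k + m) => i.val < k).map σ.toEmbedding := by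
    ext x
    simp [mem_frontSet]
  rw [eq_map, Finset.card_map, Fin.card_filter_val_lt]
  omega

theorem exists_mem_unshuffles_frontSet_eq {s : Finset (Fin (k + m))} (hs : s.card = k) :
    ∃ σ ∈ unshuffles k (k + m), frontSet k σ = s := by
  have hsc : sᶜ.card = m := by rw [Finset.card_compl, hs, Fintype.card_fin]; omega
  let σ : Equiv.Perm (Fin (k + m)) := finSumFinEquiv.symm.trans (finSumEquivOfFinset hs hsc)
  have apply_left : ∀ i : Fin k, σ (Fin.castAdd m i) = s.orderEmbOfFin hs i := fun i => by simp [σ]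
  have apply_right : ∀ i : Fin m, σ (Fin.natAdd k i) = sᶜ.orderEmbOfFin hsc i := fun i => by
    simp [σ]
  refine ⟨σ, mem_unshuffles.2 fun i j hij h => ?_,
    Finset.eq_of_subset_of_card_le (fun x hx => ?_) (by rw [card_frontSet, hs])⟩
  · induction i using Fin.addCases <;> induction j using Fin.addCases <;>
      simp only [Fin.lt_def, Fin.val_castAdd, Fin.val_natAdd] at hij h
    · rw [apply_left, apply_left]
      exact (s.orderEmbOfFin hs).strictMono (Fin.lt_def.2 hij)
    · omega
    · omega
    · rw [apply_right, apply_right]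
      exact (sᶜ.orderEmbOfFin hsc).strictMono (Fin.lt_def.2 (Nat.lt_of_add_lt_add_left hij))
  · obtain ⟨i, rfl⟩ := σ.surjective x
    have hi := apply_left ⟨i, apply_mem_frontSet.1 hx⟩
    exact hi ▸ s.orderEmbOfFin_mem hs _

theorem sum_unshuffles_eq_unshuffleSum {X : Type*} [AddCommGroup X] (p : Fin (k + m) → ZMod 2)
    (G : List (Fin (k + m)) → List (Fin (k + m)) → X) :
    ∑ σ ∈ unshuffles k (k + m), ((Equiv.Perm.sign σ : ℤ) * koszul σ p) •
        G ((List.ofFn σ).take k) ((List.ofFn σ).drop k) =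
      unshuffleSum (fun a b => ksign (1 + p a * p b)) (List.finRange (k + m))
        fun T R => if T.length = k then G T R else 0 := by
  have length_filter_mem : ∀ s : Finset (Fin (k + m)),
      ((List.finRange (k + m)).filter (· ∈ s)).length = s.card := fun s => by
    rw [← List.toFinset_card_of_nodup ((List.nodup_finRange _).filter _),
      toFinset_filter_mem fun x _ => by simp]
  rw [unshuffleSum_eq_sum_powerset _ (List.pairwise_lt_finRange _)]
  simp only [List.toFinset_finRange, length_filter_mem, smul_ite, smul_zero]
  rw [← Finset.sum_filter]
  refine Finset.sum_bij (fun σ _ => frontSet k σ) (fun σ _ => by simp [card_frontSet])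
    (fun σ hσ τ hτ h => ?_) (fun s hs => ?_) fun σ hσ => ?_
  · refine Equiv.coe_fn_injective (List.ofFn_injective ?_)
    rw [← List.take_append_drop k (List.ofFn σ), ← List.take_append_drop k (List.ofFn τ),
      take_ofFn_of_mem_unshuffles hσ, drop_ofFn_of_mem_unshuffles hσ,
      take_ofFn_of_mem_unshuffles hτ, drop_ofFn_of_mem_unshuffles hτ]
    simp only [h]
  · obtain ⟨σ, hσ, h⟩ := exists_mem_unshuffles_frontSet_eq (Finset.mem_filter.1 hs).2
    exact ⟨σ, hσ, h⟩
  · rw [sign_mul_koszul_of_mem_unshuffles hσ, take_ofFn_of_mem_unshuffles hσ,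
      drop_ofFn_of_mem_unshuffles hσ]

end UnshuffleBridge

section InsertTerm

variable {V X : Type*} [AddCommGroup V] {𝒱 : ZMod 2 → AddSubgroup V}

/-- The summand of `insertAt` with inserted arguments `T` and remaining arguments `R`. -/
def insertTerm {m b : ℕ} (f : (Fin (m + 1) → V) → X) (g : (Fin (b + 1) → V) → V)
    (T R : List (Letter 𝒱)) : X :=
  f (Fin.cons (g fun i => (T.map Letter.val).getD i 0) fun j : Fin m =>
    (R.map Letter.val).getD j 0)

theorem insertTerm_eq (F : ∀ N : ℕ, (Fin N → V) → X) (G : ∀ N : ℕ, (Fin N → V) → V)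
    (a : Letter 𝒱) (T R : List (Letter 𝒱)) :
    insertTerm (F (R.length + 1)) (G (T.length + 1)) (a :: T) R =
      F (R.length + 1) (Fin.cons (G (T.length + 1) fun i => ((a :: T).get i).val)
        fun i => (R.get i).val) := by
  have getD_map_val : ∀ (l : List (Letter 𝒱)) (i : Fin l.length),
      (l.map Letter.val).getD i 0 = (l.get i).val := fun l i => by
    rw [List.getD_eq_getElem _ _ (by simp), List.getElem_map]
    rfl
  simp only [insertTerm, getD_map_val R]
  exact congrArg _ (congrArg (Fin.cons · _) (congrArg _ (funext (getD_map_val (a :: T)))))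

theorem argAt_eq_getD {N : ℕ} (v : Fin N → V) (i : ℕ) : argAt v i = (List.ofFn v).getD i 0 := by
  unfold argAt
  split_ifs with h
  · rw [List.getD_eq_getElem _ _ (by simpa using h), List.getElem_ofFn]
  · rw [List.getD_eq_default _ _ (by simpa using h)]

end InsertTerm

section InsertAt

variable {V X : Type*} [AddCommGroup V] [AddCommGroup X] {𝒱 : ZMod 2 → AddSubgroup V}

theorem insertAt_eq_unshuffleSum [DirectSum.Decomposition 𝒱] {m b N : ℕ} (hN : b + 1 + m = N)
    (f : (Fin (m + 1) → V) → X) (g : (Fin (b + 1) → V) → V) {p : Fin N → ZMod 2} {v : Fin N → V}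
    (hv : ∀ i, v i ∈ 𝒱 (p i)) :
    insertAt f g p v = unshuffleSum (fun a b => ksign (1 + (a.deg + 1) * (b.deg + 1)))
      (word p v : List (Letter 𝒱))
      fun T R => if T.length = b + 1 then insertTerm f g T R else 0 := by
  subst hN
  rw [word, List.ofFn_eq_map, unshuffleSum_map]
  simp only [letter_deg, add_one_add_one, List.length_map]
  rw [← sum_unshuffles_eq_unshuffleSum p fun T R => insertTerm f g
    (T.map fun i => (letter (p i + 1) (v i) : Letter 𝒱)) (R.map fun i => letter (p i + 1) (v i)),
    insertAt]
  refine Finset.sum_congr rfl fun σ _ => congrArg _ ?_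
  simp only [insertTerm, argAt_eq_getD, Function.comp_def, List.map_take, List.map_drop,
    List.map_ofFn, letter_val, add_one_add_one, proj_of_mem (hv _), List.getD_eq_getElem?_getD,
    List.getElem?_drop, List.getElem?_take_of_lt (Fin.isLt _)]

end InsertAt

section DecalageInsert

variable {V X : Type*} [AddCommGroup V] [AddCommGroup X] {𝒱 : ZMod 2 → AddSubgroup V}

theorem decalage_eq_add (e : ZMod 2) (l : List (ZMod 2)) :
    decalage e l = decalage 0 l + e * (l.sum + l.length) := by
  induction l with
  | nil => simp [decalage]
  | cons a l ih => simp only [decalage, ih, List.sum_cons, List.length_cons]; push_cast; ring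

theorem prod_ksign_one_add (T : List (Letter 𝒱)) (c : ZMod 2) :
    (T.map fun t => ksign (1 + (t.deg + 1) * (c + 1))).prod =
      ksign (T.length + (label T + T.length) * (c + 1)) := by
  induction T with
  | nil => simp [ksign_zero]
  | cons t T ih =>
    rw [List.map_cons, List.prod_cons, ih, ← ksign_add, List.length_cons, label_cons]
    congr 1
    push_cast
    ring

/-- The décalage signs turn the graded antisymmetric Koszul signs on `V` into the graded symmetric
ones on `V[1]`. -/
theorem unshuffleSum_eq_koszulSum (e : ZMod 2) (l : List (Letter 𝒱))
    (F : List (Letter 𝒱) → List (Letter 𝒱) → X) :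
    unshuffleSum (fun a b => ksign (1 + (a.deg + 1) * (b.deg + 1))) l F =
      ksign (decalage e (l.map Letter.deg)) • koszulSum l fun T R =>
        ksign (decalage e (T.map Letter.deg) + decalage e (R.map Letter.deg) +
          (label T + T.length) * R.length) • F T R := by
  have length_eq : ∀ {l T R : List (Letter 𝒱)}, (T ++ R).Perm l →
      (l.length : ZMod 2) = T.length + R.length := fun hp => by
    rw [← hp.length_eq, List.length_append, Nat.cast_add]
  induction l generalizing F with
  | nil => simp [unshuffleSum, decalage, ksign_zero]
  | cons a l ih =>
    rw [koszulSum_cons, unshuffleSum, ih, ih, smul_add]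
    simp only [koszulSum, ← unshuffleSum_smul, prod_ksign_one_add]
    congr 1 <;> refine unshuffleSum_congr _ _ fun T R hp => ?_ <;>
      simp only [ksign_smul_ksign_smul, List.map_cons, decalage, label_cons, List.length_cons,
        List.length_map, length_eq hp] <;>
      push_cast <;> exact ksign_smul_congr (by grind) _

theorem ksign_smul_insertTerm_eq [DirectSum.Decomposition 𝒱] (e γ : ZMod 2)
    {F : ∀ N : ℕ, (Fin N → V) → X} {G : ∀ N : ℕ, (Fin N → V) → V}
    (hF : HeadAdditive (wordForm e F : List (Letter 𝒱) → X))
    (hG : HasDegree 𝒱 1 γ (wordForm 0 G : List (Letter 𝒱) → V)) (a : Letter 𝒱)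
    (T R : List (Letter 𝒱)) :
    ksign ((γ + T.length) * (R.length + e) + (decalage e ((a :: T).map Letter.deg) +
        decalage e (R.map Letter.deg) + (label (a :: T) + (a :: T).length) * R.length)) •
        insertTerm (F (R.length + 1)) (G (T.length + 1)) (a :: T) R =
      wordForm e F (letter (γ + label (a :: T)) (wordForm 0 G (a :: T)) :: R) := by
  have insert_mem : G (T.length + 1) (fun i => ((a :: T).get i).val) ∈
      𝒱 (γ + label (a :: T) + 1) := by
    have smul_mem := (𝒱 _).zsmul_mem (hG (a :: T)) (ksign (decalage 0 ((a :: T).map Letter.deg)))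
    rwa [wordForm, ksign_smul_self] at smul_mem
  have wordForm_cons : ∀ d z, z ∈ 𝒱 (d + 1) → wordForm e F (letter d z :: R) =
      ksign (decalage e (d :: R.map Letter.deg)) •
        F (R.length + 1) (Fin.cons z fun i => (R.get i).val) := fun d z hz => by
    rw [wordForm]
    congr 2
    funext i
    exact Fin.cases (proj_of_mem hz) (fun i => rfl) i
  have label_eq : label (a :: T) = ((a :: T).map Letter.deg).sum := rfl
  have wordForm_letter : wordForm e F (letter (γ + label (a :: T)) (wordForm 0 G (a :: T)) :: R) =
      _ := (hF.zsmul _ _ _ _).trans (congrArg _ (wordForm_cons _ _ insert_mem))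
  rw [wordForm_letter, insertTerm_eq, ksign_smul_ksign_smul,
    decalage_eq_add e ((a :: T).map Letter.deg), ← label_eq]
  simp only [decalage, label_cons, List.length_cons, List.length_map]
  push_cast
  exact ksign_smul_congr (by grind) _

theorem sum_ite_insertTerm_eq [DirectSum.Decomposition 𝒱] (e γ : ZMod 2)
    {F : ∀ N : ℕ, (Fin N → V) → X} {G : ∀ N : ℕ, (Fin N → V) → V}
    (hF : HeadAdditive (wordForm e F : List (Letter 𝒱) → X))
    (hG : HasDegree 𝒱 1 γ (wordForm 0 G : List (Letter 𝒱) → V)) (hG₀ : G 0 = 0) {n : ℕ}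
    {T R : List (Letter 𝒱)} (length_eq : T.length + R.length = n + 1) :
    ∑ mb ∈ Finset.HasAntidiagonal.antidiagonal n, (ksign ((γ + mb.2) * (mb.1 + e) +
        (decalage e (T.map Letter.deg) + decalage e (R.map Letter.deg) +
          (label T + T.length) * R.length)) •
        if T.length = mb.2 + 1 then insertTerm (F (mb.1 + 1)) (G (mb.2 + 1)) T R else 0) =
      wordForm e F (letter (γ + label T) (wordForm 0 G T) :: R) := by
  cases T with
  | nil =>
    rw [show wordForm 0 G ([] : List (Letter 𝒱)) = ksign 0 • G 0 _ from rfl, hG₀, Pi.zero_apply,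
      smul_zero, hF.zero]
    exact Finset.sum_eq_zero fun mb _ => by simp
  | cons a T =>
    rw [List.length_cons] at length_eq
    rw [Finset.sum_eq_single_of_mem (R.length, T.length)
      (Finset.HasAntidiagonal.mem_antidiagonal.2 (by change R.length + T.length = n; omega))]
    · exact (congrArg _ (if_pos rfl)).trans (ksign_smul_insertTerm_eq e γ hF hG a T R)
    · intro mb hmb hne
      rw [Finset.HasAntidiagonal.mem_antidiagonal] at hmb
      refine (congrArg _ (if_neg fun h => hne ?_)).trans (smul_zero _)
      rw [List.length_cons] at h
      exact Prod.ext (by change mb.1 = R.length; omega) (by change mb.2 = T.length; omega)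

theorem sum_insertAt [DirectSum.Decomposition 𝒱] (e γ : ZMod 2) {F : ∀ N : ℕ, (Fin N → V) → X}
    {G : ∀ N : ℕ, (Fin N → V) → V} (hF : HeadAdditive (wordForm e F : List (Letter 𝒱) → X))
    (hG : HasDegree 𝒱 1 γ (wordForm 0 G : List (Letter 𝒱) → V)) (hG₀ : G 0 = 0) {n : ℕ}
    {v : Fin (n + 1) → V} {p : Fin (n + 1) → ZMod 2} (hv : ∀ i, v i ∈ 𝒱 (p i)) :
    ∑ mb ∈ Finset.HasAntidiagonal.antidiagonal n, ksign ((γ + mb.2) * (mb.1 + e)) •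
        insertAt (F (mb.1 + 1)) (G (mb.2 + 1)) p v =
      ksign (decalage e ((List.ofFn p).map (· + 1))) •
        wordInsert γ (wordForm e F) (wordForm 0 G) (word p v : List (Letter 𝒱)) := by
  have summand_eq : ∀ mb ∈ Finset.HasAntidiagonal.antidiagonal n,
      ksign ((γ + mb.2) * (mb.1 + e)) • insertAt (F (mb.1 + 1)) (G (mb.2 + 1)) p v =
        ksign (decalage e ((List.ofFn p).map (· + 1))) •
        koszulSum (word p v : List (Letter 𝒱)) fun T R => ksign ((γ + mb.2) * (mb.1 + e) +
          (decalage e (T.map Letter.deg) + decalage e (R.map Letter.deg) +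
            (label T + T.length) * R.length)) •
          if T.length = mb.2 + 1 then insertTerm (F (mb.1 + 1)) (G (mb.2 + 1)) T R else 0 := by
    intro mb hmb
    rw [Finset.HasAntidiagonal.mem_antidiagonal] at hmb
    rw [insertAt_eq_unshuffleSum (by omega) _ _ hv, unshuffleSum_eq_koszulSum e, map_deg_word,
      smul_comm]
    simp only [koszulSum, ← unshuffleSum_smul, ksign_smul_ksign_smul]
  rw [Finset.sum_congr rfl summand_eq, ← Finset.smul_sum]
  simp only [koszulSum]
  rw [← unshuffleSum_sum, wordInsert]
  exact congrArg _ (unshuffleSum_congr _ _ fun T R hp => sum_ite_insertTerm_eq e γ hF hG hG₀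
    (by rw [← List.length_append, hp.length_eq, length_word]))

end DecalageInsert

/-! ### The inner product -/

section DegreePart

variable {V X : Type*} [AddCommGroup V] [AddCommGroup X] {𝒱 : ZMod 2 → AddSubgroup V}
  (𝒳 : ZMod 2 → AddSubgroup X) [DirectSum.Decomposition 𝒳] (u γ : ZMod 2)

/-- The component of degree `γ` of a function of words, in the sense of `HasDegree 𝒳 u`. -/
def degreePart (F : List (Letter 𝒱) → X) (l : List (Letter 𝒱)) : X :=
  proj 𝒳 (γ + label l + u) (F l)

variable {F : List (Letter 𝒱) → X}

theorem hasDegree_degreePart : HasDegree 𝒳 u γ (degreePart 𝒳 u γ F) := fun _ => proj_mem 𝒳 _ _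

theorem sum_degreePart (l : List (Letter 𝒱)) : ∑ γ, degreePart 𝒳 u γ F l = F l := by
  conv_rhs => rw [← sum_proj 𝒳 (F l)]
  refine Fintype.sum_equiv (Equiv.addRight (label l + u)) _ _ fun γ => ?_
  rw [degreePart, Equiv.coe_addRight, add_assoc]

variable {u γ 𝒳}

theorem degreePart_of_hasDegree_ne (hF : HasDegree 𝒳 u γ F) {γ' : ZMod 2} (h : γ' ≠ γ) :
    degreePart 𝒳 u γ' F = 0 :=
  funext fun l => proj_of_mem_ne (hF l) (by simpa using h.symm)

theorem IsGradedSymmetric.degreePart (hF : IsGradedSymmetric F) :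
    IsGradedSymmetric (degreePart 𝒳 u γ F) := fun l₁ l₂ a b => by
  have same_label : label (l₁ ++ a :: b :: l₂) = label (l₁ ++ b :: a :: l₂) :=
    label_perm ((List.Perm.swap b a l₂).append_left l₁)
  rw [LInfty.degreePart, hF, same_label]
  exact map_zsmul (projHom 𝒳 _) _ _

variable [DirectSum.Decomposition 𝒱]

theorem HeadAdditive.degreePart (hF : HeadAdditive F) :
    HeadAdditive (degreePart 𝒳 u γ F) := fun d x y l => by
  simp only [LInfty.degreePart, hF d x y l, proj_add, label_cons, letter_deg]

theorem wordInsert_degreePart {f : List (Letter 𝒱) → X} (g : List (Letter 𝒱) → V) :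
    wordInsert γ f (LInfty.degreePart 𝒱 1 γ g) = wordInsert γ f g := by
  funext l
  simp only [wordInsert, LInfty.degreePart, letter_proj]

end DegreePart

section ParityPart

variable {V : Type*} [AddCommGroup V] {𝒱 : ZMod 2 → AddSubgroup V} [DirectSum.Decomposition 𝒱]
  {N : ℕ} {f : (Fin N → V) → V}

theorem parityPart_of_mem (hf : MultiAdditive f) (q : ZMod 2) {v : Fin N → V} {p : Fin N → ZMod 2}
    (hv : ∀ i, v i ∈ 𝒱 (p i)) : parityPart 𝒱 q f v = proj 𝒱 (q + ∑ i, p i) (f v) := by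
  rw [parityPart, Finset.sum_eq_single_of_mem p (Finset.mem_univ p)]
  · simp only [proj_of_mem (hv _)]
  · intro p' _ hp'
    obtain ⟨i, hi⟩ := Function.ne_iff.1 hp'
    rw [hf.eq_zero (i := i) (proj_of_mem_ne (hv i) (Ne.symm hi))]
    exact map_zero (projHom 𝒱 _)

theorem multiAdditive_parityPart (hf : MultiAdditive f) (q : ZMod 2) :
    MultiAdditive (parityPart 𝒱 q f) :=
  MultiAdditive.sum _ fun p _ =>
    (hf.comp_hom fun i => projHom 𝒱 (p i)).map (projHom 𝒱 (q + ∑ i, p i))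

theorem parityPart_of_hasParity (hf : MultiAdditive f) {q : ZMod 2}
    (hq : HasParity 𝒱 𝒱 q f) : parityPart 𝒱 q f = f :=
  MultiAdditive.ext 𝒱 (multiAdditive_parityPart hf q) hf fun v p hv => by
    rw [parityPart_of_mem hf q hv, proj_of_mem (hq v p hv)]

theorem parityPart_of_hasParity_ne (hf : MultiAdditive f) {q q' : ZMod 2}
    (hq : HasParity 𝒱 𝒱 q f) (h : q ≠ q') : parityPart 𝒱 q' f = 0 :=
  MultiAdditive.ext 𝒱 (multiAdditive_parityPart hf q') (fun _ _ _ _ => (add_zero 0).symm)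
    fun v p hv => by
      rw [parityPart_of_mem hf q' hv, proj_of_mem_ne (hq v p hv) (by simpa using h)]
      rfl

end ParityPart

section CochainWord

variable {V K : Type*}

/-- The maps of a cochain family, indexed by their number of arguments. -/
def cochainSeq [Zero V] (φ : CochainFamily V) : ∀ N : ℕ, (Fin N → V) → V
  | 0 => 0
  | d + 1 => φ d

/-- The maps of a form family, indexed by their number of arguments. -/
def formSeq [Zero K] (f : FormFamily V K) : ∀ N : ℕ, (Fin N → V) → K
  | 0 => 0
  | 1 => 0
  | d + 2 => f d

variable [AddCommGroup V] [AddCommGroup K] {𝒱 : ZMod 2 → AddSubgroup V}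

/-- The function of words that corresponds to a cochain family. -/
abbrev cochainWord (φ : CochainFamily V) : List (Letter 𝒱) → V := wordForm 0 (cochainSeq φ)

/-- The function of words that corresponds to a form family. -/
abbrev formWord (f : FormFamily V K) : List (Letter 𝒱) → K := wordForm 1 (formSeq f)

variable [DirectSum.Decomposition 𝒱]

theorem cochainWord_parityPart {φ : CochainFamily V} (hφ : ∀ d, MultiAdditive (φ d))
    (γ : ZMod 2) : (cochainWord fun d => parityPart 𝒱 (γ + d) (φ d) : List (Letter 𝒱) → V) =
      degreePart 𝒱 1 γ (cochainWord φ) := by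
  funext l
  obtain ⟨v, p, hv, h⟩ := exists_eq_word l
  rw [h, degreePart, cochainWord, cochainWord, wordForm_word 0 _ hv, wordForm_word 0 _ hv,
    label_word]
  refine Eq.trans ?_ (map_zsmul (projHom 𝒱 _) _ _).symm
  congr 1
  generalize l.length = N at v p hv
  cases N with
  | zero => exact (map_zero (projHom 𝒱 _)).symm
  | succ d =>
    refine (parityPart_of_mem (hφ d) _ hv).trans (congrArg (proj 𝒱 · (φ d v)) ?_)
    push_cast
    grind

end CochainWord

section Words

variable {K V : Type*} [Ring K] [AddCommGroup V] [Module K V] [Module Kᵐᵒᵖ V]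
  {𝒱 : ZMod 2 → AddSubgroup V}

theorem isCochain_formSeq {f : FormFamily V K} (hf : f ∈ Forms K 𝒱) :
    ∀ m, IsCochain K 𝒱 (formSeq f (m + 1))
  | 0 => ⟨fun _ _ _ _ => (add_zero 0).symm, fun _ _ _ => rfl, fun _ _ => (smul_zero _).symm,
      fun _ _ _ _ => (smul_zero _).symm⟩
  | d + 1 => hf d

theorem isGradedSymmetric_cochainWord {φ : CochainFamily V} (hφ : InC K 𝒱 φ) :
    IsGradedSymmetric (cochainWord φ : List (Letter 𝒱) → V) :=
  isGradedSymmetric_wordForm 0 fun m => (hφ m).antisymm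

theorem isGradedSymmetric_formWord {f : FormFamily V K} (hf : f ∈ Forms K 𝒱) :
    IsGradedSymmetric (formWord f : List (Letter 𝒱) → K) :=
  isGradedSymmetric_wordForm 1 fun m => (isCochain_formSeq hf m).antisymm

end Words

section InnerProduct

/-- `f` is the function of words that the inner product associates with `φ`; the sign is due to the
shift of the last letter. -/
def Represents {K V : Type*} [AddCommGroup K] [AddCommGroup V] {𝒱 : ZMod 2 → AddSubgroup V}
    (ip : V →+ V →+ K) (φ : List (Letter 𝒱) → V) (f : List (Letter 𝒱) → K) : Prop :=
  ∀ (l : List (Letter 𝒱)) (w : Letter 𝒱), f (l ++ [w]) = ksign (w.deg + 1) • ip (φ l) w.val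

variable {K V : Type*} [Ring K] [AddCommGroup V] [Module K V] [Module Kᵐᵒᵖ V]
  {𝒦 : ZMod 2 → AddSubgroup K} {𝒱 : ZMod 2 → AddSubgroup V} {ip : V →+ V →+ K}

namespace IsInnerProduct

theorem ext (hip : IsInnerProduct 𝒦 𝒱 ip) {x y : V} (h : ∀ w, ip x w = ip y w) : x = y := by
  let g : V →ₗ[Kᵐᵒᵖ] K :=
    { ip y with map_smul' := fun t w => hip.map_op_smul y w t.unop }
  exact (hip.nondegenerate g).unique h fun _ => rfl

variable [DirectSum.Decomposition 𝒱]

theorem ext_homogeneous (hip : IsInnerProduct 𝒦 𝒱 ip) {x y : V}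
    (h : ∀ (q : ZMod 2) (w : V), w ∈ 𝒱 q → ip x w = ip y w) : x = y := by
  refine hip.ext fun w => ?_
  rw [← sum_proj 𝒱 w, map_sum, map_sum]
  exact Finset.sum_congr rfl fun q _ => h q _ (proj_mem 𝒱 _ _)

variable [DirectSum.Decomposition 𝒦]

theorem proj_left (hip : IsInnerProduct 𝒦 𝒱 ip) (p : ZMod 2) {q : ZMod 2} (x : V)
    {w : V} (hw : w ∈ 𝒱 q) : proj 𝒦 (p + q) (ip x w) = ip (proj 𝒱 p x) w :=
  proj_map (ip.flip w) (fun r y hy => hip.even r q y w hy hw) p x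

theorem mem_of_forall (hip : IsInnerProduct 𝒦 𝒱 ip) {p : ZMod 2} {x : V}
    (h : ∀ (q : ZMod 2) (w : V), w ∈ 𝒱 q → ip x w ∈ 𝒦 (p + q)) : x ∈ 𝒱 p := by
  have eq_proj : proj 𝒱 p x = x := hip.ext_homogeneous fun q w hw => by
    rw [← hip.proj_left p x hw, proj_of_mem (h q w hw)]
  exact eq_proj ▸ proj_mem 𝒱 p x

end IsInnerProduct

variable [DirectSum.Decomposition 𝒱] [DirectSum.Decomposition 𝒦]

theorem Represents.degreePart (hip : IsInnerProduct 𝒦 𝒱 ip) {φ : List (Letter 𝒱) → V}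
    {f : List (Letter 𝒱) → K} (h : Represents ip φ f) (γ : ZMod 2) :
    Represents ip (degreePart 𝒱 1 γ φ) (degreePart 𝒦 0 γ f) := by
  intro l w
  have degree_eq : γ + label (l ++ [w]) + 0 = γ + label l + 1 + (w.deg + 1) := by
    simp only [label_append, label_cons, label_nil]
    grind
  rw [LInfty.degreePart, h, degree_eq, LInfty.degreePart, ← hip.proj_left _ _ w.mem]
  exact map_zsmul (projHom 𝒦 _) _ _

end InnerProduct

section Tilde

variable {K V : Type*} [Ring K] [AddCommGroup V] {𝒱 : ZMod 2 → AddSubgroup V} {ip : V →+ V →+ K}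

theorem represents_tilde (φ : CochainFamily V) :
    Represents ip (cochainWord φ : List (Letter 𝒱) → V) (formWord (tilde ip φ)) := by
  intro l w
  rw [formWord, wordForm_append_singleton]
  cases l with
  | nil =>
    have cochainWord_nil : cochainWord φ ([] : List (Letter 𝒱)) = 0 := smul_zero _
    rw [cochainWord_nil, map_zero, AddMonoidHom.zero_apply, smul_zero]
    exact smul_zero _
  | cons a l =>
    have tilde_snoc : formSeq (tilde ip φ) ((a :: l).length + 1)
        (Fin.snoc (α := fun _ => V) (fun i => ((a :: l).get i).val) w.val) =
        ip (φ l.length fun i => ((a :: l).get i).val) w.val := by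
      change tilde ip φ l.length _ = _
      simp only [tilde, Fin.snoc_castSucc]
      exact congrArg _ (Fin.snoc_last (α := fun _ => V) _ _)
    rw [tilde_snoc, cochainWord, wordForm, map_zsmul, AddMonoidHom.zsmul_apply,
      ksign_smul_ksign_smul, List.map_append, decalage_append]
    simp only [decalage, cochainSeq, List.map_cons, List.map_nil, List.length_cons, List.length_nil]
    exact ksign_smul_congr (by grind) _

theorem tilde_update_castSucc (φ : CochainFamily V) {d : ℕ} (v : Fin (d + 2) → V) (i : Fin (d + 1))
    (x : V) : tilde ip φ d (Function.update v i.castSucc x) =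
      ip (φ d (Function.update (fun j => v j.castSucc) i x)) (v (Fin.last (d + 1))) := by
  rw [tilde, Function.update_of_ne (Fin.castSucc_lt_last i).ne']
  exact congrArg (fun u => ip (φ d u) _)
    (Function.update_comp_eq_of_injective v (Fin.castSucc_injective _) i x)

theorem tilde_update_last (φ : CochainFamily V) {d : ℕ} (v : Fin (d + 2) → V) (x : V) :
    tilde ip φ d (Function.update v (Fin.last (d + 1)) x) = ip (φ d fun j => v j.castSucc) x := by
  simp [tilde]

theorem multiAdditive_tilde {φ : CochainFamily V} (hφ : ∀ d, MultiAdditive (φ d)) (d : ℕ) :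
    MultiAdditive (tilde ip φ d) := by
  intro v i x y
  induction i using Fin.lastCases with
  | last => simp only [tilde_update_last, map_add]
  | cast i => simp only [tilde_update_castSucc, hφ d _ i x y, map_add, AddMonoidHom.add_apply]

end Tilde

/-! ### Cyclic families -/

theorem sum_map_add_one {N : ℕ} (p : Fin N → ZMod 2) :
    ((List.ofFn p).map (· + 1)).sum = ∑ i, p i + N := by
  simp [List.sum_ofFn, List.map_ofFn, Finset.sum_add_distrib]

section Cyclic

variable {K V : Type*} [Ring K] [AddCommGroup V] {𝒱 : ZMod 2 → AddSubgroup V} {ip : V →+ V →+ K}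

/-- Swaps that avoid the last letter are covered by the symmetry of `φ`; a rotation moves every
other swap away from the last letter. -/
theorem isGradedSymmetric_tilde_iff_rotate {φ : CochainFamily V}
    (hφ : IsGradedSymmetric (cochainWord φ : List (Letter 𝒱) → V)) :
    IsGradedSymmetric (formWord (tilde ip φ) : List (Letter 𝒱) → K) ↔
      ∀ (a : Letter 𝒱) (l : List (Letter 𝒱)), formWord (tilde ip φ) (a :: l) =
        ksign (a.deg * label l) • formWord (tilde ip φ) (l ++ [a]) := by
  refine ⟨fun h => h.cons_eq, fun rotate => ?_⟩
  have swap_before_last : ∀ (l₁ l₂ : List (Letter 𝒱)) (a b w : Letter 𝒱),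
      formWord (tilde ip φ) (l₁ ++ a :: b :: (l₂ ++ [w])) =
        ksign (a.deg * b.deg) • formWord (tilde ip φ) (l₁ ++ b :: a :: (l₂ ++ [w])) := by
    intro l₁ l₂ a b w
    have split : ∀ c d, l₁ ++ c :: d :: (l₂ ++ [w]) = (l₁ ++ c :: d :: l₂) ++ [w] := by simp
    rw [split, split, represents_tilde φ, represents_tilde φ, hφ, map_zsmul,
      AddMonoidHom.zsmul_apply, smul_comm]
  intro l₁ l₂ a b
  rcases List.eq_nil_or_concat' l₂ with rfl | ⟨l₂, w, rfl⟩
  · cases l₁ with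
    | nil => simpa using rotate a [b]
    | cons c l₁ =>
      have swapped := swap_before_last l₁ [] a b c
      simp only [List.nil_append] at swapped
      rw [List.cons_append, rotate, List.cons_append, rotate, List.append_assoc, List.append_assoc,
        List.cons_append, List.cons_append, List.cons_append, List.cons_append, List.nil_append,
        swapped, smul_comm, label_perm ((List.Perm.swap b a []).append_left l₁)]
  · exact swap_before_last l₁ l₂ a b w

variable [DirectSum.Decomposition 𝒱]

theorem cyclic_iff_rotate {φ : CochainFamily V} {d : ℕ} {v : Fin (d + 2) → V}
    {p : Fin (d + 2) → ZMod 2} (hv : ∀ i, v i ∈ 𝒱 (p i)) {a : Letter 𝒱} {l : List (Letter 𝒱)}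
    (hl : word p v = a :: l) :
    ip (φ d fun i => v i.castSucc) (v (Fin.last (d + 1))) =
        ksign ((d : ZMod 2) + 1 + p 0 * ∑ i : Fin (d + 1), p i.succ) •
          ip (φ d fun i => v i.succ) (v 0) ↔
      formWord (tilde ip φ) (a :: l) =
        ksign (a.deg * label l) • formWord (tilde ip φ) (l ++ [a]) := by
  have word_eq : (word p v : List (Letter 𝒱)) =
      letter (p 0 + 1) (v 0) :: word (fun i => p i.succ) fun i => v i.succ := List.ofFn_succ
  obtain ⟨rfl, rfl⟩ := List.cons.inj (word_eq.symm.trans hl)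
  rw [represents_tilde φ, letter_val, add_one_add_one, proj_of_mem (hv 0), ← hl, formWord,
    cochainWord, wordForm_word 1 _ hv, wordForm_word 0 _ fun i : Fin (d + 1) => hv i.succ,
    label_word, map_zsmul, AddMonoidHom.zsmul_apply, ksign_smul_eq_iff, formSeq, cochainSeq, tilde,
    List.ofFn_succ, List.map_cons, decalage, decalage_eq_add 1]
  have sum_eq : ((List.ofFn fun i : Fin (d + 1) => p i.succ).map (· + 1)).sum =
      ∑ i : Fin (d + 1), p i.succ + (d + 1 : ℕ) :=
    sum_map_add_one _
  simp only [ksign_smul_ksign_smul, List.length_map, List.length_ofFn, letter_deg, sum_eq]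
  refine iff_of_eq (congrArg _ (ksign_smul_congr ?_ _))
  push_cast
  grind

variable [Module K V] [Module Kᵐᵒᵖ V] {𝒦 : ZMod 2 → AddSubgroup K} [DirectSum.Decomposition 𝒦]

theorem IsInnerProduct.cyclic_parityPart_iff (hip : IsInnerProduct 𝒦 𝒱 ip) {d : ℕ}
    {f : (Fin (d + 1) → V) → V} (hf : MultiAdditive f) (q : ZMod 2) {v : Fin (d + 2) → V}
    {p : Fin (d + 2) → ZMod 2} (hv : ∀ i, v i ∈ 𝒱 (p i)) :
    ip (parityPart 𝒱 q f fun i => v i.castSucc) (v (Fin.last (d + 1))) =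
        ksign ((d : ZMod 2) + 1 + p 0 * q) • ip (v 0) (parityPart 𝒱 q f fun i => v i.succ) ↔
      proj 𝒦 (q + ∑ i, p i) (ip (f fun i => v i.castSucc) (v (Fin.last (d + 1)))) =
        proj 𝒦 (q + ∑ i, p i) (ksign ((d : ZMod 2) + 1 + p 0 * ∑ i : Fin (d + 1), p i.succ) •
          ip (f fun i => v i.succ) (v 0)) := by
  have proj_zsmul : ∀ (n : ℤ) (x : K) (r : ZMod 2), proj 𝒦 r (n • x) = n • proj 𝒦 r x :=
    fun n x r => map_zsmul (projHom 𝒦 r) n x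
  rw [parityPart_of_mem hf q (fun i : Fin (d + 1) => hv i.castSucc),
    parityPart_of_mem hf q (fun i : Fin (d + 1) => hv i.succ), ← hip.proj_left _ _ (hv _),
    hip.symm _ _ _ _ (hv 0) (proj_mem 𝒱 _ _), ← hip.proj_left _ _ (hv _), proj_zsmul,
    ksign_smul_ksign_smul, add_assoc q, ← Fin.sum_univ_castSucc p, add_assoc q,
    add_comm _ (p 0), ← Fin.sum_univ_succ p]
  rw [ksign_smul_congr (show (d : ZMod 2) + 1 + p 0 * q +
    p 0 * (q + ∑ i : Fin (d + 1), p i.succ) =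
      (d : ZMod 2) + 1 + p 0 * ∑ i : Fin (d + 1), p i.succ by grind)]

theorem IsInnerProduct.isCyclic_iff (hip : IsInnerProduct 𝒦 𝒱 ip) {d : ℕ}
    {f : (Fin (d + 1) → V) → V} (hf : MultiAdditive f) : IsCyclic 𝒱 ip f ↔
      ∀ (v : Fin (d + 2) → V) (p : Fin (d + 2) → ZMod 2), (∀ i, v i ∈ 𝒱 (p i)) →
        ip (f fun i => v i.castSucc) (v (Fin.last (d + 1))) =
          ksign ((d : ZMod 2) + 1 + p 0 * ∑ i : Fin (d + 1), p i.succ) •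
            ip (f fun i => v i.succ) (v 0) := by
  refine ⟨fun h v p hv => eq_of_proj_eq 𝒦 fun r => ?_, fun h q v p hv => ?_⟩
  · have component := (hip.cyclic_parityPart_iff hf (r - ∑ i, p i) hv).1 (h _ v p hv)
    rwa [sub_add_cancel] at component
  · rw [hip.cyclic_parityPart_iff hf q hv, h v p hv]

theorem IsInnerProduct.isCyclic_iff_rotate (hip : IsInnerProduct 𝒦 𝒱 ip) {φ : CochainFamily V}
    (hφ : ∀ d, MultiAdditive (φ d)) : (∀ d, IsCyclic 𝒱 ip (φ d)) ↔
      ∀ (a : Letter 𝒱) (l : List (Letter 𝒱)), formWord (tilde ip φ) (a :: l) =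
        ksign (a.deg * label l) • formWord (tilde ip φ) (l ++ [a]) := by
  refine ⟨fun h a l => ?_, fun h d => (hip.isCyclic_iff (hφ d)).2 fun v p hv =>
    (cyclic_iff_rotate hv List.ofFn_succ).2 (h _ _)⟩
  cases l with
  | nil => simp [ksign_zero]
  | cons b l =>
    obtain ⟨v, p, hv, word_eq⟩ := exists_eq_word (a :: b :: l)
    exact (cyclic_iff_rotate hv word_eq.symm).1 ((hip.isCyclic_iff (hφ l.length)).1 (h _) v p hv)

theorem IsInnerProduct.isCyclic_iff_isGradedSymmetric (hip : IsInnerProduct 𝒦 𝒱 ip)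
    {φ : CochainFamily V} (hφ : InC K 𝒱 φ) : (∀ d, IsCyclic 𝒱 ip (φ d)) ↔
      IsGradedSymmetric (formWord (tilde ip φ) : List (Letter 𝒱) → K) :=
  (hip.isCyclic_iff_rotate fun d => (hφ d).add).trans
    (isGradedSymmetric_tilde_iff_rotate (isGradedSymmetric_cochainWord hφ)).symm

end Cyclic

section Sharp

variable {K V : Type*} [Ring K] [AddCommGroup V] [Module K V] [Module Kᵐᵒᵖ V]
  {𝒦 : ZMod 2 → AddSubgroup K} {𝒱 : ZMod 2 → AddSubgroup V} {ip : V →+ V →+ K}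

theorem IsInnerProduct.tilde_injective (hip : IsInnerProduct 𝒦 𝒱 ip) :
    Function.Injective (tilde ip) := by
  refine fun φ ψ h => funext fun d => funext fun v => hip.ext fun w => ?_
  simpa [tilde] using congrFun (congrFun h d) (Fin.snoc (α := fun _ => V) v w)

/-- The form `f`, evaluated at `v`, as a linear function of its last argument. -/
def lastArg (f : Forms K 𝒱) {d : ℕ} (v : Fin (d + 1) → V) : V →ₗ[Kᵐᵒᵖ] K where
  toFun w := f.1 d (Fin.snoc (α := fun _ => V) v w)
  map_add' w w' := by
    simpa [Fin.update_snoc_last] using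
      (f.2 d).add (Fin.snoc (α := fun _ => V) v 0) (Fin.last _) w w'
  map_smul' t w := by
    simpa [Fin.update_snoc_last] using
      (f.2 d).map_op_smul (Fin.snoc (α := fun _ => V) v w) t.unop

/-- The inverse of `tilde`: the family of maps `φ` with `f(v_1, …, v_{n+1}) =
⟨φ(v_1, …, v_n), v_{n+1}⟩`, which exists because the inner product is non-degenerate. -/
noncomputable def sharp (hip : IsInnerProduct 𝒦 𝒱 ip) (f : Forms K 𝒱) : CochainFamily V :=
  fun _ v => (hip.nondegenerate (lastArg f v)).choose

variable (hip : IsInnerProduct 𝒦 𝒱 ip) (f : Forms K 𝒱)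

theorem ip_sharp {d : ℕ} (v : Fin (d + 1) → V) (w : V) :
    ip (sharp hip f d v) w = f.1 d (Fin.snoc (α := fun _ => V) v w) :=
  (hip.nondegenerate (lastArg f v)).choose_spec.1 w

theorem tilde_sharp : tilde ip (sharp hip f) = f.1 := by
  funext d v
  rw [tilde, ip_sharp]
  exact congrArg _ (Fin.snoc_init_self v)

theorem multiAdditive_sharp (d : ℕ) : MultiAdditive (sharp hip f d) := by
  refine fun v i x y => hip.ext fun w => ?_
  simp only [map_add, AddMonoidHom.add_apply, ip_sharp, Fin.snoc_update, (f.2 d).add]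

theorem sharp_balanced {d : ℕ} (v : Fin (d + 1) → V) (i : Fin d) (t : K) :
    sharp hip f d (Function.update v i.castSucc (MulOpposite.op t • v i.castSucc)) =
      sharp hip f d (Function.update v i.succ (t • v i.succ)) := by
  refine hip.ext fun w => ?_
  have balanced := (f.2 d).balanced (Fin.snoc (α := fun _ => V) v w) i.castSucc t
  rwa [Fin.succ_castSucc, Fin.snoc_castSucc, Fin.snoc_castSucc, ← Fin.snoc_update,
    ← Fin.snoc_update, ← ip_sharp hip, ← ip_sharp hip] at balanced

theorem sharp_map_op_smul {d : ℕ} (v : Fin (d + 1) → V) (t : K) :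
    sharp hip f d (Function.update v (Fin.last d) (MulOpposite.op t • v (Fin.last d))) =
      MulOpposite.op t • sharp hip f d v := by
  refine hip.ext fun w => ?_
  have balanced := (f.2 d).balanced (Fin.snoc (α := fun _ => V) v w) (Fin.last d) t
  rwa [Fin.succ_last, Fin.snoc_castSucc, Fin.snoc_last, ← Fin.snoc_update, Fin.update_snoc_last,
    ← ip_sharp hip, ← ip_sharp hip, ← hip.balanced] at balanced

variable [DirectSum.Decomposition 𝒱]

theorem sharp_antisymm {d : ℕ} {v : Fin (d + 1) → V} {p : Fin (d + 1) → ZMod 2}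
    (hv : ∀ i, v i ∈ 𝒱 (p i)) (i : Fin d) : sharp hip f d v =
      ksign (1 + p i.castSucc * p i.succ) •
        sharp hip f d fun j => v (Equiv.swap i.castSucc i.succ j) := by
  refine hip.ext_homogeneous fun q w hw => ?_
  have mem : ∀ j, Fin.snoc (α := fun _ => V) v w j ∈ 𝒱 (Fin.snoc (α := fun _ => ZMod 2) p q j) :=
    Fin.lastCases (by simpa using hw) (by simpa using hv)
  have snoc_swap : (fun j => Fin.snoc (α := fun _ => V) v w
      (Equiv.swap i.castSucc.castSucc i.castSucc.succ j)) =
      Fin.snoc (α := fun _ => V) (fun j => v (Equiv.swap i.castSucc i.succ j)) w := by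
    funext j
    induction j using Fin.lastCases with
    | last =>
      rw [Equiv.swap_apply_of_ne_of_ne (Fin.castSucc_lt_last _).ne'
        (Fin.succ_castSucc i ▸ (Fin.castSucc_lt_last _).ne'), Fin.snoc_last, Fin.snoc_last]
    | cast j =>
      rw [Fin.succ_castSucc, ← (Fin.castSucc_injective _).map_swap, Fin.snoc_castSucc,
        Fin.snoc_castSucc]
  have antisymm := (f.2 d).antisymm _ _ mem (Equiv.swap i.castSucc.castSucc i.castSucc.succ)
  rwa [sign_mul_koszul_swap, snoc_swap, Fin.succ_castSucc, Fin.snoc_castSucc, Fin.snoc_castSucc,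
    ← ip_sharp hip, ← ip_sharp hip, ← AddMonoidHom.zsmul_apply, ← map_zsmul] at antisymm

theorem inC_sharp : InC K 𝒱 (sharp hip f) := fun d =>
  { add := multiAdditive_sharp hip f d
    balanced := sharp_balanced hip f
    map_op_smul := sharp_map_op_smul hip f
    antisymm := antisymm_of_swap fun _ _ hv i => sharp_antisymm hip f hv i }

variable [DirectSum.Decomposition 𝒦]

theorem sharp_mem : sharp hip f ∈ CC 𝒱 ip := by
  refine ⟨inC_sharp hip f, (hip.isCyclic_iff_isGradedSymmetric (inC_sharp hip f)).2 ?_⟩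
  rw [tilde_sharp]
  exact isGradedSymmetric_formWord f.2

include hip

theorem tilde_mem_forms {φ : CochainFamily V} (hφ : φ ∈ CC 𝒱 ip) : tilde ip φ ∈ Forms K 𝒱 := by
  refine fun d => ⟨multiAdditive_tilde (fun d => (hφ.1 d).add) d, fun v i t => ?_, fun v t => ?_,
    antisymm_of_swap fun v p hv i => ?_⟩
  · induction i using Fin.lastCases with
    | last =>
      rw [Fin.succ_last, tilde_update_last, tilde_update_castSucc, (hφ.1 d).map_op_smul,
        hip.balanced]
    | cast i =>
      rw [Fin.succ_castSucc, tilde_update_castSucc, tilde_update_castSucc, (hφ.1 d).balanced]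
  · rw [tilde_update_last, hip.map_op_smul]
    rfl
  · exact ((hip.isCyclic_iff_isGradedSymmetric hφ.1).1 hφ.2).apply_eq_swap hv i

theorem bijOn_tilde : Set.BijOn (tilde ip) (CC 𝒱 ip) (Forms K 𝒱) :=
  ⟨fun _ hφ => tilde_mem_forms hip hφ, hip.tilde_injective.injOn,
    fun f hf => ⟨sharp hip ⟨f, hf⟩, sharp_mem hip _, tilde_sharp hip _⟩⟩

end Sharp

section Adjoint

variable {K V : Type*} [Ring K] [AddCommGroup V] [Module K V] [Module Kᵐᵒᵖ V]
  {𝒦 : ZMod 2 → AddSubgroup K} {𝒱 : ZMod 2 → AddSubgroup V} [DirectSum.Decomposition 𝒱]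
  {ip : V →+ V →+ K} {f g : List (Letter 𝒱) → K} {φ ψ : List (Letter 𝒱) → V} {γ₁ γ₂ : ZMod 2}

/-- Both sides are `⟨φ T, ψ (R ++ [w])⟩` up to sign. -/
theorem Represents.adjoint (hip : IsInnerProduct 𝒦 𝒱 ip) (hf : IsGradedSymmetric f)
    (hg : IsGradedSymmetric g) (hφ : HasDegree 𝒱 1 γ₁ φ) (hψ : HasDegree 𝒱 1 γ₂ ψ)
    (hφf : Represents ip φ f) (hψg : Represents ip ψ g) (T R : List (Letter 𝒱)) (w : Letter 𝒱) :
    f (letter (γ₂ + label (R ++ [w])) (ψ (R ++ [w])) :: T) =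
      ksign (1 + γ₁ * γ₂ + label T * label R + w.deg * label T + (w.deg + 1)) •
        ip (ψ (letter (γ₁ + label T) (φ T) :: R)) w.val := by
  have through_g := hg.cons_eq (letter (γ₁ + label T) (φ T)) (R ++ [w])
  rw [← List.cons_append, hψg, hψg, letter_val, proj_of_mem (hφ T), eq_comm,
    ksign_smul_ksign_smul, ksign_smul_eq_iff] at through_g
  rw [hf.cons_eq, hφf, letter_val, proj_of_mem (hψ _), hip.symm _ _ _ _ (hφ T) (hψ _), through_g]
  simp only [ksign_smul_ksign_smul, label_append, label_cons, label_nil, letter_deg]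
  exact ksign_smul_congr (by grind) _

theorem Represents.wordInsert (hip : IsInnerProduct 𝒦 𝒱 ip) (hf : IsGradedSymmetric f)
    (hg : IsGradedSymmetric g) (hφ : HasDegree 𝒱 1 γ₁ φ) (hψ : HasDegree 𝒱 1 γ₂ ψ)
    (hφf : Represents ip φ f) (hψg : Represents ip ψ g) :
    Represents ip (fun l => wordInsert γ₂ φ ψ l + ksign (γ₁ * γ₂ + 1) • wordInsert γ₁ ψ φ l)
      (wordInsert γ₂ f ψ) := by
  intro l w
  have ip_koszulSum : ∀ F : List (Letter 𝒱) → List (Letter 𝒱) → V,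
      ip (koszulSum l F) w.val = koszulSum l fun T R => ip (F T R) w.val := fun F =>
    map_unshuffleSum _ (ip.flip w.val) l F
  have last_in_tail : (koszulSum l fun T R => f (letter (γ₂ + label T) (ψ T) :: (R ++ [w]))) =
      ksign (w.deg + 1) • ip (LInfty.wordInsert γ₂ φ ψ l) w.val := by
    rw [LInfty.wordInsert, ip_koszulSum, ← unshuffleSum_smul]
    simp only [← List.cons_append, hφf _ _]
  have last_in_head : (koszulSum l fun T R => ksign (w.deg * label R) •
      f (letter (γ₂ + label (T ++ [w])) (ψ (T ++ [w])) :: R)) =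
      ksign (w.deg + 1) • ksign (γ₁ * γ₂ + 1) • ip (LInfty.wordInsert γ₁ ψ φ l) w.val := by
    rw [LInfty.wordInsert, ip_koszulSum, koszulSum_comm]
    simp only [← unshuffleSum_smul, koszulSum, hφf.adjoint hip hf hg hφ hψ hψg,
      ksign_smul_ksign_smul]
    congr! 3
    exact ksign_smul_congr (by grind) _
  rw [LInfty.wordInsert, koszulSum_append_singleton, last_in_tail, last_in_head, ← smul_add,
    add_comm (ksign (γ₁ * γ₂ + 1) • _), map_add, map_zsmul]
  rfl

end Adjoint

/-! ### The action of `C(V)` on scalar valued cochains -/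

section Closure

variable {V X : Type*} [AddCommGroup V] [AddCommGroup X] {𝒱 : ZMod 2 → AddSubgroup V}

theorem IsGradedSymmetric.add {F G : List (Letter 𝒱) → X} (hF : IsGradedSymmetric F)
    (hG : IsGradedSymmetric G) : IsGradedSymmetric fun l => F l + G l := fun l₁ l₂ a b => by
  simp only [hF l₁ l₂ a b, hG l₁ l₂ a b, smul_add]

theorem IsGradedSymmetric.zsmul {F : List (Letter 𝒱) → X} (hF : IsGradedSymmetric F) (n : ℤ) :
    IsGradedSymmetric fun l => n • F l := fun l₁ l₂ a b => by
  simp only [hF l₁ l₂ a b, smul_comm n]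

theorem IsGradedSymmetric.sum {ι : Type*} (s : Finset ι) {F : ι → List (Letter 𝒱) → X}
    (hF : ∀ i, IsGradedSymmetric (F i)) : IsGradedSymmetric fun l => ∑ i ∈ s, F i l :=
  fun l₁ l₂ a b => by simp only [hF _ l₁ l₂ a b, Finset.smul_sum]

variable [DirectSum.Decomposition 𝒱]

theorem HeadAdditive.add {F G : List (Letter 𝒱) → X} (hF : HeadAdditive F)
    (hG : HeadAdditive G) : HeadAdditive fun l => F l + G l := fun d x y l => by
  simp only [hF d x y l, hG d x y l, add_add_add_comm]

theorem HeadAdditive.const_zsmul {F : List (Letter 𝒱) → X} (hF : HeadAdditive F) (n : ℤ) :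
    HeadAdditive fun l => n • F l := fun d x y l => by
  simp only [hF d x y l, smul_add]

theorem HeadAdditive.sum {ι : Type*} (s : Finset ι) {F : ι → List (Letter 𝒱) → X}
    (hF : ∀ i, HeadAdditive (F i)) : HeadAdditive fun l => ∑ i ∈ s, F i l :=
  fun d x y l => by simp only [hF _ d x y l, Finset.sum_add_distrib]

theorem HeadLinear.sum {K : Type*} [Ring K] [Module Kᵐᵒᵖ V] [Module Kᵐᵒᵖ X]
    {𝒦 : ZMod 2 → AddSubgroup K} {e : ZMod 2} {ι : Type*} (s : Finset ι)
    {F : ι → List (Letter 𝒱) → X} (hF : ∀ i, HeadLinear 𝒦 e (F i)) :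
    HeadLinear 𝒦 e fun l => ∑ i ∈ s, F i l := fun s t ht d x l => by
  simp only [hF _ s t ht d x l, Finset.smul_sum]

theorem ofWord_zero (e : ZMod 2) {F : List (Letter 𝒱) → X} (hF : F [] = 0) : ofWord e F 0 = 0 :=
  funext fun v => Finset.sum_eq_zero fun p _ => by
    rw [show (word p v : List (Letter 𝒱)) = [] from List.ofFn_zero, hF, smul_zero]

theorem cochainWord_ofWord {F : List (Letter 𝒱) → V} (hF : IsGradedSymmetric F)
    (hFa : HeadAdditive F) (hF₀ : F [] = 0) : cochainWord (fun d => ofWord 0 F (d + 1)) = F := by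
  have seq_eq : (cochainSeq fun d => ofWord 0 F (d + 1)) = ofWord 0 F := funext fun
    | 0 => (ofWord_zero 0 hF₀).symm
    | _ + 1 => rfl
  rw [cochainWord, seq_eq, wordForm_ofWord hF hFa]

theorem formWord_ofWord {F : List (Letter 𝒱) → X} (hF : IsGradedSymmetric F)
    (hFa : HeadAdditive F) (hF₀ : F [] = 0) (hF₁ : ∀ a, F [a] = 0) :
    formWord (fun d => ofWord 1 F (d + 2)) = F := by
  have ofWord_one : ofWord 1 F 1 = 0 := funext fun v => Finset.sum_eq_zero fun p _ => by
    rw [show (word p v : List (Letter 𝒱)) = [letter (p 0 + 1) (v 0)] by simp [word], hF₁,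
      smul_zero]
  have seq_eq : (formSeq fun d => ofWord 1 F (d + 2)) = ofWord 1 F := funext fun
    | 0 => (ofWord_zero 1 hF₀).symm
    | 1 => ofWord_one.symm
    | _ + 2 => rfl
  rw [formWord, seq_eq, wordForm_ofWord hF hFa]

end Closure

section InsertAt

variable {V X : Type*} [AddCommGroup V] [AddCommGroup X] {m b N : ℕ}

theorem insertAt_zero_left (g : (Fin (b + 1) → V) → V) (p : Fin N → ZMod 2) (v : Fin N → V) :
    insertAt (0 : (Fin (m + 1) → V) → X) g p v = 0 := by
  simp [insertAt]

theorem insertAt_zero_right {f : (Fin (m + 1) → V) → X} (hf : MultiAdditive f)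
    (p : Fin N → ZMod 2) (v : Fin N → V) : insertAt f (0 : (Fin (b + 1) → V) → V) p v = 0 :=
  Finset.sum_eq_zero fun σ _ => by rw [hf.eq_zero (i := 0) (by simp), smul_zero]

end InsertAt

section Nil

variable {K V : Type*} [AddCommGroup K] [AddCommGroup V] {𝒱 : ZMod 2 → AddSubgroup V}

theorem cochainWord_nil (φ : CochainFamily V) : cochainWord φ ([] : List (Letter 𝒱)) = 0 :=
  smul_zero _

theorem formWord_nil (f : FormFamily V K) : formWord f ([] : List (Letter 𝒱)) = 0 :=
  smul_zero _

theorem formWord_singleton (f : FormFamily V K) (a : Letter 𝒱) : formWord f [a] = 0 :=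
  smul_zero _

end Nil

section Action

variable {K V : Type*} [Ring K] [AddCommGroup V] [Module K V] [Module Kᵐᵒᵖ V]
  {𝒦 : ZMod 2 → AddSubgroup K} {𝒱 : ZMod 2 → AddSubgroup V} [DirectSum.Decomposition 𝒱]

theorem isWordCochain_cochainWord (hV : IsSupermodule 𝒦 𝒱) {φ : CochainFamily V}
    (hφ : InC K 𝒱 φ) : IsWordCochain 𝒦 0 (cochainWord φ : List (Letter 𝒱) → V) :=
  isWordCochain_wordForm hV 0 hφ

theorem isWordCochain_formWord (hV : IsSupermodule 𝒦 𝒱) {f : FormFamily V K}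
    (hf : f ∈ Forms K 𝒱) : IsWordCochain 𝒦 1 (formWord f : List (Letter 𝒱) → K) :=
  isWordCochain_wordForm hV 1 (isCochain_formSeq hf)

theorem headAdditive_cochainWord {φ : CochainFamily V} (hφ : InC K 𝒱 φ) :
    HeadAdditive (cochainWord φ : List (Letter 𝒱) → V) :=
  headAdditive_wordForm 0 fun m => (hφ m).add

theorem headAdditive_formWord {f : FormFamily V K} (hf : f ∈ Forms K 𝒱) :
    HeadAdditive (formWord f : List (Letter 𝒱) → K) :=
  headAdditive_wordForm 1 fun m => (isCochain_formSeq hf m).add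

/-- The action of a family of cochains `ψ` on a form `f`, as a function of words: the insertion of
all homogeneous components of `ψ` into `f`. -/
def actWord (𝒱 : ZMod 2 → AddSubgroup V) [DirectSum.Decomposition 𝒱] (f : FormFamily V K)
    (ψ : CochainFamily V) (l : List (Letter 𝒱)) : K :=
  ∑ γ, wordInsert γ (formWord f) (cochainWord ψ) l

/-- The right action of `C(V)` on scalar valued cochains by insertion. -/
def act (𝒱 : ZMod 2 → AddSubgroup V) [DirectSum.Decomposition 𝒱] (f : FormFamily V K)
    (ψ : CochainFamily V) : FormFamily V K :=
  fun d => ofWord 1 (actWord 𝒱 f ψ) (d + 2)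

variable {f : FormFamily V K} {ψ : CochainFamily V}

theorem isGradedSymmetric_actWord (hf : f ∈ Forms K 𝒱) (hψ : InC K 𝒱 ψ) :
    IsGradedSymmetric (actWord 𝒱 f ψ) :=
  IsGradedSymmetric.sum _ fun γ => (isGradedSymmetric_formWord hf).wordInsert γ
    (headAdditive_formWord hf) (isGradedSymmetric_cochainWord hψ)

theorem headAdditive_actWord (hf : f ∈ Forms K 𝒱) (hψ : InC K 𝒱 ψ) :
    HeadAdditive (actWord 𝒱 f ψ) :=
  HeadAdditive.sum _ fun γ => (headAdditive_formWord hf).wordInsert γ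
    (isGradedSymmetric_formWord hf) (headAdditive_cochainWord hψ)

theorem actWord_singleton (hf : f ∈ Forms K 𝒱) (ψ : CochainFamily V) (a : Letter 𝒱) :
    actWord 𝒱 f ψ [a] = 0 :=
  Finset.sum_eq_zero fun γ _ => by
    rw [wordInsert, koszulSum_cons, koszulSum, koszulSum, unshuffleSum, unshuffleSum,
      formWord_singleton, cochainWord_nil, (headAdditive_formWord hf).zero, smul_zero, add_zero]

theorem formWord_act (hf : f ∈ Forms K 𝒱) (hψ : InC K 𝒱 ψ) :
    formWord (act 𝒱 f ψ) = actWord 𝒱 f ψ :=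
  formWord_ofWord (isGradedSymmetric_actWord hf hψ) (headAdditive_actWord hf hψ)
    (Finset.sum_eq_zero fun _ _ => formWord_singleton _ _) (actWord_singleton hf ψ)

theorem act_mem [DirectSum.Decomposition 𝒦] (hV : IsSupermodule 𝒦 𝒱) (hf : f ∈ Forms K 𝒱)
    (hψ : InC K 𝒱 ψ) : act 𝒱 f ψ ∈ Forms K 𝒱 := fun d => by
  have symm := isGradedSymmetric_actWord hf hψ
  have add := headAdditive_actWord hf hψ
  have linear : HeadLinear 𝒦 1 (actWord 𝒱 f ψ) := HeadLinear.sum _ fun γ =>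
    ((isWordCochain_formWord hV hf).wordInsert γ (isWordCochain_cochainWord hV hψ)).linear
  refine IsWordCochain.isCochain (e := 1) (F := ofWord 1 (actWord 𝒱 f ψ)) ?_ hV
    (multiAdditive_ofWord symm add 1 _)
  rw [wordForm_ofWord symm add]
  exact ⟨symm, add, linear⟩

theorem act_apply (hf : f ∈ Forms K 𝒱) (hψ : InC K 𝒱 ψ) {d : ℕ} {v : Fin (d + 2) → V}
    {p : Fin (d + 2) → ZMod 2} (hv : ∀ i, v i ∈ 𝒱 (p i)) :
    act 𝒱 f ψ d v = ∑ ab ∈ Finset.HasAntidiagonal.antidiagonal d, ∑ γ : ZMod 2,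
      ksign (ab.1 * (γ + ab.2)) •
        insertAt (f ab.1) (parityPart 𝒱 (γ + ab.2) (ψ ab.2)) p v := by
  rw [act, ofWord_of_mem (isGradedSymmetric_actWord hf hψ) (headAdditive_actWord hf hψ) 1 hv,
    actWord, Finset.smul_sum, Finset.sum_comm]
  refine Finset.sum_congr rfl fun γ _ => ?_
  have part_eq := cochainWord_parityPart (𝒱 := 𝒱) (fun d => (hψ d).add) γ
  have hasDegree := hasDegree_degreePart 𝒱 1 γ (F := (cochainWord ψ : List (Letter 𝒱) → V))
  rw [← part_eq] at hasDegree
  rw [← wordInsert_degreePart, ← part_eq,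
    ← sum_insertAt 1 γ (headAdditive_formWord hf) hasDegree rfl hv,
    Finset.Nat.sum_antidiagonal_succ, show formSeq f (0 + 1) = 0 from rfl, insertAt_zero_left,
    smul_zero, zero_add]
  refine Finset.sum_congr rfl fun ab _ => ksign_smul_congr ?_ _
  push_cast
  grind

theorem act_apply_of_hasParity (hf : f ∈ Forms K 𝒱) (hψ : InC K 𝒱 ψ) {q : ℕ → ZMod 2}
    (hq : ∀ b, HasParity 𝒱 𝒱 (q b) (ψ b)) {d : ℕ} {v : Fin (d + 2) → V}
    {p : Fin (d + 2) → ZMod 2} (hv : ∀ i, v i ∈ 𝒱 (p i)) :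
    act 𝒱 f ψ d v = ∑ ab ∈ Finset.HasAntidiagonal.antidiagonal d,
      ksign (ab.1 * q ab.2) • insertAt (f ab.1) (ψ ab.2) p v := by
  rw [act_apply hf hψ hv]
  refine Finset.sum_congr rfl fun ab _ => ?_
  rw [Finset.sum_eq_single_of_mem (q ab.2 - ab.2) (Finset.mem_univ _) fun γ _ hγ => ?_]
  · rw [sub_add_cancel, parityPart_of_hasParity (hψ _).add (hq _)]
  · have parity_ne : q ab.2 ≠ γ + ab.2 := fun h => hγ (eq_sub_of_add_eq h.symm)
    rw [parityPart_of_hasParity_ne (hψ _).add (hq _) parity_ne, insertAt_zero_right (hf _).add,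
      smul_zero]

end Action

/-! ### The bracket -/

section Bracket

variable {V : Type*} [AddCommGroup V] {𝒱 : ZMod 2 → AddSubgroup V} [DirectSum.Decomposition 𝒱]
  {φ ψ : CochainFamily V}

/-- The modified bracket of two families of cochains, as a function of words: under the décalage
its signs become the ones of the graded commutator for insertion. -/
def bracketWord (φ ψ : CochainFamily V) (l : List (Letter 𝒱)) : V :=
  ∑ γ₁, ∑ γ₂, (wordInsert γ₂ (degreePart 𝒱 1 γ₁ (cochainWord φ)) (cochainWord ψ) l +
    ksign (γ₁ * γ₂ + 1) • wordInsert γ₁ (degreePart 𝒱 1 γ₂ (cochainWord ψ)) (cochainWord φ) l)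

theorem sum_insertAt_parityPart (hφ : ∀ d, MultiAdditive (φ d)) (hψ : ∀ d, MultiAdditive (ψ d))
    (γ₁ γ₂ : ZMod 2) {d : ℕ} {v : Fin (d + 1) → V} {p : Fin (d + 1) → ZMod 2}
    (hv : ∀ i, v i ∈ 𝒱 (p i)) :
    ∑ ab ∈ Finset.HasAntidiagonal.antidiagonal d, ksign ((γ₂ + ab.2) * ab.1) •
        insertAt (parityPart 𝒱 (γ₁ + ab.1) (φ ab.1)) (parityPart 𝒱 (γ₂ + ab.2) (ψ ab.2)) p v =
      ksign (decalage 0 ((List.ofFn p).map (· + 1))) •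
        wordInsert γ₂ (degreePart 𝒱 1 γ₁ (cochainWord φ)) (cochainWord ψ)
          (word p v : List (Letter 𝒱)) := by
  have hasDegree := hasDegree_degreePart 𝒱 1 γ₂ (F := (cochainWord ψ : List (Letter 𝒱) → V))
  rw [← cochainWord_parityPart hψ] at hasDegree
  rw [← wordInsert_degreePart, ← cochainWord_parityPart hφ, ← cochainWord_parityPart hψ,
    ← sum_insertAt 0 γ₂ (headAdditive_wordForm 0 fun m => multiAdditive_parityPart (hφ m) _)
      hasDegree rfl hv]
  simp only [add_zero]
  rfl

/-- The summands of `modBracket` on homogeneous arguments are those of `bracketWord`, where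
`q = γ₁ + a` and `r = γ₂ + b`. -/
theorem sum_insertAt_sub_insertAt (hφ : ∀ d, MultiAdditive (φ d))
    (hψ : ∀ d, MultiAdditive (ψ d)) {d : ℕ} {v : Fin (d + 1) → V} {p : Fin (d + 1) → ZMod 2}
    (hv : ∀ i, v i ∈ 𝒱 (p i)) :
    ∑ ab ∈ Finset.HasAntidiagonal.antidiagonal d, ∑ q : ZMod 2, ∑ r : ZMod 2, ksign (ab.1 * r) •
        (insertAt (parityPart 𝒱 q (φ ab.1)) (parityPart 𝒱 r (ψ ab.2)) p v -
          ksign (q * r + ab.1 * ab.2) •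
            insertAt (parityPart 𝒱 r (ψ ab.2)) (parityPart 𝒱 q (φ ab.1)) p v) =
      ksign (decalage 0 ((List.ofFn p).map (· + 1))) •
        bracketWord φ ψ (word p v : List (Letter 𝒱)) := by
  have neg_eq : ∀ x : V, -x = ksign 1 • x := fun x => by simp [ksign]
  have swapped : ∀ γ₁ γ₂ : ZMod 2, ksign (decalage 0 ((List.ofFn p).map (· + 1))) •
      ksign (γ₁ * γ₂ + 1) • wordInsert γ₁ (degreePart 𝒱 1 γ₂ (cochainWord ψ)) (cochainWord φ)
        (word p v : List (Letter 𝒱)) =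
      ∑ ab ∈ Finset.HasAntidiagonal.antidiagonal d, ksign (γ₁ * γ₂ + 1 + (γ₁ + ab.1) * ab.2) •
        insertAt (parityPart 𝒱 (γ₂ + ab.2) (ψ ab.2)) (parityPart 𝒱 (γ₁ + ab.1) (φ ab.1)) p v := by
    intro γ₁ γ₂
    rw [smul_comm, ← sum_insertAt_parityPart hψ hφ γ₂ γ₁ hv, ← Finset.Nat.sum_antidiagonal_swap,
      Finset.smul_sum]
    simp only [ksign_smul_ksign_smul, Prod.fst_swap, Prod.snd_swap]
  simp only [bracketWord, Finset.smul_sum, smul_add, swapped,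
    ← sum_insertAt_parityPart hφ hψ _ _ hv, ← Finset.sum_add_distrib]
  refine Eq.symm <| ((Finset.sum_congr rfl fun _ _ => Finset.sum_comm).trans
    Finset.sum_comm).trans (Finset.sum_congr rfl fun ab _ => ?_)
  refine Fintype.sum_equiv (Equiv.addRight (ab.1 : ZMod 2)) _ _ fun γ₁ => ?_
  refine Fintype.sum_equiv (Equiv.addRight (ab.2 : ZMod 2)) _ _ fun γ₂ => ?_
  rw [sub_eq_add_neg, neg_eq, smul_add, Equiv.coe_addRight, Equiv.coe_addRight]
  simp only [ksign_smul_ksign_smul]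
  exact congrArg₂ _ (ksign_smul_congr (mul_comm _ _) _) (ksign_smul_congr (by grind) _)

theorem modBracket_eq_ofWord (hφ : ∀ d, MultiAdditive (φ d)) (hψ : ∀ d, MultiAdditive (ψ d))
    (d : ℕ) : modBracket 𝒱 φ ψ d = ofWord 0 (bracketWord φ ψ : List (Letter 𝒱) → V) (d + 1) := by
  funext v
  have sum_parities : modBracket 𝒱 φ ψ d v = ∑ p : Fin (d + 1) → ZMod 2,
      ∑ ab ∈ Finset.HasAntidiagonal.antidiagonal d, ∑ q : ZMod 2, ∑ r : ZMod 2, ksign (ab.1 * r) •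
        (insertAt (parityPart 𝒱 q (φ ab.1)) (parityPart 𝒱 r (ψ ab.2)) p
            (fun i => proj 𝒱 (p i) (v i)) -
          ksign (q * r + ab.1 * ab.2) •
            insertAt (parityPart 𝒱 r (ψ ab.2)) (parityPart 𝒱 q (φ ab.1)) p
              (fun i => proj 𝒱 (p i) (v i))) := by
    simp only [modBracket, coderBracket, insertion, Finset.smul_sum, ← Finset.sum_sub_distrib]
    simp only [Finset.sum_comm (s := (Finset.univ : Finset (Fin (d + 1) → ZMod 2)))]
  rw [sum_parities, ofWord]
  refine Finset.sum_congr rfl fun p _ => ?_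
  rw [sum_insertAt_sub_insertAt hφ hψ fun i => proj_mem 𝒱 (p i) (v i), word_proj]

end Bracket

section TildeBracket

variable {K V : Type*} [Ring K] [AddCommGroup V] [Module K V] [Module Kᵐᵒᵖ V]
  {𝒦 : ZMod 2 → AddSubgroup K} {𝒱 : ZMod 2 → AddSubgroup V} [DirectSum.Decomposition 𝒱]
  {φ ψ : CochainFamily V}

theorem isGradedSymmetric_bracketWord (hφ : InC K 𝒱 φ) (hψ : InC K 𝒱 ψ) :
    IsGradedSymmetric (bracketWord φ ψ : List (Letter 𝒱) → V) := by
  have part : ∀ {φ ψ : CochainFamily V}, InC K 𝒱 φ → InC K 𝒱 ψ → ∀ γ₁ γ₂ : ZMod 2,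
      IsGradedSymmetric (wordInsert γ₂ (degreePart 𝒱 1 γ₁ (cochainWord φ))
        (cochainWord ψ : List (Letter 𝒱) → V)) := fun hφ hψ _ γ₂ =>
    (isGradedSymmetric_cochainWord hφ).degreePart.wordInsert γ₂
      (headAdditive_cochainWord hφ).degreePart (isGradedSymmetric_cochainWord hψ)
  exact IsGradedSymmetric.sum _ fun γ₁ => IsGradedSymmetric.sum _ fun γ₂ =>
    (part hφ hψ γ₁ γ₂).add ((part hψ hφ γ₂ γ₁).zsmul _)

theorem headAdditive_bracketWord (hφ : InC K 𝒱 φ) (hψ : InC K 𝒱 ψ) :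
    HeadAdditive (bracketWord φ ψ : List (Letter 𝒱) → V) := by
  have part : ∀ {φ ψ : CochainFamily V}, InC K 𝒱 φ → InC K 𝒱 ψ → ∀ γ₁ γ₂ : ZMod 2,
      HeadAdditive (wordInsert γ₂ (degreePart 𝒱 1 γ₁ (cochainWord φ))
        (cochainWord ψ : List (Letter 𝒱) → V)) := fun hφ hψ _ γ₂ =>
    (headAdditive_cochainWord hφ).degreePart.wordInsert γ₂
      (isGradedSymmetric_cochainWord hφ).degreePart (headAdditive_cochainWord hψ)
  exact HeadAdditive.sum _ fun γ₁ => HeadAdditive.sum _ fun γ₂ =>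
    (part hφ hψ γ₁ γ₂).add ((part hψ hφ γ₂ γ₁).const_zsmul _)

theorem bracketWord_nil (hφ : InC K 𝒱 φ) (hψ : InC K 𝒱 ψ) :
    bracketWord φ ψ ([] : List (Letter 𝒱)) = 0 := by
  have part : ∀ {φ : CochainFamily V}, InC K 𝒱 φ → ∀ (ψ : CochainFamily V) (γ₁ γ₂ : ZMod 2),
      wordInsert γ₂ (degreePart 𝒱 1 γ₁ (cochainWord φ)) (cochainWord ψ)
        ([] : List (Letter 𝒱)) = 0 := fun {φ} hφ ψ γ₁ γ₂ => by
    rw [wordInsert, koszulSum, unshuffleSum, cochainWord_nil,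
      (headAdditive_cochainWord hφ).degreePart.zero]
  simp only [bracketWord, part hφ, part hψ, smul_zero, add_zero, Finset.sum_const_zero]

theorem multiAdditive_modBracket (hφ : InC K 𝒱 φ) (hψ : InC K 𝒱 ψ) (d : ℕ) :
    MultiAdditive (modBracket 𝒱 φ ψ d) := by
  rw [modBracket_eq_ofWord (fun d => (hφ d).add) fun d => (hψ d).add]
  exact multiAdditive_ofWord (isGradedSymmetric_bracketWord hφ hψ)
    (headAdditive_bracketWord hφ hψ) 0 _

theorem cochainWord_modBracket (hφ : InC K 𝒱 φ) (hψ : InC K 𝒱 ψ) :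
    cochainWord (modBracket 𝒱 φ ψ) = (bracketWord φ ψ : List (Letter 𝒱) → V) := by
  rw [funext (modBracket_eq_ofWord (𝒱 := 𝒱) (fun d => (hφ d).add) fun d => (hψ d).add)]
  exact cochainWord_ofWord (isGradedSymmetric_bracketWord hφ hψ)
    (headAdditive_bracketWord hφ hψ) (bracketWord_nil hφ hψ)

theorem eq_of_formWord_eq {X : Type*} [AddCommGroup X] {f g : FormFamily V X}
    (hf : ∀ d, MultiAdditive (f d)) (hg : ∀ d, MultiAdditive (g d))
    (h : ∀ (l : List (Letter 𝒱)) (a : Letter 𝒱), formWord f (l ++ [a]) = formWord g (l ++ [a])) :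
    f = g := by
  refine funext fun d => MultiAdditive.ext 𝒱 (hf d) (hg d) fun v p hv => ?_
  have word_eq : ∃ (l : List (Letter 𝒱)) (a : Letter 𝒱), word p v = l ++ [a] :=
    ⟨_, _, List.ofFn_succ' _ |>.trans (List.concat_eq_append ..)⟩
  obtain ⟨l, a, hla⟩ := word_eq
  change formSeq f (d + 2) v = formSeq g (d + 2) v
  rw [eq_wordForm_word 1 (formSeq f) hv, eq_wordForm_word 1 (formSeq g) hv, hla]
  exact congrArg _ (h l a)

variable [DirectSum.Decomposition 𝒦] {ip : V →+ V →+ K}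

theorem represents_bracketWord (hip : IsInnerProduct 𝒦 𝒱 ip) (hφ : φ ∈ CC 𝒱 ip)
    (hψ : ψ ∈ CC 𝒱 ip) :
    Represents ip (bracketWord φ ψ : List (Letter 𝒱) → V) (actWord 𝒱 (tilde ip φ) ψ) := by
  intro l w
  have symm : ∀ {χ}, χ ∈ CC 𝒱 ip →
      IsGradedSymmetric (formWord (tilde ip χ) : List (Letter 𝒱) → K) :=
    fun hχ => isGradedSymmetric_formWord (tilde_mem_forms hip hχ)
  have parts : ∀ γ₁ γ₂ : ZMod 2, Represents ip (𝒱 := 𝒱)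
      (fun l => wordInsert γ₂ (degreePart 𝒱 1 γ₁ (cochainWord φ)) (cochainWord ψ) l +
        ksign (γ₁ * γ₂ + 1) •
          wordInsert γ₁ (degreePart 𝒱 1 γ₂ (cochainWord ψ)) (cochainWord φ) l)
      (wordInsert γ₂ (degreePart 𝒦 0 γ₁ (formWord (tilde ip φ))) (cochainWord ψ)) := by
    intro γ₁ γ₂
    simpa only [wordInsert_degreePart] using Represents.wordInsert hip (symm hφ).degreePart
      (symm hψ).degreePart (hasDegree_degreePart 𝒱 1 γ₁) (hasDegree_degreePart 𝒱 1 γ₂)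
      (Represents.degreePart hip (represents_tilde φ) γ₁)
      (Represents.degreePart hip (represents_tilde ψ) γ₂)
  have sum_parts : ∀ γ₂ : ZMod 2, wordInsert γ₂ (formWord (tilde ip φ)) (cochainWord ψ) (l ++ [w]) =
      ∑ γ₁, wordInsert γ₂ (degreePart 𝒦 0 γ₁ (formWord (tilde ip φ))) (cochainWord ψ)
        (l ++ [w]) := fun γ₂ => by
    simp only [wordInsert, koszulSum, ← unshuffleSum_sum, sum_degreePart]
  simp only [actWord, bracketWord, sum_parts, parts _ _ l w, map_sum,
    AddMonoidHom.finsetSum_apply, ← Finset.smul_sum]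
  rw [Finset.sum_comm]

theorem tilde_modBracket (hip : IsInnerProduct 𝒦 𝒱 ip) (hV : IsSupermodule 𝒦 𝒱)
    (hφ : φ ∈ CC 𝒱 ip) (hψ : ψ ∈ CC 𝒱 ip) :
    tilde ip (modBracket 𝒱 φ ψ) = act 𝒱 (tilde ip φ) ψ := by
  have tilde_mem := tilde_mem_forms hip hφ
  refine eq_of_formWord_eq (𝒱 := 𝒱) (multiAdditive_tilde (multiAdditive_modBracket hφ.1 hψ.1))
    (fun d => (act_mem hV tilde_mem hψ.1 d).add) fun l w => ?_
  rw [represents_tilde, cochainWord_modBracket hφ.1 hψ.1, formWord_act tilde_mem hψ.1,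
    represents_bracketWord hip hφ hψ]

theorem modBracket_mem (hip : IsInnerProduct 𝒦 𝒱 ip) (hV : IsSupermodule 𝒦 𝒱)
    (hφ : φ ∈ CC 𝒱 ip) (hψ : ψ ∈ CC 𝒱 ip) : modBracket 𝒱 φ ψ ∈ CC 𝒱 ip := by
  have tilde_mem : tilde ip (modBracket 𝒱 φ ψ) ∈ Forms K 𝒱 :=
    tilde_modBracket hip hV hφ hψ ▸ act_mem hV (tilde_mem_forms hip hφ) hψ.1
  have sharp_eq : sharp hip ⟨_, tilde_mem⟩ = modBracket 𝒱 φ ψ :=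
    hip.tilde_injective (tilde_sharp hip _)
  exact sharp_eq ▸ sharp_mem hip _

end TildeBracket

section Linearity

section Words

variable {K V : Type*} [Ring K]

theorem formSeq_add (f g : FormFamily V K) : formSeq (f + g) = formSeq f + formSeq g :=
  funext fun N => match N with
    | 0 => (add_zero 0).symm
    | 1 => (add_zero 0).symm
    | _ + 2 => rfl

theorem formSeq_smul (t : K) (f : FormFamily V K) : formSeq (t • f) = t • formSeq f :=
  funext fun N => match N with
    | 0 => (smul_zero t).symm
    | 1 => (smul_zero t).symm
    | _ + 2 => rfl

variable [AddCommGroup V]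

theorem cochainSeq_add (φ ψ : CochainFamily V) :
    cochainSeq (φ + ψ) = cochainSeq φ + cochainSeq ψ :=
  funext fun N => match N with
    | 0 => (add_zero 0).symm
    | _ + 1 => rfl

variable {𝒱 : ZMod 2 → AddSubgroup V}

theorem formWord_add (f g : FormFamily V K) :
    (formWord (f + g) : List (Letter 𝒱) → K) = fun l => formWord f l + formWord g l :=
  funext fun l => by
    rw [formWord, wordForm, formSeq_add, Pi.add_apply, Pi.add_apply, smul_add]
    rfl

theorem formWord_smul (t : K) (f : FormFamily V K) :
    (formWord (t • f) : List (Letter 𝒱) → K) = fun l => t * formWord f l :=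
  funext fun l => by
    rw [formWord, wordForm, formSeq_smul, Pi.smul_apply, Pi.smul_apply, smul_eq_mul,
      ← mul_smul_comm]
    rfl

theorem cochainWord_add (φ ψ : CochainFamily V) :
    (cochainWord (φ + ψ) : List (Letter 𝒱) → V) = fun l => cochainWord φ l + cochainWord ψ l :=
  funext fun l => by
    rw [cochainWord, wordForm, cochainSeq_add, Pi.add_apply, Pi.add_apply, smul_add]
    rfl

/-- `formWord` as an additive map, to commute it with sums and signs. -/
def formWordHom (K : Type*) [Ring K] (𝒱 : ZMod 2 → AddSubgroup V) :
    FormFamily V K →+ List (Letter 𝒱) → K :=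
  AddMonoidHom.mk' formWord formWord_add

end Words

variable {K V : Type*} [Ring K] [AddCommGroup V] {𝒱 : ZMod 2 → AddSubgroup V}

theorem sharp_add [Module K V] [Module Kᵐᵒᵖ V] {𝒦 : ZMod 2 → AddSubgroup K} {ip : V →+ V →+ K}
    (hip : IsInnerProduct 𝒦 𝒱 ip) (f g : Forms K 𝒱) :
    sharp hip (f + g) = sharp hip f + sharp hip g := by
  refine hip.tilde_injective ?_
  rw [tilde_sharp, Submodule.coe_add, ← tilde_sharp hip f, ← tilde_sharp hip g]
  funext d v
  simp only [tilde, Pi.add_apply, map_add, AddMonoidHom.add_apply]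

variable [DirectSum.Decomposition 𝒱]

theorem wordInsert_const_mul (γ : ZMod 2) (t : K) (f : List (Letter 𝒱) → K)
    (g : List (Letter 𝒱) → V) (l : List (Letter 𝒱)) :
    wordInsert γ (fun l => t * f l) g l = t * wordInsert γ f g l :=
  (map_unshuffleSum _ (AddMonoidHom.mulLeft t) l _).symm

theorem act_add_left (f g : FormFamily V K) (ψ : CochainFamily V) :
    act 𝒱 (f + g) ψ = act 𝒱 f ψ + act 𝒱 g ψ := by
  funext d v
  simp only [act, ofWord, actWord, formWord_add, wordInsert_add_left, smul_add,
    Finset.sum_add_distrib, Pi.add_apply]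

theorem act_smul_left (t : K) (f : FormFamily V K) (ψ : CochainFamily V) :
    act 𝒱 (t • f) ψ = t • act 𝒱 f ψ := by
  funext d v
  simp only [act, ofWord, actWord, formWord_smul, wordInsert_const_mul, Pi.smul_apply, smul_eq_mul,
    Finset.mul_sum, mul_smul_comm]

variable [Module K V] [Module Kᵐᵒᵖ V]

theorem act_add_right {f : FormFamily V K} (hf : f ∈ Forms K 𝒱) (φ ψ : CochainFamily V) :
    act 𝒱 f (φ + ψ) = act 𝒱 f φ + act 𝒱 f ψ := by
  funext d v
  simp only [act, ofWord, actWord, cochainWord_add, smul_add, Finset.sum_add_distrib, Pi.add_apply,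
    wordInsert_add_right _ (headAdditive_formWord hf)]

variable {𝒦 : ZMod 2 → AddSubgroup K} [DirectSum.Decomposition 𝒦] {ip : V →+ V →+ K}

/-- `act` for a fixed `ψ ∈ C(V)`, as a linear endomorphism of the module of scalar valued
cochains. -/
def actHom (hV : IsSupermodule 𝒦 𝒱) {ψ : CochainFamily V} (hψ : InC K 𝒱 ψ) :
    Forms K 𝒱 →ₗ[K] Forms K 𝒱 where
  toFun f := ⟨act 𝒱 f.1 ψ, act_mem hV f.2 hψ⟩
  map_add' _ _ := Subtype.ext (act_add_left _ _ _)
  map_smul' _ _ := Subtype.ext (act_smul_left _ _ _)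

/-- The bracket `{φ̃, ψ̃}` on scalar valued cochains: the action of `ψ` on `φ̃`. -/
noncomputable def formBracket (hip : IsInnerProduct 𝒦 𝒱 ip) (hV : IsSupermodule 𝒦 𝒱) :
    Forms K 𝒱 →+ Forms K 𝒱 →+ Forms K 𝒱 :=
  AddMonoidHom.mk' (fun f => AddMonoidHom.mk' (fun g => actHom hV (inC_sharp hip g) f)
    fun g g' => Subtype.ext <| by
      change act 𝒱 f.1 _ = act 𝒱 f.1 _ + act 𝒱 f.1 _
      rw [sharp_add, act_add_right f.2])
    fun f f' => AddMonoidHom.ext fun g => map_add (actHom hV (inC_sharp hip g)) f f'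

end Linearity

/-! ### Degrees and the Lie algebra axioms -/

section Degree

variable {K V : Type*} [Ring K] [AddCommGroup V] {𝒱 : ZMod 2 → AddSubgroup V}

theorem represents_sharp [Module K V] [Module Kᵐᵒᵖ V] {𝒦 : ZMod 2 → AddSubgroup K}
    {ip : V →+ V →+ K} (hip : IsInnerProduct 𝒦 𝒱 ip) (f : Forms K 𝒱) :
    Represents ip (cochainWord (sharp hip f) : List (Letter 𝒱) → V) (formWord f.1) :=
  tilde_sharp hip f ▸ represents_tilde _

variable [DirectSum.Decomposition 𝒱]

theorem hasDegree_cochainWord {s : ZMod 2} {φ : CochainFamily V}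
    (h : ∀ d : ℕ, HasParity 𝒱 𝒱 (s + d) (φ d)) :
    HasDegree 𝒱 1 s (cochainWord φ : List (Letter 𝒱) → V) := by
  intro l
  obtain ⟨v, p, hv, hl⟩ := exists_eq_word l
  generalize l.length = N at v p hv hl
  rw [hl, cochainWord, wordForm_word 0 _ hv, label_word]
  refine (𝒱 _).zsmul_mem ?_ _
  cases N with
  | zero => exact zero_mem _
  | succ d =>
    have degree_eq : s + d + ∑ i, p i = s + (∑ i, p i + (d + 1 : ℕ)) + 1 := by
      push_cast
      grind
    exact degree_eq ▸ h d v p hv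

variable [Module K V] [Module Kᵐᵒᵖ V] {𝒦 : ZMod 2 → AddSubgroup K}

theorem mem_totalParityPart_iff {s : ZMod 2} {f : Forms K 𝒱} :
    f ∈ totalParityPart 𝒦 𝒱 s ↔ HasDegree 𝒦 0 s (formWord f.1 : List (Letter 𝒱) → K) := by
  have degree_eq : ∀ {d : ℕ} (p : Fin (d + 2) → ZMod 2),
      s + d + ∑ i, p i = s + (∑ i, p i + (d + 2 : ℕ)) + 0 := fun p => by
    push_cast
    grind
  refine ⟨fun h l => ?_, fun h d v p hv => ?_⟩
  · obtain ⟨v, p, hv, hl⟩ := exists_eq_word l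
    generalize l.length = N at v p hv hl
    rw [hl, formWord, wordForm_word 1 _ hv, label_word]
    refine (𝒦 _).zsmul_mem ?_ _
    match N with
    | 0 | 1 => exact zero_mem _
    | d + 2 => exact degree_eq p ▸ h d v p hv
  · change formSeq f.1 (d + 2) v ∈ _
    rw [eq_wordForm_word 1 (formSeq f.1) hv, degree_eq,
      ← label_word (V := V) (𝒱 := 𝒱) (v := v)]
    exact (𝒦 _).zsmul_mem (h _) _

variable [DirectSum.Decomposition 𝒦] {ip : V →+ V →+ K}

theorem hasDegree_sharp (hip : IsInnerProduct 𝒦 𝒱 ip) {s : ZMod 2} {f : Forms K 𝒱}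
    (hf : f ∈ totalParityPart 𝒦 𝒱 s) :
    HasDegree 𝒱 1 s (cochainWord (sharp hip f) : List (Letter 𝒱) → V) := by
  intro l
  refine hip.mem_of_forall fun q w hw => ?_
  let a : Letter 𝒱 := ⟨q + 1, w, by rwa [add_one_add_one]⟩
  have mem_part := mem_totalParityPart_iff.1 hf (l ++ [a])
  rw [represents_sharp hip f l a] at mem_part
  have degree_eq : s + label l + 1 + q = s + label (l ++ [a]) + 0 := by
    simp only [label_append, label_cons, label_nil, a]
    grind
  rw [degree_eq, ← ksign_smul_self (a.deg + 1) (ip _ w)]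
  exact (𝒦 _).zsmul_mem mem_part _

end Degree

section Action

variable {K V : Type*} [Ring K] [AddCommGroup V] {𝒱 : ZMod 2 → AddSubgroup V}
  [DirectSum.Decomposition 𝒱]

theorem wordInsert_zero_right (γ : ZMod 2) {f : List (Letter 𝒱) → K} (hf : HeadAdditive f)
    (l : List (Letter 𝒱)) : wordInsert γ f (0 : List (Letter 𝒱) → V) l = 0 := by
  simpa only [zero_smul] using! wordInsert_zsmul_right γ hf 0 0 l

variable [Module K V] [Module Kᵐᵒᵖ V] {𝒦 : ZMod 2 → AddSubgroup K} {ψ : CochainFamily V}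
  {t : ZMod 2}

theorem actWord_of_hasDegree {f : FormFamily V K} (hf : f ∈ Forms K 𝒱)
    (hψ : HasDegree 𝒱 1 t (cochainWord ψ : List (Letter 𝒱) → V)) :
    actWord 𝒱 f ψ = wordInsert t (formWord f) (cochainWord ψ) := by
  funext l
  refine Finset.sum_eq_single_of_mem t (Finset.mem_univ t) fun γ _ hγ => ?_
  rw [← wordInsert_degreePart, degreePart_of_hasDegree_ne hψ hγ,
    wordInsert_zero_right γ (headAdditive_formWord hf)]

variable [DirectSum.Decomposition 𝒦]

theorem formWord_actHom (hV : IsSupermodule 𝒦 𝒱) (hψ : InC K 𝒱 ψ)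
    (ht : HasDegree 𝒱 1 t (cochainWord ψ : List (Letter 𝒱) → V)) (f : Forms K 𝒱) :
    formWord (actHom hV hψ f).1 =
      (wordInsert t (formWord f.1) (cochainWord ψ) : List (Letter 𝒱) → K) :=
  (formWord_act f.2 hψ).trans (actWord_of_hasDegree f.2 ht)

theorem actHom_mem (hV : IsSupermodule 𝒦 𝒱) (hψ : InC K 𝒱 ψ)
    (ht : HasDegree 𝒱 1 t (cochainWord ψ : List (Letter 𝒱) → V)) {s : ZMod 2} {f : Forms K 𝒱}
    (hf : f ∈ totalParityPart 𝒦 𝒱 s) : actHom hV hψ f ∈ totalParityPart 𝒦 𝒱 (s + t) := by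
  rw [mem_totalParityPart_iff, formWord_actHom hV hψ ht]
  exact (mem_totalParityPart_iff.1 hf).wordInsert t _

end Action

section FormBracket

variable {K V : Type*} [Ring K] [AddCommGroup V] {𝒱 : ZMod 2 → AddSubgroup V}

theorem formWord_zsmul (n : ℤ) (f : FormFamily V K) (l : List (Letter 𝒱)) :
    formWord (n • f) l = n • formWord f l :=
  congrFun (map_zsmul (formWordHom K 𝒱) n f) l

variable [Module K V] [Module Kᵐᵒᵖ V] [DirectSum.Decomposition 𝒱]

theorem forms_ext {f g : Forms K 𝒱}
    (h : (formWord f.1 : List (Letter 𝒱) → K) = formWord g.1) : f = g :=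
  Subtype.ext <| eq_of_formWord_eq (fun d => (f.2 d).add) (fun d => (g.2 d).add)
    fun l a => congrFun h (l ++ [a])

variable {𝒦 : ZMod 2 → AddSubgroup K} [DirectSum.Decomposition 𝒦] {ip : V →+ V →+ K}
  {s t : ZMod 2} {f g h : Forms K 𝒱} (hip : IsInnerProduct 𝒦 𝒱 ip) (hV : IsSupermodule 𝒦 𝒱)

include hV

theorem formBracket_mem (hf : f ∈ totalParityPart 𝒦 𝒱 s) (hg : g ∈ totalParityPart 𝒦 𝒱 t) :
    formBracket hip hV f g ∈ totalParityPart 𝒦 𝒱 (s + t) :=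
  actHom_mem hV (inC_sharp hip g) (hasDegree_sharp hip hg) hf

theorem formWord_formBracket (f : Forms K 𝒱) (hg : g ∈ totalParityPart 𝒦 𝒱 t) :
    formWord (formBracket hip hV f g).1 =
      (wordInsert t (formWord f.1) (cochainWord (sharp hip g)) : List (Letter 𝒱) → K) :=
  formWord_actHom hV (inC_sharp hip g) (hasDegree_sharp hip hg) f

theorem cochainWord_sharp_formBracket (hf : f ∈ totalParityPart 𝒦 𝒱 s)
    (hg : g ∈ totalParityPart 𝒦 𝒱 t) :
    (cochainWord (sharp hip (formBracket hip hV f g)) : List (Letter 𝒱) → V) = fun l =>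
      wordInsert t (cochainWord (sharp hip f)) (cochainWord (sharp hip g)) l -
        ksign (s * t) • wordInsert s (cochainWord (sharp hip g)) (cochainWord (sharp hip f)) l := by
  funext l
  refine hip.ext_homogeneous fun q w hw => ?_
  let a : Letter 𝒱 := ⟨q + 1, w, by rwa [add_one_add_one]⟩
  have repr_bracket := represents_sharp hip (formBracket hip hV f g) l a
  have repr_insert := Represents.wordInsert hip (isGradedSymmetric_formWord f.2)
    (isGradedSymmetric_formWord g.2) (hasDegree_sharp hip hf) (hasDegree_sharp hip hg)
    (represents_sharp hip f) (represents_sharp hip g) l a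
  rw [← formWord_formBracket hip hV f hg, repr_bracket, ksign_smul_eq_iff, ksign_smul_self]
    at repr_insert
  simp only [ksign_add, ksign_one, mul_neg_one, neg_smul, ← sub_eq_add_neg] at repr_insert
  exact repr_insert

theorem formBracket_antisymm (hf : f ∈ totalParityPart 𝒦 𝒱 s) (hg : g ∈ totalParityPart 𝒦 𝒱 t) :
    formBracket hip hV f g = -(ksign (s * t) • formBracket hip hV g f) := by
  have sharp_antisymm : ∀ l : List (Letter 𝒱), cochainWord (sharp hip (formBracket hip hV f g)) l =
      -(ksign (s * t) • cochainWord (sharp hip (formBracket hip hV g f)) l) := fun l => by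
    rw [cochainWord_sharp_formBracket hip hV hf hg, cochainWord_sharp_formBracket hip hV hg hf,
      mul_comm t s, smul_sub, ksign_smul_self, neg_sub]
  refine Subtype.ext <| eq_of_formWord_eq (𝒱 := 𝒱) (fun d => ((formBracket hip hV f g).2 d).add)
    (fun d => ((-(ksign (s * t) • formBracket hip hV g f)).2 d).add) fun l a => ?_
  have formWord_neg : formWord (-(ksign (s * t) • formBracket hip hV g f)).1 (l ++ [a]) =
      -(ksign (s * t) • formWord (formBracket hip hV g f).1 (l ++ [a])) := by
    rw [← neg_smul, ← neg_smul, Submodule.coe_smul_of_tower, formWord_zsmul]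
  rw [formWord_neg, represents_sharp hip, represents_sharp hip, sharp_antisymm, map_neg, map_zsmul,
    AddMonoidHom.neg_apply, AddMonoidHom.zsmul_apply, smul_neg, smul_comm]

theorem formBracket_formBracket (f : Forms K 𝒱) (hg : g ∈ totalParityPart 𝒦 𝒱 s)
    (hh : h ∈ totalParityPart 𝒦 𝒱 t) :
    formBracket hip hV (formBracket hip hV f g) h =
      formBracket hip hV f (formBracket hip hV g h) +
        ksign (s * t) • formBracket hip hV (formBracket hip hV f h) g := by
  have hgh := formBracket_mem hip hV hg hh
  refine forms_ext (funext fun l => ?_)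
  rw [Submodule.coe_add, Submodule.coe_smul_of_tower, formWord_add]
  beta_reduce
  rw [formWord_zsmul, formWord_formBracket hip hV _ hh, formWord_formBracket hip hV _ hgh,
    formWord_formBracket hip hV f hg, formWord_formBracket hip hV _ hg,
    formWord_formBracket hip hV f hh, cochainWord_sharp_formBracket hip hV hg hh,
    wordInsert_bracket s t (headAdditive_formWord f.2) (isGradedSymmetric_formWord f.2),
    sub_add_cancel]

end FormBracket

section TotalPart

variable {K V : Type*} [Ring K] [AddCommGroup V] {𝒦 : ZMod 2 → AddSubgroup K} [GradedRing 𝒦]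
  {𝒱 : ZMod 2 → AddSubgroup V} [Module Kᵐᵒᵖ V]

theorem HeadLinear.degreePart {e u γ : ZMod 2} {F : List (Letter 𝒱) → K}
    [DirectSum.Decomposition 𝒱] (hF : HeadLinear 𝒦 e F) :
    HeadLinear 𝒦 e (degreePart 𝒦 u γ F) := by
  intro s t ht d x l
  have degree_eq : γ + label (letter (d + s) (MulOpposite.op t • x) :: l) + u =
      γ + label (letter d x :: l) + u + s := by
    simp only [label_cons, letter_deg]
    ring
  rw [LInfty.degreePart, hF s t ht, degree_eq, ← projHom_apply, map_zsmul, projHom_apply]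
  exact congrArg _ <| proj_map (AddMonoidHom.mulRight t)
    (fun _ _ hx => SetLike.mul_mem_graded hx ht) _ _

variable [Module K V] [DirectSum.Decomposition 𝒱] (hV : IsSupermodule 𝒦 𝒱)

/-- The component of total parity `γ` of a family of scalar valued cochains. -/
def totalPart (γ : ZMod 2) (f : Forms K 𝒱) : Forms K 𝒱 :=
  ⟨fun d => ofWord 1 (degreePart 𝒦 0 γ (formWord f.1) : List (Letter 𝒱) → K) (d + 2), fun d => by
    have cochain := isWordCochain_formWord hV f.2
    have symm := cochain.symm.degreePart (𝒳 := 𝒦) (u := 0) (γ := γ)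
    have add := cochain.add.degreePart (𝒳 := 𝒦) (u := 0) (γ := γ)
    refine IsWordCochain.isCochain (e := 1)
      (F := ofWord 1 (degreePart 𝒦 0 γ (formWord f.1) : List (Letter 𝒱) → K)) ?_ hV
      (multiAdditive_ofWord symm add 1 _)
    rw [wordForm_ofWord symm add]
    exact ⟨symm, add, cochain.linear.degreePart⟩⟩

theorem formWord_totalPart (γ : ZMod 2) (f : Forms K 𝒱) :
    formWord (totalPart hV γ f).1 = (degreePart 𝒦 0 γ (formWord f.1) : List (Letter 𝒱) → K) :=
  formWord_ofWord (isGradedSymmetric_formWord f.2).degreePart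
    (headAdditive_formWord f.2).degreePart
    ((congrArg _ (formWord_nil f.1)).trans (map_zero (projHom 𝒦 _)))
    fun a => (congrArg _ (formWord_singleton f.1 a)).trans (map_zero (projHom 𝒦 _))

theorem totalPart_mem (γ : ZMod 2) (f : Forms K 𝒱) :
    totalPart hV γ f ∈ totalParityPart 𝒦 𝒱 γ := by
  rw [mem_totalParityPart_iff, formWord_totalPart]
  exact hasDegree_degreePart 𝒦 0 γ

theorem sum_totalPart (f : Forms K 𝒱) : ∑ γ, totalPart hV γ f = f := by
  refine forms_ext (funext fun l => ?_)
  have formWord_sum : formWord (∑ γ, totalPart hV γ f).1 l =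
      ∑ γ, formWord (totalPart hV γ f).1 l := by
    rw [Submodule.coe_sum, ← Finset.sum_apply]
    exact congrFun (map_sum (formWordHom K 𝒱) (fun γ => (totalPart hV γ f).1) Finset.univ) l
  simp only [formWord_sum, formWord_totalPart, sum_degreePart]

end TotalPart

section Lie

variable {K V : Type*} [Ring K] [AddCommGroup V] [Module K V] [Module Kᵐᵒᵖ V]
  {𝒦 : ZMod 2 → AddSubgroup K} [GradedRing 𝒦] {𝒱 : ZMod 2 → AddSubgroup V}
  [DirectSum.Decomposition 𝒱] {ip : V →+ V →+ K}
  (hip : IsInnerProduct 𝒦 𝒱 ip) (hV : IsSupermodule 𝒦 𝒱)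

theorem formBracket_jacobi {s t : ZMod 2} {f g : Forms K 𝒱} (hf : f ∈ totalParityPart 𝒦 𝒱 s)
    (hg : g ∈ totalParityPart 𝒦 𝒱 t) (h : Forms K 𝒱) :
    formBracket hip hV f (formBracket hip hV g h) =
      formBracket hip hV (formBracket hip hV f g) h +
        ksign (s * t) • formBracket hip hV g (formBracket hip hV f h) := by
  have homogeneous : ∀ (γ : ZMod 2) {h : Forms K 𝒱}, h ∈ totalParityPart 𝒦 𝒱 γ →
      formBracket hip hV f (formBracket hip hV g h) =
        formBracket hip hV (formBracket hip hV f g) h +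
          ksign (s * t) • formBracket hip hV g (formBracket hip hV f h) := by
    intro γ h hh
    have swap : ksign (t * γ) • formBracket hip hV (formBracket hip hV f h) g =
        -(ksign (s * t) • formBracket hip hV g (formBracket hip hV f h)) := by
      rw [formBracket_antisymm hip hV (formBracket_mem hip hV hf hh) hg, smul_neg,
        ksign_smul_ksign_smul]
      exact congrArg _ (ksign_smul_congr (by grind) _)
    rw [formBracket_formBracket hip hV f hg hh, swap, neg_add_cancel_right]
  rw [← sum_totalPart hV h]
  simp only [map_sum, homogeneous _ (totalPart_mem hV _ h), Finset.sum_add_distrib,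
    Finset.smul_sum]

theorem isGradedLieBracket_total :
    IsGradedLieBracket K (totalParityPart 𝒦 𝒱) (fun s t => s * t) (formBracket hip hV) where
  mem _ _ _ _ := formBracket_mem hip hV
  smul_left t f g := map_smul (actHom hV (inC_sharp hip g)) t f
  antisymm _ _ _ _ := formBracket_antisymm hip hV
  jacobi _ _ _ _ h hf hg := formBracket_jacobi hip hV hf hg h

end Lie

section Bidegree

theorem eq_of_sum_eq_of_hasParity {K V : Type*} [Ring K] [AddCommGroup V]
    {𝒦 : ZMod 2 → AddSubgroup K} [DirectSum.Decomposition 𝒦] {𝒱 : ZMod 2 → AddSubgroup V}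
    [DirectSum.Decomposition 𝒱] {N : ℕ}
    {F G : ZMod 2 → (Fin N → V) → K} (hF : ∀ q, MultiAdditive (F q))
    (hG : ∀ q, MultiAdditive (G q)) (hFq : ∀ q, HasParity 𝒱 𝒦 q (F q))
    (hGq : ∀ q, HasParity 𝒱 𝒦 q (G q)) (h : ∑ q, F q = ∑ q, G q) : F = G := by
  refine funext fun q => MultiAdditive.ext 𝒱 (hF q) (hG q) fun v p hv => ?_
  have proj_sum : ∀ {F : ZMod 2 → (Fin N → V) → K}, (∀ q, HasParity 𝒱 𝒦 q (F q)) →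
      proj 𝒦 (q + ∑ i, p i) ((∑ q, F q) v) = F q v := fun {F} hFq => by
    rw [Finset.sum_apply, ← projHom_apply, map_sum]
    exact (Finset.sum_eq_single_of_mem q (Finset.mem_univ q) fun q' _ hq' =>
      proj_of_mem_ne (hFq q' v p hv) fun h => hq' (add_right_cancel h)).trans
        (proj_of_mem (hFq q v p hv))
  rw [← proj_sum hFq, h, proj_sum hGq]

variable {K V : Type*} [Ring K] [AddCommGroup V] [Module K V] [Module Kᵐᵒᵖ V]
  {𝒦 : ZMod 2 → AddSubgroup K} {𝒱 : ZMod 2 → AddSubgroup V}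

theorem mem_bidegreePart_iff {g : ZMod 2 × ℤ} {f : Forms K 𝒱} :
    f ∈ bidegreePart 𝒦 𝒱 g ↔
      (∀ d : ℕ, (d : ℤ) ≠ g.2 → f.1 d = 0) ∧ f ∈ totalParityPart 𝒦 𝒱 (g.1 + (g.2 : ZMod 2)) := by
  refine and_congr_right fun hf => forall_congr' fun d => ?_
  by_cases hd : (d : ℤ) = g.2
  · have parity_eq : g.1 + (g.2 : ZMod 2) + d = g.1 := by
      rw [← hd, Int.cast_natCast]
      grind
    rw [parity_eq]
  · have hasParity : ∀ q, HasParity 𝒱 𝒦 q (f.1 d) := fun q v p _ => by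
      rw [hf d hd]
      exact zero_mem _
    exact iff_of_true (hasParity _) (hasParity _)

theorem sharp_apply_eq_zero {ip : V →+ V →+ K} (hip : IsInnerProduct 𝒦 𝒱 ip) {f : Forms K 𝒱}
    {d : ℕ} (h : f.1 d = 0) : sharp hip f d = 0 := by
  funext v
  refine hip.ext fun w => ?_
  rw [ip_sharp, h, Pi.zero_apply, Pi.zero_apply, map_zero, AddMonoidHom.zero_apply]

/-- The component of exterior degree `d`. -/
def truncate (d : ℕ) (f : Forms K 𝒱) : Forms K 𝒱 :=
  ⟨Pi.single d (f.1 d), fun e => by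
    obtain rfl | h := eq_or_ne e d
    · exact Pi.single_eq_same (M := fun d => (Fin (d + 2) → V) → K) e _ ▸ f.2 e
    · exact Pi.single_eq_of_ne (M := fun d => (Fin (d + 2) → V) → K) h _ ▸
        (Forms K 𝒱).zero_mem e⟩

theorem truncate_apply_self (d : ℕ) (f : Forms K 𝒱) : (truncate d f).1 d = f.1 d :=
  Pi.single_eq_same d _

theorem truncate_apply_of_ne {d e : ℕ} (h : e ≠ d) (f : Forms K 𝒱) : (truncate d f).1 e = 0 :=
  Pi.single_eq_of_ne h _

theorem truncate_mem {d : ℕ} {q : ZMod 2} {f : Forms K 𝒱}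
    (hf : f ∈ totalParityPart 𝒦 𝒱 (q + d)) : truncate d f ∈ bidegreePart 𝒦 𝒱 (q, (d : ℤ)) := by
  have vanish : ∀ e : ℕ, (e : ℤ) ≠ d → (truncate d f).1 e = 0 := fun e he =>
    truncate_apply_of_ne (mod_cast he) f
  refine mem_bidegreePart_iff.2 ⟨vanish, fun e v p hv => ?_⟩
  obtain rfl | he := eq_or_ne e d
  · rw [truncate_apply_self, Int.cast_natCast]
    exact hf e v p hv
  · rw [truncate_apply_of_ne he]
    exact zero_mem _

variable [DirectSum.Decomposition 𝒱]

theorem existsUnique_bihomogeneous [GradedRing 𝒦] (hV : IsSupermodule 𝒦 𝒱) (f : Forms K 𝒱) :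
    ∃! c : ZMod 2 → ℕ → Forms K 𝒱,
      (∀ (q : ZMod 2) (d : ℕ), c q d ∈ bidegreePart 𝒦 𝒱 (q, (d : ℤ))) ∧
        ∀ d : ℕ, f.1 d = ∑ q : ZMod 2, (c q d).1 d := by
  refine existsUnique_of_exists_of_unique ⟨fun q d => truncate d (totalPart hV (q + d) f),
    fun q d => truncate_mem (totalPart_mem hV _ f), fun d => ?_⟩ ?_
  · conv_lhs => rw [← sum_totalPart hV f, Submodule.coe_sum, Finset.sum_apply]
    exact (Fintype.sum_equiv (Equiv.addRight (d : ZMod 2)) _ _ fun q =>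
      truncate_apply_self d _).symm
  · rintro c c' ⟨hc, hsum⟩ ⟨hc', hsum'⟩
    have same_parts : ∀ d, (fun q => (c q d).1 d) = fun q => (c' q d).1 d := fun d =>
      eq_of_sum_eq_of_hasParity (fun q => ((c q d).2 d).add) (fun q => ((c' q d).2 d).add)
        (fun q => (hc q d).2 d) (fun q => (hc' q d).2 d) ((hsum d).symm.trans (hsum' d))
    refine funext fun q => funext fun d => Subtype.ext (funext fun e => ?_)
    obtain rfl | he := eq_or_ne e d
    · exact congrFun (same_parts e) q
    · have he' : (e : ℤ) ≠ d := mod_cast he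
      rw [(hc q d).1 e he', (hc' q d).1 e he']

variable {ip : V →+ V →+ K} (hip : IsInnerProduct 𝒦 𝒱 ip) (hV : IsSupermodule 𝒦 𝒱)

theorem formBracket_apply_eq_zero [DirectSum.Decomposition 𝒦] {m n : ℤ} {f g : Forms K 𝒱}
    (hf : ∀ d : ℕ, (d : ℤ) ≠ m → f.1 d = 0) (hg : ∀ d : ℕ, (d : ℤ) ≠ n → g.1 d = 0) {d : ℕ}
    (hd : (d : ℤ) ≠ m + n) : (formBracket hip hV f g).1 d = 0 := by
  refine MultiAdditive.ext 𝒱 ((formBracket hip hV f g).2 d).add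
    (fun _ _ _ _ => (add_zero 0).symm) fun v p hv => (act_apply f.2 (inC_sharp hip g) hv).trans
      (Finset.sum_eq_zero fun ab hab => Finset.sum_eq_zero fun γ _ => ?_)
  rw [Finset.HasAntidiagonal.mem_antidiagonal] at hab
  by_cases ha : (ab.1 : ℤ) = m
  · have hb : (ab.2 : ℤ) ≠ n := by omega
    have part_eq_zero : parityPart 𝒱 (γ + ab.2) (sharp hip g ab.2) = 0 := by
      rw [sharp_apply_eq_zero hip (hg _ hb)]
      exact funext fun v => Finset.sum_eq_zero fun p _ => map_zero (projHom 𝒱 _)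
    rw [part_eq_zero, insertAt_zero_right (f.2 _).add, smul_zero]
  · rw [hf _ ha, insertAt_zero_left, smul_zero]

theorem isGradedLieBracket_bidegree [GradedRing 𝒦] :
    IsGradedLieBracket K (bidegreePart 𝒦 𝒱) totalForm (formBracket hip hV) where
  mem g h f f' hf hf' := by
    rw [mem_bidegreePart_iff] at *
    refine ⟨fun d hd => formBracket_apply_eq_zero hip hV hf.1 hf'.1 hd, ?_⟩
    have mem_total := formBracket_mem hip hV hf.2 hf'.2
    rwa [add_add_add_comm, ← Int.cast_add] at mem_total
  smul_left := (isGradedLieBracket_total hip hV).smul_left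
  antisymm _ _ _ _ hf hg :=
    formBracket_antisymm hip hV (mem_bidegreePart_iff.1 hf).2 (mem_bidegreePart_iff.1 hg).2
  jacobi _ _ _ _ h hf hg :=
    formBracket_jacobi hip hV (mem_bidegreePart_iff.1 hf).2 (mem_bidegreePart_iff.1 hg).2 h

end Bidegree

/-! ### The differential -/

section Differential

theorem tilde_hasParity {K V : Type*} [Ring K] [AddCommGroup V] [Module K V] [Module Kᵐᵒᵖ V]
    {𝒦 : ZMod 2 → AddSubgroup K} {𝒱 : ZMod 2 → AddSubgroup V}
    {ip : V →+ V →+ K} (hip : IsInnerProduct 𝒦 𝒱 ip) {φ : CochainFamily V} {q : ZMod 2} {d : ℕ}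
    (h : HasParity 𝒱 𝒱 q (φ d)) : HasParity 𝒱 𝒦 q (tilde ip φ d) := fun v p hv => by
  rw [Fin.sum_univ_castSucc, ← add_assoc]
  exact hip.even _ _ _ _ (h _ _ fun i => hv i.castSucc) (hv (Fin.last (d + 1)))

variable {K V : Type*} [Ring K] [AddCommGroup V] [Module K V] [Module Kᵐᵒᵖ V]
  {𝒱 : ZMod 2 → AddSubgroup V} [DirectSum.Decomposition 𝒱] {φ : CochainFamily V}

theorem IsLInfty.hasDegree (h : IsLInfty K 𝒱 φ) :
    HasDegree 𝒱 1 1 (cochainWord φ : List (Letter 𝒱) → V) :=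
  hasDegree_cochainWord fun d => add_comm (d : ZMod 2) 1 ▸ h.parity d

theorem IsLInfty.wordInsert_eq_zero (h : IsLInfty K 𝒱 φ) :
    wordInsert 1 (cochainWord φ) (cochainWord φ) = (0 : List (Letter 𝒱) → V) := by
  have add : HeadAdditive (cochainWord φ : List (Letter 𝒱) → V) :=
    headAdditive_cochainWord h.cochain
  funext l
  obtain ⟨v, p, hv, hl⟩ := exists_eq_word l
  generalize l.length = N at v p hv hl
  subst hl
  cases N with
  | zero =>
    change cochainWord φ [letter _ (cochainWord φ [])] = 0
    rw [cochainWord_nil, add.zero]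
  | succ d =>
    have inserted := sum_insertAt 0 1 add h.hasDegree rfl hv
    rw [← ksign_smul_eq_iff] at inserted
    refine inserted.symm.trans ((congrArg _ ?_).trans (smul_zero _))
    refine (Finset.sum_congr rfl fun ab _ => ?_).trans (h.relation d v p hv)
    rw [add_zero, mul_comm, add_comm 1 (ab.2 : ZMod 2)]
    rfl

variable {𝒦 : ZMod 2 → AddSubgroup K} [DirectSum.Decomposition 𝒦] (hV : IsSupermodule 𝒦 𝒱)

theorem actHom_actHom (h2 : IsLeftRegular (2 : K)) (h : IsLInfty K 𝒱 φ) (f : Forms K 𝒱) :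
    actHom hV h.cochain (actHom hV h.cochain f) = 0 := by
  refine forms_ext (funext fun l => ?_)
  rw [formWord_actHom hV h.cochain h.hasDegree, formWord_actHom hV h.cochain h.hasDegree,
    wordInsert_wordInsert 1 1 (headAdditive_formWord f.2), h.wordInsert_eq_zero,
    wordInsert_zero_right _ (headAdditive_formWord f.2), zero_add]
  have eq_neg := wordInsertPair_swap 1 1 (isGradedSymmetric_formWord f.2) (cochainWord φ)
    (cochainWord φ) l
  rw [mul_one, ksign_one, neg_one_smul, eq_neg_iff_add_eq_zero, ← two_mul] at eq_neg
  exact (h2.mul_left_eq_zero_iff.1 eq_neg).trans (congrFun (map_zero (formWordHom K 𝒱)) l).symm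

theorem isDifferential_actHom (h2 : IsLeftRegular (2 : K)) (h : IsLInfty K 𝒱 φ) :
    IsDifferential (totalParityPart 𝒦 𝒱) (actHom hV h.cochain) where
  odd _ _ := actHom_mem hV h.cochain h.hasDegree
  sq_zero := actHom_actHom hV h2 h

variable {ip : V →+ V →+ K} (hip : IsInnerProduct 𝒦 𝒱 ip)

theorem actHom_eq_formBracket (hφ : InC K 𝒱 φ) (f : Forms K 𝒱) {g : Forms K 𝒱}
    (hg : g.1 = tilde ip φ) : actHom hV hφ f = formBracket hip hV f g := by
  have sharp_eq : sharp hip g = φ := hip.tilde_injective ((tilde_sharp hip g).trans hg)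
  exact Subtype.ext (congrArg (act 𝒱 f.1) sharp_eq.symm)

end Differential

theorem isDGLie_actHom {K V : Type*} [Ring K] [AddCommGroup V] [Module K V] [Module Kᵐᵒᵖ V]
    {𝒦 : ZMod 2 → AddSubgroup K} [GradedRing 𝒦] {𝒱 : ZMod 2 → AddSubgroup V}
    [DirectSum.Decomposition 𝒱] (hV : IsSupermodule 𝒦 𝒱) {ip : V →+ V →+ K}
    (hip : IsInnerProduct 𝒦 𝒱 ip) {φ : CochainFamily V} (h2 : IsLeftRegular (2 : K))
    (h : IsLInfty K 𝒱 φ) (hcyc : ∀ d, IsCyclic 𝒱 ip (φ d)) :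
    IsDGLie (totalParityPart 𝒦 𝒱) (formBracket hip hV) (actHom hV h.cochain) where
  lie := isGradedLieBracket_total hip hV
  differential := isDifferential_actHom hV h2 h
  derivation s f g hg := by
    let φ' : Forms K 𝒱 := ⟨tilde ip φ, tilde_mem_forms hip ⟨h.cochain, hcyc⟩⟩
    have odd : φ' ∈ totalParityPart 𝒦 𝒱 1 := fun d =>
      tilde_hasParity hip (add_comm (d : ZMod 2) 1 ▸ h.parity d)
    have D_eq : ∀ f, actHom hV h.cochain f = formBracket hip hV f φ' := fun f =>
      actHom_eq_formBracket hV hip h.cochain f rfl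
    rw [D_eq, D_eq, D_eq, formBracket_formBracket hip hV f hg odd, mul_one]

theorem isLeftRegular_two {K : Type*} [Ring K] [CharZero K] {𝒦 : ZMod 2 → AddSubgroup K}
    [GradedRing 𝒦] (hK0 : IsField (𝒦 0)) : IsLeftRegular (2 : K) := by
  have two_ne : (2 : 𝒦 0) ≠ 0 := fun h => two_ne_zero (congrArg (Subtype.val : 𝒦 0 → K) h)
  obtain ⟨half, h⟩ := hK0.mul_inv_cancel two_ne
  have half_mul : (half : K) * 2 = 1 :=
    congrArg (Subtype.val : 𝒦 0 → K) ((hK0.mul_comm _ _).trans h)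
  exact isLeftRegular_of_mul_eq_one half_mul

end LInfty

open LInfty in
theorem mainTheorem6_general {K V : Type*} [Ring K]
    (𝒦 : ZMod 2 → AddSubgroup K) [GradedRing 𝒦] (h2 : IsLeftRegular (2 : K))
    [AddCommGroup V] [Module K V] [Module Kᵐᵒᵖ V]
    (𝒱 : ZMod 2 → AddSubgroup V) [DirectSum.Decomposition 𝒱] (hV : IsSupermodule 𝒦 𝒱)
    (ip : V →+ V →+ K) (hip : IsInnerProduct 𝒦 𝒱 ip) :
    (∀ φ ∈ CC 𝒱 ip, ∀ ψ ∈ CC 𝒱 ip, modBracket 𝒱 φ ψ ∈ CC 𝒱 ip) ∧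
    (∀ φ ∈ CC 𝒱 ip, ∀ ψ ∈ CC 𝒱 ip, ∀ q : ℕ → ZMod 2, (∀ b, HasParity 𝒱 𝒱 (q b) (ψ b)) →
      ∀ (d : ℕ) (v : Fin (d + 2) → V) (p : Fin (d + 2) → ZMod 2), (∀ i, v i ∈ 𝒱 (p i)) →
        tilde ip (modBracket 𝒱 φ ψ) d v =
          ∑ ab ∈ Finset.HasAntidiagonal.antidiagonal d, ksign ((ab.1 : ZMod 2) * q ab.2) •
            insertAt (tilde ip φ ab.1) (ψ ab.2) p v) ∧
    Set.BijOn (tilde ip) (CC 𝒱 ip) (Forms K 𝒱 : Set (FormFamily V K)) ∧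
    (∀ f : Forms K 𝒱, ∃! c : ZMod 2 → ℕ → Forms K 𝒱,
      (∀ (q : ZMod 2) (d : ℕ), c q d ∈ bidegreePart 𝒦 𝒱 (q, (d : ℤ))) ∧
        ∀ d : ℕ, f.1 d = ∑ q : ZMod 2, (c q d).1 d) ∧
    ∃ B : Forms K 𝒱 →+ Forms K 𝒱 →+ Forms K 𝒱,
      (∀ φ ∈ CC 𝒱 ip, ∀ ψ ∈ CC 𝒱 ip, ∀ f g : Forms K 𝒱, f.1 = tilde ip φ → g.1 = tilde ip ψ →
        (B f g).1 = tilde ip (modBracket 𝒱 φ ψ)) ∧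
      IsGradedLieBracket K (bidegreePart 𝒦 𝒱) totalForm B ∧
      IsGradedLieBracket K (totalParityPart 𝒦 𝒱) (fun s t => s * t) B ∧
      ∀ l : CochainFamily V, IsLInfty K 𝒱 l →
        ∃ D : Forms K 𝒱 →ₗ[K] Forms K 𝒱,
          (∀ φ ∈ CC 𝒱 ip, ∀ f : Forms K 𝒱, f.1 = tilde ip φ →
            ∀ (d : ℕ) (v : Fin (d + 2) → V) (p : Fin (d + 2) → ZMod 2), (∀ i, v i ∈ 𝒱 (p i)) →
              (D f).1 d v =
                ∑ ab ∈ Finset.HasAntidiagonal.antidiagonal d,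
                  ksign ((ab.1 : ZMod 2) * ((ab.2 : ZMod 2) + 1)) •
                    insertAt (tilde ip φ ab.1) (l ab.2) p v) ∧
          IsDifferential (totalParityPart 𝒦 𝒱) D ∧
          ((∀ d, IsCyclic 𝒱 ip (l d)) →
            (∀ f g : Forms K 𝒱, g.1 = tilde ip l → D f = B f g) ∧
            IsDGLie (totalParityPart 𝒦 𝒱) B D) := by
  refine ⟨fun φ hφ ψ hψ => modBracket_mem hip hV hφ hψ, fun φ hφ ψ hψ q hq d v p hv => ?_,
    bijOn_tilde hip, existsUnique_bihomogeneous hV, formBracket hip hV,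
    fun φ hφ ψ hψ f g hf hg => ?_, isGradedLieBracket_bidegree hip hV,
    isGradedLieBracket_total hip hV, fun l hl => ⟨actHom hV hl.cochain,
      fun φ _ f hf d v p hv => ?_, isDifferential_actHom hV h2 hl, fun hcyc =>
        ⟨fun f g => actHom_eq_formBracket hV hip hl.cochain f, isDGLie_actHom hV hip h2 hl hcyc⟩⟩⟩
  · rw [tilde_modBracket hip hV hφ hψ]
    exact act_apply_of_hasParity (tilde_mem_forms hip hφ) hψ.1 hq hv
  · rw [tilde_modBracket hip hV hφ hψ, ← hf, ← actHom_eq_formBracket hV hip hψ.1 f hg]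
    rfl
  · rw [← hf]
    exact act_apply_of_hasParity f.2 hl.cochain hl.parity hv

open LInfty in
theorem mainTheorem6 {K V : Type*} [Ring K] [CharZero K]
    (𝒦 : ZMod 2 → AddSubgroup K) [GradedRing 𝒦] (hK : IsSupercommutative 𝒦)
    (hK0 : IsField (𝒦 0))
    [AddCommGroup V] [Module K V] [Module Kᵐᵒᵖ V]
    (𝒱 : ZMod 2 → AddSubgroup V) [DirectSum.Decomposition 𝒱] (hV : IsSupermodule 𝒦 𝒱)
    (ip : V →+ V →+ K) (hip : IsInnerProduct 𝒦 𝒱 ip) :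
    -- the bracket preserves cyclic cochains
    (∀ φ ∈ CC 𝒱 ip, ∀ ψ ∈ CC 𝒱 ip, modBracket 𝒱 φ ψ ∈ CC 𝒱 ip) ∧
    -- the unshuffle formula, for `ψ` with homogeneous components `ψ_l` of parity `q l`
    (∀ φ ∈ CC 𝒱 ip, ∀ ψ ∈ CC 𝒱 ip, ∀ q : ℕ → ZMod 2, (∀ b, HasParity 𝒱 𝒱 (q b) (ψ b)) →
      ∀ (d : ℕ) (v : Fin (d + 2) → V) (p : Fin (d + 2) → ZMod 2), (∀ i, v i ∈ 𝒱 (p i)) →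
        tilde ip (modBracket 𝒱 φ ψ) d v =
          ∑ ab ∈ Finset.HasAntidiagonal.antidiagonal d, ksign ((ab.1 : ZMod 2) * q ab.2) •
            insertAt (tilde ip φ ab.1) (ψ ab.2) p v) ∧
    -- `φ ↦ φ̃` identifies `CC(V)` with the module of scalar valued cochains, which is
    -- the product of its bihomogeneous parts
    Set.BijOn (tilde ip) (CC 𝒱 ip) (Forms K 𝒱 : Set (FormFamily V K)) ∧
    (∀ f : Forms K 𝒱, ∃! c : ZMod 2 → ℕ → Forms K 𝒱,
      (∀ (q : ZMod 2) (d : ℕ), c q d ∈ bidegreePart 𝒦 𝒱 (q, (d : ℤ))) ∧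
        ∀ d : ℕ, f.1 d = ∑ q : ZMod 2, (c q d).1 d) ∧
    -- the induced graded Lie algebra
    ∃ B : Forms K 𝒱 →+ Forms K 𝒱 →+ Forms K 𝒱,
      (∀ φ ∈ CC 𝒱 ip, ∀ ψ ∈ CC 𝒱 ip, ∀ f g : Forms K 𝒱, f.1 = tilde ip φ → g.1 = tilde ip ψ →
        (B f g).1 = tilde ip (modBracket 𝒱 φ ψ)) ∧
      IsGradedLieBracket K (bidegreePart 𝒦 𝒱) totalForm B ∧
      IsGradedLieBracket K (totalParityPart 𝒦 𝒱) (fun s t => s * t) B ∧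
      -- the differential of an `L_∞` structure
      ∀ l : CochainFamily V, IsLInfty K 𝒱 l →
        ∃ D : Forms K 𝒱 →ₗ[K] Forms K 𝒱,
          (∀ φ ∈ CC 𝒱 ip, ∀ f : Forms K 𝒱, f.1 = tilde ip φ →
            ∀ (d : ℕ) (v : Fin (d + 2) → V) (p : Fin (d + 2) → ZMod 2), (∀ i, v i ∈ 𝒱 (p i)) →
              (D f).1 d v =
                ∑ ab ∈ Finset.HasAntidiagonal.antidiagonal d, ksign ((ab.1 : ZMod 2) * ((ab.2 : ZMod 2) + 1)) •
                  insertAt (tilde ip φ ab.1) (l ab.2) p v) ∧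
          IsDifferential (totalParityPart 𝒦 𝒱) D ∧
          -- the case of an invariant inner product
          ((∀ d, IsCyclic 𝒱 ip (l d)) →
            (∀ f g : Forms K 𝒱, g.1 = tilde ip l → D f = B f g) ∧
            IsDGLie (totalParityPart 𝒦 𝒱) B D) :=
  mainTheorem6_general 𝒦 (isLeftRegular_two hK0) 𝒱 hV ip hip
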